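/- For $n=2^k$ ($k\ge 0$) let $C_n$ be McClung's circuit on $n$ qubits. Register $A$ consists of $k=\log_2 n$ qubits and register $B$ of the remaining $n-k$ qubits; the qubits of $B$ correspond one to one to the patterns $a\in\{0,1\}^k$ whose Hamming weight is not $1$. $C_n$ applies (1) a Hadamard gate to every qubit of $A$; (2) for each such $a$, an $X$ gate on the qubit of $B$ belonging to $a$, controlled on $A$ being in the state $|a\rangle$; (3) for each such $a\ne 0$, an $X$ gate on every qubit of $A$ at which $a$ is $1$, controlled on the qubit of $B$ belonging to $a$. Let $|\psi_t\rangle$ be the state after the first $t$ gates on input $|0\rangle^{\otimes n}$, and let $|W_n\rangle=\frac1{\sqrt n}\sum_{|x|=1}|x\rangle$. A Pauli-LIMDD is a decision diagram with one level per qubit whose edges are labelled by $0$ or by a Pauli LIM $\lambda P_n\otimes\cdots\otimes P_1$ ($\lambda\in\mathbb C\setminus\{0\}$, each $P_j$ one of $I,X,Y,Z$); the leaf represents $1$, an edge with label $A$ to a node $v$ represents $A|v\rangle$, and a node with low edge $e_0$ and high edge $e_1$ represents $|0\rangle|e_0\rangle+|1\rangle|e_1\rangle$. The Pauli-LIMDD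 simulation of a circuit starts from the diagram of $|0\rangle^{\otimes n}$ and, for each gate in turn, builds a LIMDD of the gate's matrix and applies it to the diagram of the current state by the recursive procedure ApplyGate. This uses the procedures Add and MakeEdge (which brings nodes into canonical form by means of generators of their Pauli stabilizer groups, and merges equal nodes), and all three store results in tables and caches. Running time is the number of elementary steps: operations on complex or real scalars (arithmetic, comparison), on single-qubit Paulis and on indices have unit cost, and table lookups are linear searches. **Theorem.** There is a polynomial $p$ such that, for every $n=2^k$: $C_n|0\rangle^{\otimes n}=|W_n\rangle$; the Pauli-LIMDD simulation of $C_n$, started from empty tables, takes at most $p(n)$ steps and returns, for every $t$ from $0$ to the number of gates, a Pauli-LIMDD representing $|\psi_t\rangle$ that has at most $p(n)$ nodes. For each of these states, the subfunction rank (the maximum over $\ell$ of the number of distinct nonzero subfunctions of the amplitude function obtained by fixing the first $\ell$ bits) is at most the computational-basis rank (the number of nonzero amplitudes), and the latter is at most $n$. Moreover, on each of these diagrams the LIMDD procedures compute, in at most $p(n)$ further steps each: any single computational-basis amplitude; the probability of either outcome when any single qubit is measured in the computational basis; and a Pauli-LIMDD of the corresponding (unnormalised) post-measurement state. -/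

import Mathlib

/-!
Pauli-LIMDDs (decision diagrams whose edges carry Pauli local invertible maps), the algorithms that
manipulate them, with a step count, and McClung's circuit for the W state.

Bits of an `n`-qubit basis state are indexed by `Fin n`, index `0` being the most significant ("top")
qubit, the one that the root of a diagram branches on.

Cost model.  The algorithms run in the state monad `Sim`; the field `steps` of the store counts
elementary steps.  One step is one arithmetic operation or comparison on scalars, one operation on a
single-qubit Pauli or on a bounded number of indices or pointers, or one access to an array entry.
So an operation on an `m`-qubit LIM (product, inverse, scaling, comparison, adding or removing a
tensor factor) costs `m + 1`; this is what `charge k m` counts, `k` times.  Tables and caches are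
plain lists, and a lookup in them is charged for every entry that it inspects.
-/

noncomputable section

namespace Limdd

/-! ### Pauli operators and Pauli LIMs -/

/-- Amplitude vectors of (not necessarily normalised) `n`-qubit states. -/
abbrev Ket (n : ℕ) : Type := (Fin n → Bool) → ℂ

/-- The single-qubit Pauli operators. -/
inductive Pauli : Type
  | I | X | Y | Z
deriving DecidableEq

namespace Pauli

/-- The `2 × 2` matrix of a Pauli operator; `false` is the basis state `0`, `true` is `1`. -/
def mat : Pauli → Matrix Bool Bool ℂ
  | I => fun r c => if r = c then 1 else 0
  | X => fun r c => if r = c then 0 else 1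
  | Y => fun r c => if r = c then 0 else if r then Complex.I else -Complex.I
  | Z => fun r c => if r = c then (if r then -1 else 1) else 0

/-- The bit `x` in `X^x Z^z`: is the operator antidiagonal? -/
def xbit : Pauli → Bool
  | I => false | X => true | Y => true | Z => false

/-- The bit `z` in `X^x Z^z`. -/
def zbit : Pauli → Bool
  | I => false | X => false | Y => true | Z => true

/-- The Pauli operator that equals `X^x Z^z` up to a phase. -/
def ofBits : Bool → Bool → Pauli
  | false, false => I
  | true, false => X
  | true, true => Y
  | false, true => Z

/-- The product of two Pauli operators, up to the phase `phase p q`. -/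
def mul (p q : Pauli) : Pauli := ofBits (xor p.xbit q.xbit) (xor p.zbit q.zbit)

/-- The phase in `p q = phase p q • mul p q`. -/
def phase : Pauli → Pauli → ℂ
  | X, Y => Complex.I | Y, Z => Complex.I | Z, X => Complex.I
  | Y, X => -Complex.I | Z, Y => -Complex.I | X, Z => -Complex.I
  | _, _ => 1

end Pauli

/-- An `n`-qubit Pauli LIM `coeff • ops 0 ⊗ ⋯ ⊗ ops (n-1)`, where `coeff` is meant to be nonzero. -/
@[ext] structure LIM (n : ℕ) : Type where
  coeff : ℂ
  ops : Fin n → Pauli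

namespace LIM

variable {n : ℕ}

/-- The operator denoted by a LIM. -/
def toMatrix (A : LIM n) : Matrix (Fin n → Bool) (Fin n → Bool) ℂ :=
  fun r c => A.coeff * ∏ j, (A.ops j).mat (r j) (c j)

instance : One (LIM n) := ⟨⟨1, fun _ => Pauli.I⟩⟩

instance : Mul (LIM n) :=
  ⟨fun A B => ⟨A.coeff * B.coeff * ∏ j, (A.ops j).phase (B.ops j),
    fun j => (A.ops j).mul (B.ops j)⟩⟩

/-- Pauli strings are involutions, so only the scalar has to be inverted. -/
instance : Inv (LIM n) := ⟨fun A => ⟨A.coeff⁻¹, A.ops⟩⟩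

def scale (c : ℂ) (A : LIM n) : LIM n := ⟨c * A.coeff, A.ops⟩

/-- The Pauli string of a LIM, with scalar `1`. -/
def pauliString (A : LIM n) : LIM n := ⟨1, A.ops⟩

/-- `p ⊗ A`. -/
def cons (p : Pauli) (A : LIM n) : LIM (n + 1) := ⟨A.coeff, Fin.cons p A.ops⟩

end LIM

/-! ### Decision diagrams -/

/-- An edge to a node of level `n`: a label and the identifier of the target on its level.
`none` is an edge with label `0`, which denotes the zero vector. -/
abbrev Edge (n : ℕ) : Type := Option (LIM n × ℕ)

/-- A node of level `m + 1`: its children, on level `m`, and the labels of its two edges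
(`none` is the label `0`). -/
@[ext] structure Node (m : ℕ) : Type where
  low : ℕ
  lowLabel : Option (LIM m)
  high : ℕ
  highLabel : Option (LIM m)

/-- The node set of a diagram: `T m` lists the nodes of level `m + 1`, and a node is identified by its
position in that list.  The leaf is the node `0` of level `0`. -/
abbrev Table : Type := (m : ℕ) → List (Node m)

namespace Table

/-- Is `i` the identifier of a node of level `n`? -/
def HasNode (T : Table) : (n : ℕ) → ℕ → Prop
  | 0, i => i = 0
  | m + 1, i => i < (T m).length

/-- Labels are Pauli LIMs (or `0`) and every edge ends in a node of the next lower level. -/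
def WellFormed (T : Table) : Prop :=
  ∀ m, ∀ v ∈ T m,
    T.HasNode m v.low ∧ T.HasNode m v.high ∧
    (∀ A, v.lowLabel = some A → A.coeff ≠ 0) ∧ (∀ A, v.highLabel = some A → A.coeff ≠ 0)

/-- The action of an edge label on a vector. -/
def actLabel {n : ℕ} : Option (LIM n) → Ket n → Ket n
  | none, _ => 0
  | some A, φ => A.toMatrix.mulVec φ

/-- The state of a node: the leaf denotes `1`, and a node `v` denotes
`|0⟩ ⊗ |low edge of v⟩ + |1⟩ ⊗ |high edge of v⟩`. -/
def nodeKet (T : Table) : (n : ℕ) → ℕ → Ket n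
  | 0, _ => fun _ => 1
  | m + 1, i =>
    match (T m)[i]? with
    | none => 0
    | some v => fun x =>
        if x 0 then actLabel v.highLabel (nodeKet T m v.high) (Fin.tail x)
        else actLabel v.lowLabel (nodeKet T m v.low) (Fin.tail x)

/-- The state of an edge. -/
def edgeKet (T : Table) {n : ℕ} : Edge n → Ket n
  | none => 0
  | some (A, i) => A.toMatrix.mulVec (nodeKet T n i)

/-- The nodes, as pairs (level, identifier), that are reachable from a node, itself included. -/
def nodesBelow (T : Table) : (n : ℕ) → ℕ → Finset (ℕ × ℕ)
  | 0, _ => {(0, 0)}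
  | m + 1, i =>
    match (T m)[i]? with
    | none => {(m + 1, i)}
    | some v => insert (m + 1, i) (nodesBelow T m v.low ∪ nodesBelow T m v.high)

/-- The number of nodes of the diagram with root edge `e`. -/
def size (T : Table) {n : ℕ} : Edge n → ℕ
  | none => 0
  | some (_, i) => (nodesBelow T n i).card

/-- `T` and the root edge `e` form a Pauli-LIMDD that represents the state `φ`. -/
def Represents (T : Table) {n : ℕ} (e : Edge n) (φ : Ket n) : Prop :=
  T.WellFormed ∧ (∀ A i, e = some (A, i) → A.coeff ≠ 0 ∧ T.HasNode n i) ∧ edgeKet T e = φ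

end Table

/-! ### The store and the step counter -/

/-- The data that the algorithms keep. -/
structure Store : Type where
  /-- the unique table -/
  nodes : Table
  /-- `gens m` lists, in the order of `nodes m`, generators of the stabilizer groups of the nodes -/
  gens : (m : ℕ) → List (List (LIM (m + 1)))
  addCache : (m : ℕ) → List ((ℕ × LIM m × ℕ) × Edge m)
  applyCache : (m : ℕ) → List (((LIM (2 * m) × ℕ) × (LIM m × ℕ)) × Edge m)
  normCache : (m : ℕ) → List (ℕ × ℝ)
  projCache : (m : ℕ) → List ((ℕ × Fin m × Bool) × ℝ)
  postCache : (m : ℕ) → List ((ℕ × Fin m × Bool) × Edge m)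
  steps : ℕ

/-- The store that contains nothing but the leaf. -/
def Store.empty : Store :=
  ⟨fun _ => [], fun _ => [], fun _ => [], fun _ => [], fun _ => [], fun _ => [], fun _ => [], 0⟩

/-- Computations on the store. -/
abbrev Sim (α : Type) : Type := StateM Store α

/-- Count `k` elementary steps. -/
def tick (k : ℕ) : Sim Unit := modify fun s => { s with steps := s.steps + k }

/-- Count `k` operations on `m`-qubit LIMs. -/
def charge (k m : ℕ) : Sim Unit := tick (k * (m + 1))

open scoped Classical in
/-- Linear search in an association list; `w` is the cost of comparing two keys. -/
def scan {κ β : Type} (w : ℕ) (key : κ) : List (κ × β) → Sim (Option β)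
  | [] => do
    tick 1
    pure none
  | (k, b) :: l => do
    tick w
    if k = key then pure (some b) else scan w key l

/-- Look a node of level `m + 1` up by its identifier. -/
def getNode (m : ℕ) (i : ℕ) : Sim (Option (Node m)) := do
  tick 1
  let s ← get
  pure (s.nodes m)[i]?

/-- The stored generators of the stabilizer group of a node of level `m`. -/
def getGens : (m : ℕ) → ℕ → Sim (List (LIM m))
  | 0, _ => do
    tick 1
    pure []
  | m + 1, i => do
    tick 1
    let s ← get
    pure ((s.gens m)[i]?.getD [])

/-! ### Linear algebra on check vectors -/

section LinearAlgebra

variable {n : ℕ}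

/-- A position in a check vector `(x_n, …, x_1 | z_n, …, z_1)`; `true` stands for the Z block. -/
abbrev Col (n : ℕ) : Type := Bool × Fin n

/-- All positions, most significant first. -/
def cols (n : ℕ) : List (Col n) :=
  (List.finRange n).map (fun j => (false, j)) ++ (List.finRange n).map (fun j => (true, j))

/-- The entry of the check vector of a LIM. -/
def bit (c : Col n) (A : LIM n) : Bool := if c.1 then (A.ops c.2).zbit else (A.ops c.2).xbit

/-- A pair of an element of a first and an element of a second stabilizer group.  Its check vector is
that of the product of the two. -/
abbrev Row (n : ℕ) : Type := LIM n × LIM n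

def Row.bit (c : Col n) (r : Row n) : Bool := xor (Limdd.bit c r.1) (Limdd.bit c r.2)

/-- Gaussian elimination on rows: returns the rows of an echelon form with their pivots, the most
significant pivot first, and the rows whose check vector has become zero. -/
def eliminate : List (Col n) → List (Row n) → Sim (List (Col n × Row n) × List (Row n))
  | [], rows => do
    tick 1
    pure ([], rows)
  | c :: cs, rows => do
    charge (3 * rows.length + 1) n
    let (ones, zeros) := rows.partition (Row.bit c)
    match ones with
    | [] => eliminate cs rows
    | p :: rest => do
      let (pivots, nulls) ← eliminate cs (rest.map (fun r => (p.1 * r.1, p.2 * r.2)) ++ zeros)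
      pure ((c, p) :: pivots, nulls)

/-- Given the outcome of `eliminate`, find group elements `(g₀, g₁)` for which the check vector of
`A g₀ g₁` is lexicographically minimal. -/
def reduceRow (A : LIM n) : List (Col n × Row n) → Row n → Sim (Row n)
  | [], r => do
    tick 1
    pure r
  | (c, p) :: l, r => do
    charge 3 n
    if xor (bit c A) (r.bit c) then reduceRow A l (r.1 * p.1, r.2 * p.2)
    else reduceRow A l r

/-- Eliminate with the generators `G₀` of a first and `G₁` of a second group. -/
def eliminatePair (G₀ G₁ : List (LIM n)) : Sim (List (Col n × Row n) × List (Row n)) := do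
  charge (G₀.length + G₁.length + 2) n
  eliminate (cols n) (G₀.map (fun g => (g, 1)) ++ G₁.map (fun g => (1, g)))

/-- The canonical label of an edge with label `A` to node `v`: the lexicographically least `A g` with
`g` in the stabilizer group of `v`. -/
def rootLabel (A : LIM n) (v : ℕ) : Sim (LIM n) := do
  let G ← getGens n v
  let (pivots, _) ← eliminatePair G []
  let (g, _) ← reduceRow A pivots (1, 1)
  charge 1 n
  pure (A * g)

open scoped Classical in
/-- Given the outcome of `eliminate` for two stabilizer groups (`opp` lists the null rows `(h, -h)`),
find an element of the intersection of the cosets `π₀ ⟨G₀⟩` and `π₁ ⟨G₁⟩`, if there is one. -/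
def cosetMeet (pivots : List (Col n × Row n)) (opp : List (Row n)) (π₀ π₁ : LIM n) :
    Sim (Option (LIM n)) := do
  charge 8 n
  let A := π₁⁻¹ * π₀
  let (g₀, g₁) ← reduceRow A pivots (1, 1)
  let C := A * g₀ * g₁
  if C = 1 then pure (some (π₀ * g₀))
  else if C = LIM.scale (-1) 1 then
    match opp with
    | [] => pure none
    | h :: _ => pure (some (π₀ * g₀ * h.1))
  else pure none

open scoped Classical in
/-- Generators of the stabilizer group of the node with low edge `1 · v₀` and high edge `B · v₁`
(label `0` if `B = none`), from those of its children. -/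
def stabilizerGens (v₀ : ℕ) (B : Option (LIM n)) (v₁ : ℕ) : Sim (List (LIM (n + 1))) := do
  let G₀ ← getGens n v₀
  match B with
  | none => do
    charge (G₀.length + 1) (n + 1)
    pure (G₀.map (LIM.cons Pauli.I) ++ [LIM.cons Pauli.Z 1])
  | some B => do
    let G ← getGens n v₁
    charge (2 * G.length + 1) n
    let G₁ := G.map (fun g => B * g * B⁻¹)
    let (pivots, nulls) ← eliminatePair G₀ G₁
    charge (2 * nulls.length + 1) n
    let (equal, opp) := nulls.partition (fun r => decide (r.1 = r.2))
    let common := equal.map Prod.fst ++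
      (match opp with
        | [] => []
        | h :: rest => rest.map (fun r => r.1 * h.1))
    let z ← cosetMeet pivots opp 1 (LIM.scale (-1) 1)
    let x ← if v₀ = v₁ then cosetMeet pivots opp B B⁻¹ else pure none
    let y ← if v₀ = v₁ then
        cosetMeet pivots opp (LIM.scale (-Complex.I) B) (LIM.scale (-Complex.I) B)⁻¹
      else pure none
    charge (common.length + 8) (n + 1)
    let gens := common.map (LIM.cons Pauli.I) ++ z.toList.map (LIM.cons Pauli.Z) ++
      x.toList.map (LIM.cons Pauli.X) ++ y.toList.map (LIM.cons Pauli.Y)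
    let (indep, _) ← eliminatePair gens []
    charge (indep.length + 1) (n + 1)
    pure (indep.map (fun q => q.2.1))

end LinearAlgebra

/-! ### Creating nodes and edges in canonical form -/

/-- The angle of a complex number in `[0, 2π)`. -/
def angle (z : ℂ) : ℝ := if 0 ≤ z.arg then z.arg else z.arg + 2 * Real.pi

/-- The lexicographic order of scalars by modulus and angle. -/
def scalarLT (a b : ℂ) : Prop := ‖a‖ < ‖b‖ ∨ (‖a‖ = ‖b‖ ∧ angle a < angle b)

open scoped Classical in
/-- The first element of `d :: l` with the smallest value of `f`. -/
def argMin {α : Type} (f : α → ℂ) (d : α) (l : List α) : α :=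
  l.foldl (fun a b => if scalarLT (f b) (f a) then b else a) d

variable {m : ℕ}

/-- The canonical high label of the node with low edge `1 · v₀` and high edge `A · v₁`, and a root
label by which the canonical node has to be multiplied to give the original one.  The high label is
the least of all `(-1)^s λ^(±1) g₀ P g₁`, where `A = λ P`, `g₀` and `g₁` stabilize `v₀` and `v₁`, and
the exponent `-1` is admitted (`x = true`) only if `v₀ = v₁`. -/
def getLabels (A : LIM m) (v₀ v₁ : ℕ) : Sim (LIM m × LIM (m + 1)) := do
  let G₀ ← getGens m v₀
  let G₁ ← getGens m v₁
  let (pivots, _) ← eliminatePair G₀ G₁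
  let (g₀, g₁) ← reduceRow A pivots (1, 1)
  charge 20 (m + 1)
  let R := g₀ * A.pauliString * g₁
  let label := fun (c : Bool × Bool) =>
    LIM.scale ((if c.2 then -1 else 1) * (if c.1 then A.coeff⁻¹ else A.coeff)) R
  let c := argMin (fun c => (label c).coeff) (false, false)
    (if v₀ = v₁ then [(false, true), (true, false), (true, true)] else [(false, true)])
  let zPart := LIM.cons (if c.2 then Pauli.Z else Pauli.I) g₀⁻¹
  pure (label c, if c.1 then LIM.cons Pauli.X A * zPart else zPart)

open scoped Classical in
/-- Linear search for a node, returning its position. -/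
def findNode (v : Node m) : List (Node m) → ℕ → Sim (Option ℕ)
  | [], _ => do
    tick 1
    pure none
  | w :: l, i => do
    charge 4 m
    if w = v then pure (some i) else findNode v l (i + 1)

/-- Find or create a node with low label `1` in the unique table.  The stabilizer group of a new node
is computed and stored. -/
def intern (v₀ : ℕ) (B : Option (LIM m)) (v₁ : ℕ) : Sim ℕ := do
  let v : Node m := ⟨v₀, some 1, v₁, B⟩
  let s ← get
  let found ← findNode v (s.nodes m) 0
  match found with
  | some i => pure i
  | none => do
    let G ← stabilizerGens v₀ B v₁
    charge (G.length + 4) (m + 1)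
    modify fun s =>
      { s with
        nodes := Function.update s.nodes m (s.nodes m ++ [v])
        gens := Function.update s.gens m (s.gens m ++ [G]) }
    pure (s.nodes m).length

/-- `A · e`. -/
def Edge.act {n : ℕ} (A : LIM n) (e : Edge n) : Edge n := e.map fun p => (A * p.1, p.2)

/-- `c · e`, for a nonzero scalar. -/
def Edge.scale {n : ℕ} (c : ℂ) (e : Edge n) : Edge n := e.map fun p => (LIM.scale c p.1, p.2)

/-- `MakeEdge` for a nonzero low edge `A · v₀` whose target does not succeed that of the high edge. -/
def makeOrdered (A : LIM m) (v₀ : ℕ) (e₁ : Edge m) : Sim (Edge (m + 1)) := do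
  charge 6 (m + 1)
  match e₁ with
  | none => do
    let i ← intern (m := m) v₀ none v₀
    pure (some (LIM.cons Pauli.I A, i))
  | some (B, v₁) => do
    let (high, root) ← getLabels (A⁻¹ * B) v₀ v₁
    let i ← intern v₀ (some high) v₁
    pure (some (LIM.cons Pauli.I A * root, i))

/-- `MakeEdge`: an edge for `|0⟩ ⊗ |e₀⟩ + |1⟩ ⊗ |e₁⟩`.  Nodes are ordered by their position in the
unique table. -/
def makeEdge (e₀ e₁ : Edge m) : Sim (Edge (m + 1)) := do
  charge 2 (m + 1)
  match e₀, e₁ with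
  | none, none => pure none
  | some (A, v), none => makeOrdered A v none
  | none, some (B, w) => do
    let e ← makeOrdered B w none
    pure (e.act (LIM.cons Pauli.X 1))
  | some (A, v), some (B, w) =>
    if v ≤ w then makeOrdered A v (some (B, w))
    else do
      let e ← makeOrdered B w (some (A, v))
      pure (e.act (LIM.cons Pauli.X 1))

/-- `Follow`: if `|e⟩ = |0⟩ ⊗ |φ₀⟩ + |1⟩ ⊗ |φ₁⟩`, an edge for `|φ_b⟩`. -/
def follow (b : Bool) (e : Edge (m + 1)) : Sim (Edge m) := do
  charge 4 (m + 1)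
  match e with
  | none => pure none
  | some (A, v) => do
    let node ← getNode m v
    match node with
    | none => pure none
    | some u =>
      let d := xor b (A.ops 0).xbit
      let rest : LIM m := ⟨A.coeff * (A.ops 0).mat b d, Fin.tail A.ops⟩
      pure (if d then u.highLabel.map (fun L => (rest * L, u.high))
        else u.lowLabel.map (fun L => (rest * L, u.low)))

/-! ### Addition and gate application -/

open scoped Classical in
/-- `Add`: an edge for `|e⟩ + |f⟩`.  Of two nonzero edges the one with the earlier target is taken
first, and its label is factored out of the key of the cache. -/
def addEdges : (n : ℕ) → Edge n → Edge n → Sim (Edge n)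
  | 0, e, f => do
    tick 3
    match e, f with
    | none, f => pure f
    | e, none => pure e
    | some (A, _), some (B, _) =>
      pure (if A.coeff + B.coeff = 0 then none else some (⟨A.coeff + B.coeff, A.ops⟩, 0))
  | m + 1, e, f => do
    charge 8 (m + 1)
    match e, f with
    | none, f => pure f
    | e, none => pure e
    | some e, some f =>
      let (A, v) := if e.2 ≤ f.2 then e else f
      let (B, w) := if e.2 ≤ f.2 then f else e
      let C ← rootLabel (A⁻¹ * B) w
      let s ← get
      let hit ← scan (m + 4) (v, C, w) (s.addCache (m + 1))
      match hit with
      | some a => pure (Edge.act A a)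
      | none => do
        let e₀ ← follow false (some (A, v))
        let f₀ ← follow false (some (B, w))
        let a₀ ← addEdges m e₀ f₀
        let e₁ ← follow true (some (A, v))
        let f₁ ← follow true (some (B, w))
        let a₁ ← addEdges m e₁ f₁
        let a ← makeEdge a₀ a₁
        modify fun s =>
          { s with
            addCache := Function.update s.addCache (m + 1)
              (((v, C, w), Edge.act A⁻¹ a) :: s.addCache (m + 1)) }
        pure a

/-- `ApplyGate`: apply the matrix with diagram `u` (on `2 n` levels; row and column bits alternate) to
the state with diagram `e`. -/
def applyGate : (n : ℕ) → Edge (2 * n) → Edge n → Sim (Edge n)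
  | 0, u, e => do
    tick 3
    match u, e with
    | some (A, _), some (B, _) => pure (some (⟨A.coeff * B.coeff, B.ops⟩, 0))
    | _, _ => pure none
  | n + 1, u, e => do
    charge 12 (2 * (n + 1))
    match u, e with
    | some (A, v), some (B, w) =>
      let P ← rootLabel A.pauliString v
      let Q ← rootLabel B.pauliString w
      let s ← get
      let hit ← scan (3 * n + 8) ((P, v), (Q, w)) (s.applyCache (n + 1))
      match hit with
      | some a => pure (a.scale (A.coeff * B.coeff))
      | none => do
        let child := fun (r c : Bool) => do
          let row ← follow (m := 2 * n + 1) r (some (A, v))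
          let entry ← follow (m := 2 * n) c row
          let sub ← follow c (some (B, w))
          applyGate n entry sub
        let f₀₀ ← child false false
        let f₀₁ ← child false true
        let f₁₀ ← child true false
        let f₁₁ ← child true true
        let e₀ ← addEdges n f₀₀ f₀₁
        let e₁ ← addEdges n f₁₀ f₁₁
        let a ← makeEdge e₀ e₁
        modify fun s =>
          { s with
            applyCache := Function.update s.applyCache (n + 1)
              ((((P, v), (Q, w)), a.scale (A.coeff * B.coeff)⁻¹) :: s.applyCache (n + 1)) }
        pure a
    | _, _ => pure none

/-! ### Gates and circuits -/

/-- The role of a qubit in a controlled-X gate: not involved, a control that fires on the given bit,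
or a target. -/
inductive Role : Type
  | idle
  | control (b : Bool)
  | target
deriving DecidableEq

/-- Gates on `n` qubits: a Hadamard gate on one qubit, or an X gate on every target qubit that is
controlled by all control qubits. -/
inductive Gate (n : ℕ) : Type
  | hadamard (j : Fin n)
  | controlledX (role : Fin n → Role)

/-- The permutation of the basis states that a controlled-X gate performs. -/
def flipTargets {n : ℕ} (role : Fin n → Role) (c : Fin n → Bool) : Fin n → Bool :=
  fun i => if (∀ j b, role j = Role.control b → c j = b) ∧ role i = Role.target then !(c i) else c i

/-- The unitary matrix of a gate. -/
def Gate.mat {n : ℕ} : Gate n → Matrix (Fin n → Bool) (Fin n → Bool) ℂ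
  | .hadamard j => fun r c =>
      if ∀ i, i ≠ j → r i = c i then ((1 / Real.sqrt 2 : ℝ) : ℂ) * (if r j && c j then -1 else 1) else 0
  | .controlledX role => fun r c => if r = flipTargets role c then 1 else 0

/-- The state `|0⟩^n`. -/
def zeroKet (n : ℕ) : Ket n := fun x => if x = fun _ => false then 1 else 0

/-- The state that a circuit, a list of gates in the order of application, produces from `|0⟩^n`. -/
def runCircuit {n : ℕ} (C : List (Gate n)) : Ket n :=
  C.foldl (fun φ U => U.mat.mulVec φ) (zeroKet n)

/-! ### Diagrams of gates, and simulation -/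

/-- The diagram of a matrix from those of its four quadrants. -/
def block (e₀₀ e₀₁ e₁₀ e₁₁ : Edge m) : Sim (Edge (m + 2)) := do
  let e₀ ← makeEdge e₀₀ e₀₁
  let e₁ ← makeEdge e₁₀ e₁₁
  makeEdge e₀ e₁

/-- The diagram of the identity matrix. -/
def identityEdge : (n : ℕ) → Sim (Edge (2 * n))
  | 0 => do
    tick 1
    pure (some (1, 0))
  | n + 1 => do
    let e ← identityEdge n
    block e none none e

/-- The diagram of a Hadamard gate. -/
def hadamardEdge : (n : ℕ) → Fin n → Sim (Edge (2 * n))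
  | 0, _ => pure none
  | n + 1, j => do
    charge 3 (2 * n)
    if h : j = 0 then do
      let e ← identityEdge n
      let f := e.scale ((1 / Real.sqrt 2 : ℝ) : ℂ)
      block f f f (f.scale (-1))
    else do
      let e ← hadamardEdge n (j.pred h)
      block e none none e

/-- Diagrams for the submatrices of a controlled-X gate: the identity, the part that acts if all
controls fire, the part that acts otherwise, and the sum of the latter two. -/
structure XEdges (n : ℕ) : Type where
  ident : Edge (2 * n)
  fire : Edge (2 * n)
  rest : Edge (2 * n)
  full : Edge (2 * n)

def controlledXEdges : (n : ℕ) → (Fin n → Role) → Sim (XEdges n)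
  | 0, _ => do
    tick 4
    pure ⟨some (1, 0), some (1, 0), none, some (1, 0)⟩
  | n + 1, role => do
    tick 4
    let d ← controlledXEdges n (Fin.tail role)
    let ident ← block d.ident none none d.ident
    match role 0 with
    | .idle => do
      let fire ← block d.fire none none d.fire
      let rest ← block d.rest none none d.rest
      let full ← block d.full none none d.full
      pure ⟨ident, fire, rest, full⟩
    | .target => do
      let fire ← block none d.fire d.fire none
      let rest ← block d.rest none none d.rest
      let full ← block d.rest d.fire d.fire d.rest
      pure ⟨ident, fire, rest, full⟩
    | .control false => do
      let fire ← block d.fire none none none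
      let rest ← block d.rest none none d.ident
      let full ← block d.full none none d.ident
      pure ⟨ident, fire, rest, full⟩
    | .control true => do
      let fire ← block none none none d.fire
      let rest ← block d.ident none none d.rest
      let full ← block d.ident none none d.full
      pure ⟨ident, fire, rest, full⟩

/-- The diagram of a gate. -/
def gateEdge {n : ℕ} : Gate n → Sim (Edge (2 * n))
  | .hadamard j => hadamardEdge n j
  | .controlledX role => do
    let d ← controlledXEdges n role
    pure d.full

/-- The diagram of `|0⟩^n`. -/
def zeroEdge : (n : ℕ) → Sim (Edge n)
  | 0 => do
    tick 1
    pure (some (1, 0))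
  | n + 1 => do
    let e ← zeroEdge n
    makeEdge e none

/-- Apply the gates of a circuit to the state with diagram `e`, and return the diagrams of all states
from `e` on. -/
def simulateFrom {n : ℕ} : List (Gate n) → Edge n → Sim (List (Edge n))
  | [], e => do
    tick 1
    pure [e]
  | U :: C, e => do
    tick 1
    let u ← gateEdge U
    let f ← applyGate n u e
    let l ← simulateFrom C f
    pure (e :: l)

/-- Simulate a circuit on input `|0⟩^n`: the result lists the root edges of the diagrams of the initial
state, all intermediate states and the output state. -/
def simulate {n : ℕ} (C : List (Gate n)) : Sim (List (Edge n)) := do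
  let e ← zeroEdge n
  simulateFrom C e

/-! ### Reading amplitudes and measuring -/

/-- The amplitude of a basis state. -/
def amplitude : (n : ℕ) → Edge n → (Fin n → Bool) → Sim ℂ
  | 0, e, _ => do
    tick 1
    match e with
    | none => pure 0
    | some (A, _) => pure A.coeff
  | _ + 1, e, x => do
    tick 1
    let f ← follow (x 0) e
    amplitude _ f (Fin.tail x)

/-- The squared norm of the state of an edge. -/
def squaredNorm : (n : ℕ) → Edge n → Sim ℝ
  | 0, e => do
    tick 2
    match e with
    | none => pure 0
    | some (A, _) => pure (‖A.coeff‖ ^ 2)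
  | m + 1, e => do
    charge 5 (m + 1)
    match e with
    | none => pure 0
    | some (A, v) => do
      let s ← get
      let hit ← scan 2 v (s.normCache (m + 1))
      match hit with
      | some a => pure (‖A.coeff‖ ^ 2 * a)
      | none => do
        let e₀ ← follow false (some (1, v))
        let a₀ ← squaredNorm m e₀
        let e₁ ← follow true (some (1, v))
        let a₁ ← squaredNorm m e₁
        modify fun s =>
          { s with
            normCache := Function.update s.normCache (m + 1)
              ((v, a₀ + a₁) :: s.normCache (m + 1)) }
        pure (‖A.coeff‖ ^ 2 * (a₀ + a₁))

/-- The squared norm of the state of an edge after the projection of qubit `q` to `|y⟩`. -/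
def squaredNormProjected : (n : ℕ) → Edge n → Fin n → Bool → Sim ℝ
  | 0, _, _, _ => pure 0
  | m + 1, e, q, y => do
    charge 6 (m + 1)
    match e with
    | none => pure 0
    | some (A, v) => do
      let b := xor y (A.ops q).xbit
      let s ← get
      let hit ← scan 4 (v, q, b) (s.projCache (m + 1))
      match hit with
      | some a => pure (‖A.coeff‖ ^ 2 * a)
      | none => do
        let a ←
          if h : q = 0 then do
            let f ← follow b (some (1, v))
            squaredNorm m f
          else do
            let e₀ ← follow false (some (1, v))
            let a₀ ← squaredNormProjected m e₀ (q.pred h) b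
            let e₁ ← follow true (some (1, v))
            let a₁ ← squaredNormProjected m e₁ (q.pred h) b
            pure (a₀ + a₁)
        modify fun s =>
          { s with
            projCache := Function.update s.projCache (m + 1)
              (((v, q, b), a) :: s.projCache (m + 1)) }
        pure (‖A.coeff‖ ^ 2 * a)

/-- The probability of the outcome `y` when qubit `q` is measured in the computational basis. -/
def measurementProbability {n : ℕ} (e : Edge n) (q : Fin n) (y : Bool) : Sim ℝ := do
  tick 1
  let p ← squaredNormProjected n e q y
  let t ← squaredNorm n e
  pure (p / t)

/-- The diagram of the (unnormalised) state after the outcome `y` of a measurement of qubit `q`. -/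
def updatePostMeas : (n : ℕ) → Edge n → Fin n → Bool → Sim (Edge n)
  | 0, _, _, _ => pure none
  | m + 1, e, q, y => do
    charge 6 (m + 1)
    match e with
    | none => pure none
    | some (A, v) => do
      let b := xor y (A.ops q).xbit
      let s ← get
      let hit ← scan 4 (v, q, b) (s.postCache (m + 1))
      match hit with
      | some a => pure (Edge.act A a)
      | none => do
        let a ←
          if h : q = 0 then do
            let f ← follow b (some (1, v))
            if b then makeEdge none f else makeEdge f none
          else do
            let e₀ ← follow false (some (1, v))
            let a₀ ← updatePostMeas m e₀ (q.pred h) b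
            let e₁ ← follow true (some (1, v))
            let a₁ ← updatePostMeas m e₁ (q.pred h) b
            makeEdge a₀ a₁
        modify fun s =>
          { s with
            postCache := Function.update s.postCache (m + 1)
              (((v, q, b), a) :: s.postCache (m + 1)) }
        pure (Edge.act A a)

/-- The projection of a state to the subspace in which qubit `q` is `|y⟩`. -/
def projectKet {n : ℕ} (q : Fin n) (y : Bool) (φ : Ket n) : Ket n :=
  fun x => if x q = y then φ x else 0

/-- The Born probability of the outcome `y` when qubit `q` of the unit vector `φ` is measured. -/
def bornProbability {n : ℕ} (q : Fin n) (y : Bool) (φ : Ket n) : ℝ :=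
  ∑ x, ‖projectKet q y φ x‖ ^ 2

/-! ### The W state and its circuit -/

/-- The state `|W_n⟩`. -/
def wKet (n : ℕ) : Ket n := fun x =>
  if (Finset.univ.filter fun i => x i = true).card = 1 then ((1 / Real.sqrt n : ℝ) : ℂ) else 0

/-- The bit patterns of register `A` (`k` qubits, pattern `a < 2 ^ k`) whose Hamming weight is not `1`,
in increasing order. -/
def patterns (k : ℕ) : List ℕ :=
  (List.range (2 ^ k)).filter fun a => decide (((List.range k).filter a.testBit).length ≠ 1)

/-- McClung's circuit on `n = 2 ^ k` qubits.  Register `A` consists of the qubits `0, …, k - 1`, and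
register `B` of the others; the `i`-th qubit of `B` belongs to the `i`-th of the `patterns`.
First a Hadamard gate is applied to each qubit of `A`.  Then, for each pattern, its qubit of `B` is
flipped if `A` is in that pattern.  Finally, for each nonzero pattern, the pattern is erased from `A`
by flipping its ones if its qubit of `B` is `1`. -/
def wCircuit (k : ℕ) : List (Gate (2 ^ k)) :=
  ((List.finRange (2 ^ k)).filter fun j => decide (j.val < k)).map Gate.hadamard ++
  (patterns k).zipIdx.map (fun ai => Gate.controlledX fun q =>
    if q.val < k then Role.control (ai.1.testBit q.val)
    else if q.val = k + ai.2 then Role.target else Role.idle) ++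
  ((patterns k).zipIdx.filter fun ai => decide (ai.1 ≠ 0)).map (fun ai => Gate.controlledX fun q =>
    if q.val < k then (if ai.1.testBit q.val then Role.target else Role.idle)
    else if q.val = k + ai.2 then Role.control true else Role.idle)

/-! ### Ranks -/

/-- The number of nonzero amplitudes. -/
def compRank {n : ℕ} (φ : Ket n) : ℕ := Set.ncard {x | φ x ≠ 0}

/-- The number of nonzero subfunctions that are induced by strings of length `l`.  A subfunction is
written here as a function of all bits that does not depend on the first `l` ones. -/
def subRankAt {n : ℕ} (φ : Ket n) (l : ℕ) : ℕ :=
  Set.ncard {f : Ket n | f ≠ 0 ∧ ∃ y : Fin n → Bool,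
    f = fun x => φ (fun i => if i.val < l then y i else x i)}

/-- The subfunction rank. -/
def subRank {n : ℕ} (φ : Ket n) : ℕ := (Finset.range (n + 1)).sup (subRankAt φ)

end Limdd

end

/-!
Pauli-LIMDD simulation of the circuit for the W state takes polynomial time because no state in
the simulation has more than `n` nonzero amplitudes, and because the LIMDD procedures never
descend into zero vectors.

**Why the procedures are fast.** Every node that `MakeEdge` creates has the low label `1`, so by
induction every node denotes a nonzero vector (`Table.Good.nodeKet_ne_zero`), and a label that is
not `0` always leads to a nonzero subvector. Hence a recursion over a diagram visits, on each
level, at most as many edges as the state has nonzero amplitudes, even if no cache lookup ever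
succeeds. For `Add` this gives `spec_addEdges`. `ApplyGate` visits the pairs of a nonzero block of
the gate and a nonzero subvector that meet in the product; they are counted by `calls`. On each
level, the columns of the block matrices of a Hadamard or controlled-X gate have at most two
nonzero blocks, so there are at most `2 * (n + 1) * compRank φ` of these pairs (`callsLe_gate`).
Each such visit performs a bounded number of operations, each of which adds at most one entry to a
table and costs at most a Gaussian elimination with `O(n)` rows and columns, or a linear search in
a table. As the tables only grow by one entry per operation, their sizes are bounded by the number
of operations.

**Why the results are correct.** Neither the speed nor the correctness depends on canonicity of
the labels, nor on completeness of the stabilizer groups. It suffices that the stored generators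
do stabilize the states of their nodes, that there are not too many of them, and that the cache
entries are correct. This is the invariant `Store.Inv`. A Hoare logic (`Spec`) carries it,
together with the count of operations, through all procedures, up to `spec_simulate` and the
readouts.

**The circuit.** The Hadamard gates produce a uniform superposition of at most `2 ^ k = n` basis
states, and controlled-X gates permute basis states, so all states are unit vectors with at most
`n` nonzero amplitudes (`wCircuit_state`). A pattern of weight other than `1` in register `A` is
moved to its own qubit of register `B`, a pattern of weight `1` is left alone; so each basis state
in the superposition is mapped to one of weight `1` (`weight_flipAlong`). Since the map is
injective and there are `n` basis states of either kind, it is onto, and the final state is the W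
state (`runCircuit_wCircuit`).
-/

namespace Limdd

/-! ### Pauli LIMs as operators on amplitude vectors -/

namespace LIM

variable {n : ℕ}

/-- The basis state that a Pauli string maps to `x`, up to a phase. -/
def flip (A : LIM n) (x : Fin n → Bool) : Fin n → Bool := fun j => xor (x j) (A.ops j).xbit

/-- The only nonzero entry in row `x` of the matrix of a LIM. -/
noncomputable def entry (A : LIM n) (x : Fin n → Bool) : ℂ :=
  A.coeff * ∏ j, (A.ops j).mat (x j) (xor (x j) (A.ops j).xbit)

/-- The action of a LIM on amplitude vectors, with the matrix product resolved into its one nonzero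
summand. -/
noncomputable def act (A : LIM n) (φ : Ket n) : Ket n := fun x => A.entry x * φ (A.flip x)

end LIM

theorem Pauli.mat_eq_zero (p : Pauli) {r c : Bool} (h : c ≠ xor r p.xbit) : p.mat r c = 0 := by
  cases p <;> cases r <;> cases c <;> simp_all [Pauli.mat, Pauli.xbit]

theorem Pauli.mat_ne_zero (p : Pauli) (r : Bool) : p.mat r (xor r p.xbit) ≠ 0 := by
  cases p <;> cases r <;> simp [Pauli.mat, Pauli.xbit]

theorem Pauli.norm_mat (p : Pauli) (r : Bool) : ‖p.mat r (xor r p.xbit)‖ = 1 := by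
  cases p <;> cases r <;> simp [Pauli.mat, Pauli.xbit]

theorem Pauli.xbit_mul (p q : Pauli) : (p.mul q).xbit = xor p.xbit q.xbit := by
  cases p <;> cases q <;> rfl

theorem Pauli.zbit_mul (p q : Pauli) : (p.mul q).zbit = xor p.zbit q.zbit := by
  cases p <;> cases q <;> rfl

theorem Pauli.ext_bits {p q : Pauli} (hx : p.xbit = q.xbit) (hz : p.zbit = q.zbit) : p = q := by
  cases p <;> cases q <;> simp_all [Pauli.xbit, Pauli.zbit]

theorem Pauli.phase_ne_zero (p q : Pauli) : p.phase q ≠ 0 := by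
  cases p <;> cases q <;> simp [Pauli.phase]

theorem Pauli.phase_mul_mat (p q : Pauli) (r : Bool) :
    p.phase q * (p.mul q).mat r (xor r (p.mul q).xbit) =
      p.mat r (xor r p.xbit) * q.mat (xor r p.xbit) (xor (xor r p.xbit) q.xbit) := by
  cases p <;> cases q <;> cases r <;>
    simp [Pauli.phase, Pauli.mul, Pauli.mat, Pauli.xbit, Pauli.zbit, Pauli.ofBits]

theorem Pauli.mat_involutive (p : Pauli) (r : Bool) :
    p.mat r (xor r p.xbit) * p.mat (xor r p.xbit) r = 1 := by
  cases p <;> cases r <;> simp [Pauli.mat, Pauli.xbit]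

namespace LIM

variable {n : ℕ}

theorem toMatrix_mulVec (A : LIM n) (φ : Ket n) : A.toMatrix.mulVec φ = A.act φ := by
  funext x
  simp only [Matrix.mulVec, dotProduct, act, entry, toMatrix]
  rw [Finset.sum_eq_single (A.flip x)]
  · rfl
  · intro c _ hc
    obtain ⟨j, hj⟩ := Function.ne_iff.mp hc
    rw [Finset.prod_eq_zero (Finset.mem_univ j) (Pauli.mat_eq_zero _ hj)]
    simp
  · simp

theorem coeff_mul_ne_zero {A B : LIM n} (hA : A.coeff ≠ 0) (hB : B.coeff ≠ 0) :
    (A * B).coeff ≠ 0 := by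
  change A.coeff * B.coeff * ∏ j, (A.ops j).phase (B.ops j) ≠ 0
  exact mul_ne_zero (mul_ne_zero hA hB)
    (Finset.prod_ne_zero_iff.mpr fun j _ => Pauli.phase_ne_zero _ _)

theorem coeff_inv_ne_zero {A : LIM n} (hA : A.coeff ≠ 0) : A⁻¹.coeff ≠ 0 := inv_ne_zero hA

theorem coeff_one_ne_zero : (1 : LIM n).coeff ≠ 0 := one_ne_zero (α := ℂ)

theorem act_mul (A B : LIM n) (φ : Ket n) : (A * B).act φ = A.act (B.act φ) := by
  funext x
  have hflip : (A * B).flip x = B.flip (A.flip x) := by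
    funext j
    change xor (x j) ((A.ops j).mul (B.ops j)).xbit = _
    rw [Pauli.xbit_mul, ← Bool.xor_assoc]
    rfl
  have hentry : (A * B).entry x = A.entry x * B.entry (A.flip x) := by
    change A.coeff * B.coeff * (∏ j, (A.ops j).phase (B.ops j)) *
      ∏ j, ((A.ops j).mul (B.ops j)).mat (x j) (xor (x j) ((A.ops j).mul (B.ops j)).xbit) = _
    rw [mul_assoc, ← Finset.prod_mul_distrib]
    simp only [Pauli.phase_mul_mat, Finset.prod_mul_distrib, entry, flip]
    ring
  simp only [act, hflip, hentry, mul_assoc]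

theorem act_one (φ : Ket n) : (1 : LIM n).act φ = φ := by
  funext x
  have hf : (1 : LIM n).flip x = x := by
    funext j; change xor (x j) false = x j; simp
  have he : (1 : LIM n).entry x = 1 := by
    change (1 : ℂ) * ∏ j, Pauli.mat Pauli.I (x j) (xor (x j) false) = 1
    simp [Pauli.mat]
  simp [act, hf, he]

theorem act_smul (A : LIM n) (c : ℂ) (φ : Ket n) : A.act (c • φ) = c • A.act φ := by
  funext x; simp only [act, Pi.smul_apply, smul_eq_mul]; ring

theorem act_add (A : LIM n) (φ ψ : Ket n) : A.act (φ + ψ) = A.act φ + A.act ψ := by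
  funext x; simp only [act, Pi.add_apply]; ring

theorem act_zero (A : LIM n) : A.act (0 : Ket n) = 0 := by
  funext x; simp [act]

theorem act_scale (c : ℂ) (A : LIM n) (φ : Ket n) : (scale c A).act φ = c • A.act φ := by
  funext x
  change c * A.coeff * _ * _ = c * (A.coeff * _ * _)
  simp only [mul_assoc]; rfl

theorem act_inv_act {A : LIM n} (hA : A.coeff ≠ 0) (φ : Ket n) : A⁻¹.act (A.act φ) = φ := by
  funext x
  have hf : A.flip (A⁻¹.flip x) = x := by
    funext j
    change xor (xor (x j) (A.ops j).xbit) (A.ops j).xbit = x j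
    simp
  have he : A⁻¹.entry x * A.entry (A⁻¹.flip x) = 1 := by
    change (A.coeff⁻¹ * ∏ j, (A.ops j).mat (x j) (xor (x j) (A.ops j).xbit)) *
      (A.coeff * ∏ j, (A.ops j).mat (xor (x j) (A.ops j).xbit)
        (xor (xor (x j) (A.ops j).xbit) (A.ops j).xbit)) = 1
    rw [mul_mul_mul_comm, inv_mul_cancel₀ hA, ← Finset.prod_mul_distrib]
    simp [Pauli.mat_involutive]
  simp only [act, hf, ← mul_assoc, he, one_mul]

theorem act_act_inv {A : LIM n} (hA : A.coeff ≠ 0) (φ : Ket n) : A.act (A⁻¹.act φ) = φ := by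
  have h := act_inv_act (A := A⁻¹) (coeff_inv_ne_zero hA) φ
  have h2 : (A⁻¹)⁻¹ = A := by
    change LIM.mk (A.coeff⁻¹⁻¹) A.ops = A
    rw [inv_inv]
  rwa [h2] at h

theorem act_eq_zero {A : LIM n} (hA : A.coeff ≠ 0) {φ : Ket n} : A.act φ = 0 ↔ φ = 0 := by
  constructor
  · intro h
    rw [← act_inv_act hA φ, h, act_zero]
  · rintro rfl; exact act_zero A

theorem act_pauliString (A : LIM n) (φ : Ket n) :
    A.act φ = A.coeff • A.pauliString.act φ := by
  rw [← act_scale]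
  congr 1
  change A = LIM.mk (A.coeff * 1) A.ops
  rw [mul_one]

theorem norm_entry (A : LIM n) (x : Fin n → Bool) : ‖A.entry x‖ = ‖A.coeff‖ := by
  simp [entry, Pauli.norm_mat]

theorem flip_flip (A : LIM n) (x : Fin n → Bool) : A.flip (A.flip x) = x := by
  funext j; simp [flip]

theorem flip_bijective (A : LIM n) : Function.Bijective A.flip :=
  (Function.LeftInverse.injective (flip_flip A)).bijective_of_finite

end LIM

/-! ### Splitting an amplitude vector along its first qubit -/

section Split

variable {m : ℕ}

/-- The subvector in which the first qubit is `b`. -/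
def sub (b : Bool) (φ : Ket (m + 1)) : Ket m := fun x => φ (Fin.cons b x)

/-- `|0⟩ ⊗ |φ₀⟩ + |1⟩ ⊗ |φ₁⟩`. -/
def join (φ₀ φ₁ : Ket m) : Ket (m + 1) := fun x => if x 0 then φ₁ (Fin.tail x) else φ₀ (Fin.tail x)

@[simp] theorem sub_false_join (φ₀ φ₁ : Ket m) : sub false (join φ₀ φ₁) = φ₀ := by
  funext x; simp [sub, join]

@[simp] theorem sub_true_join (φ₀ φ₁ : Ket m) : sub true (join φ₀ φ₁) = φ₁ := by
  funext x; simp [sub, join]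

theorem join_sub (φ : Ket (m + 1)) : join (sub false φ) (sub true φ) = φ := by
  funext x
  have h : Fin.cons (x 0) (Fin.tail x) = x := Fin.cons_self_tail x
  simp only [sub, join]
  split_ifs with hx
  · rw [← hx, h]
  · rw [← Bool.eq_false_iff.mpr hx, h]

theorem ket_ext_sub {φ ψ : Ket (m + 1)} (h : ∀ b, sub b φ = sub b ψ) : φ = ψ := by
  rw [← join_sub φ, ← join_sub ψ, h, h]

@[simp] theorem sub_zero (b : Bool) : sub b (0 : Ket (m + 1)) = 0 := rfl

@[simp] theorem sub_add (b : Bool) (φ ψ : Ket (m + 1)) : sub b (φ + ψ) = sub b φ + sub b ψ := rfl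

@[simp] theorem sub_smul (b : Bool) (c : ℂ) (φ : Ket (m + 1)) : sub b (c • φ) = c • sub b φ := rfl

theorem join_add (φ₀ φ₁ ψ₀ ψ₁ : Ket m) :
    join φ₀ φ₁ + join ψ₀ ψ₁ = join (φ₀ + ψ₀) (φ₁ + ψ₁) :=
  ket_ext_sub fun b => by cases b <;> simp

theorem smul_join (c : ℂ) (φ₀ φ₁ : Ket m) : c • join φ₀ φ₁ = join (c • φ₀) (c • φ₁) :=
  ket_ext_sub fun b => by cases b <;> simp

@[simp] theorem join_zero : join (0 : Ket m) 0 = 0 := ket_ext_sub fun b => by cases b <;> simp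

theorem join_eq_zero {φ₀ φ₁ : Ket m} : join φ₀ φ₁ = 0 ↔ φ₀ = 0 ∧ φ₁ = 0 := by
  constructor
  · intro h
    exact ⟨by rw [← sub_false_join φ₀ φ₁, h]; rfl, by rw [← sub_true_join φ₀ φ₁, h]; rfl⟩
  · rintro ⟨rfl, rfl⟩; exact join_zero

/-- The subvectors of `A φ` are images of subvectors of `φ` under the remaining tensor factors of
`A`; the first factor decides which subvector is taken, and contributes a scalar. -/
theorem sub_act (A : LIM (m + 1)) (b : Bool) (φ : Ket (m + 1)) :
    sub b (A.act φ) =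
      (LIM.mk (A.coeff * (A.ops 0).mat b (xor b (A.ops 0).xbit)) (Fin.tail A.ops)).act
        (sub (xor b (A.ops 0).xbit) φ) := by
  funext x
  simp only [sub, LIM.act, LIM.entry]
  have hflip : A.flip (Fin.cons b x) =
      Fin.cons (xor b (A.ops 0).xbit) (LIM.flip ⟨A.coeff * (A.ops 0).mat b (xor b (A.ops 0).xbit),
        Fin.tail A.ops⟩ x) := by
    funext j
    refine Fin.cases ?_ (fun j => ?_) j <;> simp [LIM.flip, Fin.tail]
  rw [hflip, Fin.prod_univ_succ]
  simp only [Fin.cons_zero, Fin.cons_succ, Fin.tail]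
  ring

theorem sub_act_cons (p : Pauli) (A : LIM m) (b : Bool) (φ : Ket (m + 1)) :
    sub b ((LIM.cons p A).act φ) =
      p.mat b (xor b p.xbit) • A.act (sub (xor b p.xbit) φ) := by
  rw [sub_act, ← LIM.act_scale]
  congr 1
  simp only [LIM.cons, Fin.cons_zero, Fin.tail_cons, LIM.scale, mul_comm]

theorem act_cons_I (A : LIM m) (φ₀ φ₁ : Ket m) :
    (LIM.cons Pauli.I A).act (join φ₀ φ₁) = join (A.act φ₀) (A.act φ₁) :=
  ket_ext_sub fun b => by
    rw [sub_act_cons]; cases b <;> simp [Pauli.mat, Pauli.xbit]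

theorem act_cons_X (A : LIM m) (φ₀ φ₁ : Ket m) :
    (LIM.cons Pauli.X A).act (join φ₀ φ₁) = join (A.act φ₁) (A.act φ₀) :=
  ket_ext_sub fun b => by
    rw [sub_act_cons]; cases b <;> simp [Pauli.mat, Pauli.xbit]

theorem act_cons_Y (A : LIM m) (φ₀ φ₁ : Ket m) :
    (LIM.cons Pauli.Y A).act (join φ₀ φ₁) =
      join (-Complex.I • A.act φ₁) (Complex.I • A.act φ₀) :=
  ket_ext_sub fun b => by
    rw [sub_act_cons]; cases b <;> simp [Pauli.mat, Pauli.xbit]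

theorem act_cons_Z (A : LIM m) (φ₀ φ₁ : Ket m) :
    (LIM.cons Pauli.Z A).act (join φ₀ φ₁) = join (A.act φ₀) (-A.act φ₁) :=
  ket_ext_sub fun b => by
    rw [sub_act_cons]; cases b <;> simp [Pauli.mat, Pauli.xbit]

end Split

/-! ### The number of nonzero amplitudes -/

section Support

variable {n : ℕ}

theorem compRank_eq_zero {φ : Ket n} : compRank φ = 0 ↔ φ = 0 := by
  rw [compRank, Set.ncard_eq_zero (Set.toFinite _)]
  constructor
  · intro h
    funext x
    by_contra hx
    exact (Set.mem_empty_iff_false x).mp (h ▸ (show x ∈ {x | φ x ≠ 0} from hx))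
  · rintro rfl; simp

@[simp] theorem compRank_zero : compRank (0 : Ket n) = 0 := compRank_eq_zero.mpr rfl

theorem one_le_compRank {φ : Ket n} (h : φ ≠ 0) : 1 ≤ compRank φ :=
  Nat.one_le_iff_ne_zero.mpr fun h0 => h (compRank_eq_zero.mp h0)

/-- A Pauli LIM permutes the basis states up to nonzero factors. -/
theorem compRank_act {A : LIM n} (hA : A.coeff ≠ 0) (φ : Ket n) :
    compRank (A.act φ) = compRank φ := by
  have h : {x | A.act φ x ≠ 0} = A.flip '' {x | φ x ≠ 0} := by
    ext x
    have he : A.entry x ≠ 0 := by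
      rw [← norm_ne_zero_iff, LIM.norm_entry]; exact norm_ne_zero_iff.mpr hA
    simp only [LIM.act, Set.mem_ofPred_eq, Set.mem_image, mul_ne_zero_iff]
    constructor
    · rintro ⟨_, h⟩
      exact ⟨A.flip x, h, A.flip_flip x⟩
    · rintro ⟨y, hy, rfl⟩
      exact ⟨he, by rwa [A.flip_flip]⟩
  rw [compRank, h, Set.ncard_image_of_injective _ A.flip_bijective.injective]
  rfl

theorem compRank_add_le (φ ψ : Ket n) : compRank (φ + ψ) ≤ compRank φ + compRank ψ := by
  refine (Set.ncard_le_ncard (t := {x | φ x ≠ 0} ∪ {x | ψ x ≠ 0}) ?_ (Set.toFinite _)).trans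
    (Set.ncard_union_le _ _)
  intro x hx
  by_contra h
  simp only [Set.mem_union, Set.mem_ofPred_eq, not_or, not_not] at h
  exact hx (by simp [h.1, h.2])

theorem compRank_sub {m : ℕ} (φ : Ket (m + 1)) :
    compRank φ = compRank (sub false φ) + compRank (sub true φ) := by
  have hinj : ∀ b : Bool, Function.Injective
      (fun x : Fin m → Bool => (Fin.cons b x : Fin (m + 1) → Bool)) :=
    fun b => Fin.cons_right_injective (α := fun _ => Bool) b
  have h : {x | φ x ≠ 0} =
      (fun x : Fin m → Bool => (Fin.cons false x : Fin (m + 1) → Bool)) '' {x | sub false φ x ≠ 0} ∪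
      (fun x : Fin m → Bool => (Fin.cons true x : Fin (m + 1) → Bool)) ''
        {x | sub true φ x ≠ 0} := by
    ext x
    simp only [Set.mem_ofPred_eq, Set.mem_union, Set.mem_image, sub]
    constructor
    · intro hx
      have hc : Fin.cons (x 0) (Fin.tail x) = x := Fin.cons_self_tail x
      cases h0 : x 0
      · exact Or.inl ⟨Fin.tail x, by rw [← h0, hc]; exact hx, by rw [← h0, hc]⟩
      · exact Or.inr ⟨Fin.tail x, by rw [← h0, hc]; exact hx, by rw [← h0, hc]⟩
    · rintro (⟨y, hy, rfl⟩ | ⟨y, hy, rfl⟩) <;> exact hy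
  rw [compRank, h, Set.ncard_union_eq _ (Set.toFinite _) (Set.toFinite _),
    Set.ncard_image_of_injective _ (hinj _), Set.ncard_image_of_injective _ (hinj _)]
  · rfl
  · rw [Set.disjoint_left]
    rintro x ⟨y, _, rfl⟩ ⟨z, _, hz⟩
    have := congrFun hz 0
    simp at this

theorem compRank_join {m : ℕ} (φ₀ φ₁ : Ket m) :
    compRank (join φ₀ φ₁) = compRank φ₀ + compRank φ₁ := by
  rw [compRank_sub]; simp

end Support

/-! ### Computations that only count steps -/

/-- The store after `k` further steps. -/
def Store.addSteps (s : Store) (k : ℕ) : Store := { s with steps := s.steps + k }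

/-- Run from `s`, the computation `x` returns a value with property `Q`, takes at most `c` steps,
and leaves all tables as they are. -/
def ReadOnly {α : Type} (c : ℕ) (s : Store) (x : Sim α) (Q : α → Prop) : Prop :=
  ∃ a k, x.run s = (a, s.addSteps k) ∧ k ≤ c ∧ Q a

section ReadOnly

variable {α β : Type} {s : Store} {c c₁ c₂ : ℕ}

theorem ReadOnly.mono {x : Sim α} {Q R : α → Prop} (h : ReadOnly c₁ s x Q) (hc : c₁ ≤ c)
    (hQ : ∀ a, Q a → R a) : ReadOnly c s x R := by
  obtain ⟨a, k, hx, hk, ha⟩ := h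
  exact ⟨a, k, hx, hk.trans hc, hQ a ha⟩

theorem ReadOnly.bind {x : Sim α} {f : α → Sim β} {Q : α → Prop} {R : β → Prop}
    (hx : ReadOnly c₁ s x Q) (hf : ∀ a k, Q a → ReadOnly c₂ (s.addSteps k) (f a) R) :
    ReadOnly (c₁ + c₂) s (x >>= f) R := by
  obtain ⟨a, k, hxs, hk, ha⟩ := hx
  obtain ⟨b, l, hfs, hl, hb⟩ := hf a k ha
  refine ⟨b, k + l, ?_, Nat.add_le_add hk hl, hb⟩
  have h : (x >>= f).run s = (f (x.run s).1).run (x.run s).2 := rfl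
  rw [h, hxs, hfs]
  simp only [Store.addSteps, Nat.add_assoc]

theorem ReadOnly.pure {a : α} {Q : α → Prop} (h : Q a) : ReadOnly c s (pure a) Q :=
  ⟨a, 0, rfl, Nat.zero_le _, h⟩

theorem ReadOnly.tick {k : ℕ} (hk : k ≤ c) : ReadOnly c s (tick k) fun _ => True :=
  ⟨(), k, rfl, hk, trivial⟩

theorem ReadOnly.charge {k m : ℕ} (hk : k * (m + 1) ≤ c) :
    ReadOnly c s (charge k m) fun _ => True := ReadOnly.tick hk

end ReadOnly

/-- A successful search returns a value that is stored for the key. -/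
theorem readOnly_scan {κ β : Type} (w : ℕ) (key : κ) (l : List (κ × β)) (s : Store) :
    ReadOnly (w * l.length + 1) s (scan w key l) fun r => ∀ b, r = some b → (key, b) ∈ l := by
  induction l generalizing s with
  | nil =>
    unfold scan
    exact (ReadOnly.bind (ReadOnly.tick le_rfl) fun _ _ _ =>
      ReadOnly.pure (c := 0) (by simp)).mono (by simp) fun _ h => h
  | cons p l ih =>
    obtain ⟨k, b⟩ := p
    unfold scan
    refine (ReadOnly.bind (c₁ := w) (c₂ := w * l.length + 1)
      (R := fun r => ∀ b', r = some b' → (key, b') ∈ (k, b) :: l)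
      (ReadOnly.tick le_rfl) fun _ j _ => ?_).mono ?_ fun _ h => h
    · split_ifs with h
      · refine ReadOnly.pure fun b' hb => ?_
        obtain rfl := Option.some.inj hb
        rw [h]; exact List.mem_cons_self
      · exact (ih _).mono le_rfl fun r hr b' hb => List.mem_cons_of_mem _ (hr b' hb)
    · rw [List.length_cons]; ring_nf; omega

theorem readOnly_findNode {m : ℕ} (v : Node m) (l : List (Node m)) (i : ℕ) (s : Store) :
    ReadOnly (4 * (m + 1) * l.length + 1) s (findNode v l i)
      fun r => ∀ j, r = some j → ∃ d, j = i + d ∧ l[d]? = some v := by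
  induction l generalizing s i with
  | nil =>
    unfold findNode
    exact (ReadOnly.bind (ReadOnly.tick le_rfl) fun _ _ _ =>
      ReadOnly.pure (c := 0) (by simp)).mono (by simp) fun _ h => h
  | cons w l ih =>
    unfold findNode
    refine (ReadOnly.bind (c₁ := 4 * (m + 1)) (c₂ := 4 * (m + 1) * l.length + 1)
      (R := fun r => ∀ j, r = some j → ∃ d, j = i + d ∧ (w :: l)[d]? = some v)
      (ReadOnly.charge le_rfl) fun _ j _ => ?_).mono ?_ fun _ h => h
    · split_ifs with h
      · refine ReadOnly.pure fun b' hb => ?_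
        obtain rfl := Option.some.inj hb
        exact ⟨0, rfl, by simp [h]⟩
      · refine (ih _ _).mono le_rfl fun r hr b' hb => ?_
        obtain ⟨d, rfl, hd⟩ := hr b' hb
        exact ⟨d + 1, by omega, by simpa using hd⟩
    · rw [List.length_cons]; ring_nf; omega

/-- The generators that are stored for a node of level `n`. -/
def Store.gensOf (s : Store) : (n : ℕ) → ℕ → List (LIM n)
  | 0, _ => []
  | m + 1, i => (s.gens m)[i]?.getD []

theorem readOnly_getGens (s : Store) (n v : ℕ) :
    ReadOnly 1 s (getGens n v) fun G => G = s.gensOf n v := by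
  cases n <;> exact ⟨_, 1, rfl, le_rfl, rfl⟩

/-! ### Stabilizers -/

section Stabilizer

variable {n : ℕ}

/-- `g` is in the stabilizer group of `φ`. -/
def Stabilizes (g : LIM n) (φ : Ket n) : Prop := g.act φ = φ

theorem Stabilizes.one (φ : Ket n) : Stabilizes 1 φ := LIM.act_one φ

theorem Stabilizes.mul {g h : LIM n} {φ : Ket n} (hg : Stabilizes g φ) (hh : Stabilizes h φ) :
    Stabilizes (g * h) φ := by
  rw [Stabilizes, LIM.act_mul, hh, hg]

theorem Stabilizes.coeff_ne_zero {g : LIM n} {φ : Ket n} (hφ : φ ≠ 0) (hg : Stabilizes g φ) :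
    g.coeff ≠ 0 := by
  intro h
  apply hφ
  rw [← hg, LIM.act_pauliString, h, zero_smul]

theorem Stabilizes.inv {g : LIM n} {φ : Ket n} (hφ : φ ≠ 0) (hg : Stabilizes g φ) :
    Stabilizes g⁻¹ φ := by
  have h := LIM.act_inv_act (hg.coeff_ne_zero hφ) φ
  rwa [hg] at h

/-- The scalar of a stabilizer is a sign, since the square of a Pauli string is the identity. -/
theorem Stabilizes.coeff_sq {g : LIM n} {φ : Ket n} (hφ : φ ≠ 0) (hg : Stabilizes g φ) :
    g.coeff = 1 ∨ g.coeff = -1 := by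
  have hc := hg.coeff_ne_zero hφ
  have h1 : g⁻¹ = LIM.scale (g.coeff⁻¹ * g.coeff⁻¹) g := by
    change LIM.mk g.coeff⁻¹ g.ops = LIM.mk (g.coeff⁻¹ * g.coeff⁻¹ * g.coeff) g.ops
    rw [mul_assoc, inv_mul_cancel₀ hc, mul_one]
  have h2 := hg.inv hφ
  rw [Stabilizes, h1, LIM.act_scale, hg] at h2
  obtain ⟨x, hx⟩ := Function.ne_iff.mp hφ
  have h3 : g.coeff⁻¹ * g.coeff⁻¹ * φ x = 1 * φ x := by simpa using congrFun h2 x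
  have h4 := mul_right_cancel₀ hx h3
  have h5 : g.coeff * g.coeff = 1 := by
    rw [← mul_inv] at h4
    exact inv_eq_one.mp h4
  exact mul_self_eq_one_iff.mp h5

/-- Two stabilizers with the same Pauli string agree up to sign. -/
theorem Stabilizes.eq_or_neg {g h : LIM n} {φ ψ : Ket n} (hφ : φ ≠ 0) (hψ : ψ ≠ 0)
    (hg : Stabilizes g φ) (hh : Stabilizes h ψ) (hops : g.ops = h.ops) (hne : g ≠ h) :
    h = LIM.scale (-1) g := by
  refine LIM.ext ?_ hops.symm
  change h.coeff = -1 * g.coeff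
  have hc : g.coeff ≠ h.coeff := fun hc => hne (LIM.ext hc hops)
  rcases hg.coeff_sq hφ with h1 | h1 <;> rcases hh.coeff_sq hψ with h2 | h2 <;> simp_all

/-- The first component stabilizes `φ₀` and the second one stabilizes `φ₁`. -/
def Row.Stab (φ₀ φ₁ : Ket n) (r : Row n) : Prop := Stabilizes r.1 φ₀ ∧ Stabilizes r.2 φ₁

theorem Row.Stab.mul {φ₀ φ₁ : Ket n} {p r : Row n} (hp : Row.Stab φ₀ φ₁ p)
    (hr : Row.Stab φ₀ φ₁ r) : Row.Stab φ₀ φ₁ (p.1 * r.1, p.2 * r.2) :=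
  ⟨hp.1.mul hr.1, hp.2.mul hr.2⟩

theorem Row.stab_one (φ₀ φ₁ : Ket n) : Row.Stab φ₀ φ₁ (1, 1) := ⟨.one _, .one _⟩

theorem bit_mul (c : Col n) (A B : LIM n) : bit c (A * B) = xor (bit c A) (bit c B) := by
  have h : (A * B).ops c.2 = (A.ops c.2).mul (B.ops c.2) := rfl
  simp only [bit, h, Pauli.xbit_mul, Pauli.zbit_mul]
  split_ifs <;> rfl

theorem Row.bit_mul (c : Col n) (p r : Row n) :
    Row.bit c (p.1 * r.1, p.2 * r.2) = xor (Row.bit c p) (Row.bit c r) := by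
  simp only [Row.bit, Limdd.bit_mul]
  cases Limdd.bit c p.1 <;> cases Limdd.bit c p.2 <;> cases Limdd.bit c r.1 <;>
    cases Limdd.bit c r.2 <;> rfl

theorem ops_eq_of_bit {r : Row n} (h : ∀ c, Row.bit c r = false) : r.1.ops = r.2.ops := by
  have h' : ∀ c, bit c r.1 = bit c r.2 := fun c => by simpa [Row.bit] using h c
  funext j
  exact Pauli.ext_bits (by simpa [bit] using h' (false, j)) (by simpa [bit] using h' (true, j))

theorem mem_cols (c : Col n) : c ∈ cols n := by
  obtain ⟨_ | _, j⟩ := c <;> simp [cols]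

theorem length_cols : (cols n).length = 2 * n := by
  simp [cols, two_mul]

/-! ### Gaussian elimination -/

/-- All rows that occur in the elimination are products of the given ones, so they have every
property that is closed under products.  In particular a bit that is `0` in all rows stays `0`,
which is why the check vectors of the remaining rows vanish. -/
theorem readOnly_eliminate (cs : List (Col n)) (rows : List (Row n)) (N : ℕ)
    (hN : rows.length ≤ N) (s : Store) :
    ReadOnly (cs.length * ((3 * N + 1) * (n + 1)) + 1) s (eliminate cs rows) fun q =>
      q.1.length ≤ cs.length ∧ q.2.length ≤ rows.length ∧
      (∀ R : Row n → Prop, (∀ p r, R p → R r → R (p.1 * r.1, p.2 * r.2)) → (∀ r ∈ rows, R r) →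
        (∀ p ∈ q.1, R p.2) ∧ ∀ r ∈ q.2, R r) ∧
      ∀ r ∈ q.2, ∀ c ∈ cs, Row.bit c r = false := by
  induction cs generalizing rows s with
  | nil =>
    unfold eliminate
    refine (ReadOnly.bind (ReadOnly.tick le_rfl) fun _ _ _ =>
      ReadOnly.pure (c := 0) ?_).mono (by simp) fun _ h => h
    exact ⟨by simp, le_rfl, fun R _ h => ⟨by simp, h⟩, by simp⟩
  | cons c cs ih =>
    unfold eliminate
    have hcost : (3 * rows.length + 1) * (n + 1) ≤ (3 * N + 1) * (n + 1) := by gcongr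
    have hlen : (rows.filter (Row.bit c)).length +
        (rows.filter (fun r => !(Row.bit c r))).length = rows.length :=
      (List.length_eq_length_filter_add _).symm
    refine (ReadOnly.bind (c₂ := cs.length * ((3 * N + 1) * (n + 1)) + 1)
      (ReadOnly.charge hcost) fun _ k _ => ?_).mono
        (by rw [List.length_cons]; ring_nf; omega) fun _ h => h
    rw [List.partition_eq_filter_filter]
    have hz : ∀ r ∈ rows.filter (not ∘ Row.bit c), Row.bit c r = false := by
      intro r hr; simpa using (List.mem_filter.mp hr).2
    have ho : ∀ r ∈ rows.filter (Row.bit c), Row.bit c r = true := by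
      intro r hr; exact (List.mem_filter.mp hr).2
    have hor : ∀ r ∈ rows.filter (Row.bit c), r ∈ rows := fun r hr => (List.mem_filter.mp hr).1
    have hro : ∀ r ∈ rows, Row.bit c r = true → r ∈ rows.filter (Row.bit c) :=
      fun r hr hb => List.mem_filter.mpr ⟨hr, hb⟩
    have hzr : ∀ r ∈ rows.filter (not ∘ Row.bit c), r ∈ rows :=
      fun r hr => (List.mem_filter.mp hr).1
    change _ + (rows.filter (not ∘ Row.bit c)).length = _ at hlen
    generalize rows.filter (not ∘ Row.bit c) = zeros at *
    generalize rows.filter (Row.bit c) = ones at *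
    match ones with
    | [] =>
      refine (ih rows hN _).mono le_rfl fun q hq => ?_
      obtain ⟨h1, h2, h3, h4⟩ := hq
      refine ⟨h1.trans (by simp), h2, h3, fun r hr c' hc' => ?_⟩
      rcases List.mem_cons.mp hc' with rfl | hc'
      · refine (h3 (fun r => Row.bit c' r = false) (fun p r hp hr => ?_) fun r hr => ?_).2 r hr
        · rw [Row.bit_mul, hp, hr]; rfl
        · by_contra hb
          exact absurd (hro r hr (by simpa using hb)) List.not_mem_nil
      · exact h4 r hr c' hc'
    | p :: rest =>
      have hl : (rest.map (fun r => (p.1 * r.1, p.2 * r.2)) ++ zeros).length ≤ rows.length := by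
        simp at hlen ⊢; omega
      refine (ReadOnly.bind (c₂ := 0) (ih _ (hl.trans hN) _) fun q k hq => ?_).mono le_rfl
        fun _ h => h
      obtain ⟨pivots, nulls⟩ := q
      obtain ⟨h1, h2, h3, h4⟩ := hq
      have hp : Row.bit c p = true := ho p List.mem_cons_self
      refine ReadOnly.pure ⟨by simpa using h1, h2.trans hl, fun R hR hrows => ?_,
        fun r hr c' hc' => ?_⟩
      · have hRp : R p := hrows p (hor p List.mem_cons_self)
        have h5 := h3 R hR fun r hr => by
          rcases List.mem_append.mp hr with hr | hr
          · obtain ⟨r', hr', rfl⟩ := List.mem_map.mp hr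
            exact hR _ _ hRp (hrows r' (hor r' (List.mem_cons_of_mem _ hr')))
          · exact hrows r (hzr r hr)
        refine ⟨fun x hx => ?_, h5.2⟩
        rcases List.mem_cons.mp hx with rfl | hx
        · exact hRp
        · exact h5.1 x hx
      · rcases List.mem_cons.mp hc' with rfl | hc'
        · refine (h3 (fun r => Row.bit c' r = false) (fun p r hp hr => ?_) fun r hr => ?_).2 r hr
          · rw [Row.bit_mul, hp, hr]; rfl
          · rcases List.mem_append.mp hr with hr | hr
            · obtain ⟨r', hr', rfl⟩ := List.mem_map.mp hr
              rw [Row.bit_mul, hp, ho r' (List.mem_cons_of_mem _ hr')]; rfl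
            · exact hz r hr
        · exact h4 r hr c' hc'

/-- The row that is found is a product of the initial one and of pivots. -/
theorem readOnly_reduceRow (A : LIM n) (R : Row n → Prop)
    (hR : ∀ p r, R p → R r → R (p.1 * r.1, p.2 * r.2)) (l : List (Col n × Row n))
    (hl : ∀ p ∈ l, R p.2) (r : Row n) (hr : R r) (s : Store) :
    ReadOnly (3 * (n + 1) * l.length + 1) s (reduceRow A l r) R := by
  induction l generalizing r s with
  | nil =>
    unfold reduceRow
    exact (ReadOnly.bind (ReadOnly.tick le_rfl) fun _ _ _ =>
      ReadOnly.pure (c := 0) hr).mono (by simp) fun _ h => h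
  | cons p l ih =>
    unfold reduceRow
    refine (ReadOnly.bind (c₂ := 3 * (n + 1) * l.length + 1)
      (ReadOnly.charge le_rfl) fun _ k _ => ?_).mono
        (by rw [List.length_cons]; ring_nf; omega) fun _ h => h
    have hl' : ∀ p ∈ l, R p.2 := fun q hq => hl q (List.mem_cons_of_mem _ hq)
    split_ifs
    · exact ih hl' _ (hR _ _ hr (hl p List.mem_cons_self)) _
    · exact ih hl' _ hr _

end Stabilizer

/-! ### Stabilizer generators and canonical labels -/

section Canonical

variable {n : ℕ}

/-- Every resulting row is a pair of stabilizers of the two states, and the two components of a null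
row have the same Pauli string. -/
theorem readOnly_eliminatePair {G₀ G₁ : List (LIM n)} (hG : G₀.length + G₁.length ≤ 4 * (n + 1))
    (s : Store) :
    ReadOnly (40 * (n + 1) ^ 3) s (eliminatePair G₀ G₁) fun q =>
      q.1.length ≤ 2 * n ∧ q.2.length ≤ G₀.length + G₁.length ∧
      (∀ φ₀ φ₁, (∀ g ∈ G₀, Stabilizes g φ₀) → (∀ g ∈ G₁, Stabilizes g φ₁) →
        (∀ p ∈ q.1, Row.Stab φ₀ φ₁ p.2) ∧ ∀ r ∈ q.2, Row.Stab φ₀ φ₁ r) ∧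
      ∀ r ∈ q.2, r.1.ops = r.2.ops := by
  unfold eliminatePair
  refine (ReadOnly.bind (c₁ := (4 * (n + 1) + 2) * (n + 1)) (ReadOnly.charge (by gcongr))
    fun _ k _ => readOnly_eliminate (cols n) _ (4 * (n + 1)) (by simpa using hG) _).mono ?_ ?_
  · rw [length_cols]
    have h1 : (n + 1) ^ 3 = n ^ 3 + 3 * n ^ 2 + 3 * n + 1 := by ring
    nlinarith
  · rintro ⟨piv, nulls⟩ ⟨h1, h2, h3, h4⟩
    refine ⟨by simpa [length_cols] using h1, by simpa using h2, fun φ₀ φ₁ h₀ h₁ => ?_,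
      fun r hr => ops_eq_of_bit fun c => h4 r hr c (mem_cols c)⟩
    refine h3 (Row.Stab φ₀ φ₁) (fun p r hp hr => hp.mul hr) fun r hr => ?_
    rcases List.mem_append.mp hr with hr | hr
    · obtain ⟨g, hg, rfl⟩ := List.mem_map.mp hr
      exact ⟨h₀ g hg, .one _⟩
    · obtain ⟨g, hg, rfl⟩ := List.mem_map.mp hr
      exact ⟨.one _, h₁ g hg⟩

theorem readOnly_reduceRow_stab (A : LIM n) {φ₀ φ₁ : Ket n} {l : List (Col n × Row n)}
    (hlen : l.length ≤ 2 * n) (hl : ∀ p ∈ l, Row.Stab φ₀ φ₁ p.2) (s : Store) :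
    ReadOnly (6 * (n + 1) ^ 2) s (reduceRow A l (1, 1)) (Row.Stab φ₀ φ₁) := by
  refine (readOnly_reduceRow A (Row.Stab φ₀ φ₁) (fun p r hp hr => hp.mul hr) l hl _
    (Row.stab_one _ _) s).mono ?_ fun _ h => h
  have : 3 * (n + 1) * l.length ≤ 3 * (n + 1) * (2 * n) := by gcongr
  nlinarith

/-- What a store must record about the stabilizer group of a node: generators that do stabilize the
state of the node, and not too many. -/
def Store.GensSound (s : Store) (n v : ℕ) (φ : Ket n) : Prop :=
  (s.gensOf n v).length ≤ 2 * n ∧ ∀ g ∈ s.gensOf n v, Stabilizes g φ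

/-- The canonical label differs from `A` by a stabilizer on the right. -/
theorem readOnly_rootLabel {A : LIM n} (hA : A.coeff ≠ 0) {v : ℕ} {φ : Ket n} (hφ : φ ≠ 0)
    {s : Store} (hs : s.GensSound n v φ) :
    ReadOnly (60 * (n + 1) ^ 3) s (rootLabel A v) fun C => C.coeff ≠ 0 ∧ C.act φ = A.act φ := by
  unfold rootLabel
  refine (ReadOnly.bind (c₂ := 40 * (n + 1) ^ 3 + (6 * (n + 1) ^ 2 + (n + 1 + 0)))
    (readOnly_getGens s n v) ?_).mono ?_ fun _ h => h
  · rintro _ k rfl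
    refine ReadOnly.bind (readOnly_eliminatePair (G₁ := [])
      (by have := hs.1; simp; omega) _) ?_
    rintro ⟨pivots, nulls⟩ l ⟨h1, -, h3, -⟩
    refine ReadOnly.bind (readOnly_reduceRow_stab A h1 (h3 φ 0 hs.2 (by simp)).1 _) ?_
    rintro ⟨g, g'⟩ j ⟨hg, -⟩
    refine ReadOnly.bind (ReadOnly.charge (by simp)) fun _ _ _ => ReadOnly.pure ⟨?_, ?_⟩
    · exact LIM.coeff_mul_ne_zero hA (hg.coeff_ne_zero hφ)
    · dsimp only at hg
      rw [LIM.act_mul, hg]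
  · have h1 : (n + 1) ^ 3 = n ^ 3 + 3 * n ^ 2 + 3 * n + 1 := by ring
    nlinarith

/-- An element of `π₀ ⟨G₀⟩ ∩ π₁ ⟨G₁⟩` acts on `φ₀` like `π₀` and on `φ₁` like `π₁`. -/
theorem readOnly_cosetMeet {φ₀ φ₁ : Ket n} {pivots : List (Col n × Row n)} {opp : List (Row n)}
    (hlen : pivots.length ≤ 2 * n) (hp : ∀ p ∈ pivots, Row.Stab φ₀ φ₁ p.2)
    (ho : ∀ r ∈ opp, Row.Stab φ₀ φ₁ r ∧ r.2 = LIM.scale (-1) r.1)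
    {π₀ π₁ : LIM n} (hπ₁ : π₁.coeff ≠ 0) (s : Store) :
    ReadOnly (14 * (n + 1) ^ 2) s (cosetMeet pivots opp π₀ π₁) fun r =>
      ∀ z, r = some z → z.act φ₀ = π₀.act φ₀ ∧ z.act φ₁ = π₁.act φ₁ := by
  unfold cosetMeet
  refine (ReadOnly.bind (c₁ := 8 * (n + 1)) (c₂ := 6 * (n + 1) ^ 2 + 0) (ReadOnly.charge le_rfl)
    fun _ k _ => ?_).mono (by nlinarith) fun _ h => h
  refine ReadOnly.bind (readOnly_reduceRow_stab _ hlen hp _) ?_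
  rintro ⟨g₀, g₁⟩ l ⟨hg₀, hg₁⟩
  dsimp only at hg₀ hg₁ ⊢
  have key : ∀ c : ℂ, π₁⁻¹ * π₀ * g₀ * g₁ = LIM.scale c 1 → (π₀ * g₀).act φ₁ = c • π₁.act φ₁ := by
    intro c h
    have h1 : (π₁⁻¹ * π₀ * g₀ * g₁).act φ₁ = c • φ₁ := by rw [h, LIM.act_scale, LIM.act_one]
    rw [LIM.act_mul, hg₁, LIM.act_mul, LIM.act_mul] at h1
    rw [LIM.act_mul, ← LIM.act_act_inv hπ₁ (π₀.act (g₀.act φ₁)), h1, LIM.act_smul]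
  split_ifs with h1 h2
  · refine ReadOnly.pure fun z hz => ?_
    obtain rfl := Option.some.inj hz
    refine ⟨by rw [LIM.act_mul, hg₀], ?_⟩
    rw [key 1 (by rw [h1]; exact LIM.ext (mul_one _).symm rfl), one_smul]
  · match opp with
    | [] => exact ReadOnly.pure (by simp)
    | h :: t =>
      refine ReadOnly.pure fun z hz => ?_
      obtain rfl := Option.some.inj hz
      obtain ⟨⟨ha, hb⟩, hneg⟩ := ho h List.mem_cons_self
      refine ⟨by rw [LIM.act_mul, ha, LIM.act_mul, hg₀], ?_⟩
      have h3 : h.1.act φ₁ = -φ₁ := by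
        have : h.2.act φ₁ = φ₁ := hb
        rw [hneg, LIM.act_scale, neg_one_smul] at this
        exact neg_eq_iff_eq_neg.mp this
      rw [LIM.act_mul, h3, ← neg_one_smul ℂ φ₁, LIM.act_smul, key (-1) h2, smul_smul]
      norm_num
  · exact ReadOnly.pure (by simp)

/-- The last part of the computation of stabilizer generators: a choice of independent ones. -/
theorem readOnly_independentGens {common : List (LIM n)} {z x y : Option (LIM n)}
    (hlen : common.length ≤ 4 * n) {φ : Ket (n + 1)}
    (hg : ∀ g ∈ common.map (LIM.cons Pauli.I) ++ z.toList.map (LIM.cons Pauli.Z) ++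
      x.toList.map (LIM.cons Pauli.X) ++ y.toList.map (LIM.cons Pauli.Y), Stabilizes g φ)
    (s : Store) :
    ReadOnly (60 * (n + 2) ^ 3) s (do
      charge (common.length + 8) (n + 1)
      let gens := common.map (LIM.cons Pauli.I) ++ z.toList.map (LIM.cons Pauli.Z) ++
        x.toList.map (LIM.cons Pauli.X) ++ y.toList.map (LIM.cons Pauli.Y)
      let (indep, _) ← eliminatePair gens []
      charge (indep.length + 1) (n + 1)
      pure (indep.map (fun q => q.2.1))) fun G =>
        G.length ≤ 2 * (n + 1) ∧ ∀ g ∈ G, Stabilizes g φ := by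
  have hz : z.toList.length ≤ 1 := by cases z <;> simp
  have hx : x.toList.length ≤ 1 := by cases x <;> simp
  have hy : y.toList.length ≤ 1 := by cases y <;> simp
  refine (ReadOnly.bind (c₁ := (4 * n + 8) * (n + 2))
    (c₂ := 40 * (n + 2) ^ 3 + ((2 * (n + 1) + 1) * (n + 2) + 0))
    (ReadOnly.charge (by gcongr)) fun _ k _ => ?_).mono ?_ fun _ h => h
  · refine ReadOnly.bind (readOnly_eliminatePair (G₁ := []) ?_ _) ?_
    · simp only [List.length_append, List.length_map, List.length_nil]; omega
    · rintro ⟨indep, nulls⟩ l ⟨h1, -, h3, -⟩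
      dsimp only at h1
      refine ReadOnly.bind (ReadOnly.charge (by gcongr)) fun _ _ _ =>
        ReadOnly.pure ⟨by simpa using h1, fun g hg' => ?_⟩
      obtain ⟨p, hp, rfl⟩ := List.mem_map.mp hg'
      exact ((h3 φ 0 hg (by simp)).1 p hp).1
  · have h1 : (n + 2) ^ 3 = n ^ 3 + 6 * n ^ 2 + 12 * n + 8 := by ring
    nlinarith

theorem stabilizes_cons_I {g : LIM n} {φ₀ φ₁ : Ket n} (h₀ : Stabilizes g φ₀)
    (h₁ : Stabilizes g φ₁) : Stabilizes (LIM.cons Pauli.I g) (join φ₀ φ₁) := by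
  rw [Stabilizes, act_cons_I, h₀, h₁]

theorem readOnly_stabilizerGens_none {v₀ v₁ : ℕ} {φ₀ : Ket n} {s : Store}
    (hs : s.GensSound n v₀ φ₀) :
    ReadOnly (300 * (n + 2) ^ 3) s (stabilizerGens v₀ none v₁) fun G =>
      G.length ≤ 2 * (n + 1) ∧ ∀ g ∈ G, Stabilizes g (join φ₀ 0) := by
  unfold stabilizerGens
  refine (ReadOnly.bind (c₂ := (2 * n + 1) * (n + 2) + 0) (readOnly_getGens s n v₀) ?_).mono
    ?_ fun _ h => h
  · rintro _ k rfl
    refine ReadOnly.bind (ReadOnly.charge (by have := hs.1; gcongr)) fun _ _ _ =>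
      ReadOnly.pure ⟨?_, fun g hg => ?_⟩
    · have := hs.1
      simp; omega
    · rcases List.mem_append.mp hg with hg | hg
      · obtain ⟨g, hg', rfl⟩ := List.mem_map.mp hg
        exact stabilizes_cons_I (hs.2 g hg') (LIM.act_zero g)
      · obtain rfl := List.mem_singleton.mp hg
        rw [Stabilizes, act_cons_Z, LIM.act_one, LIM.act_one, neg_zero]
  · have h1 : (n + 2) ^ 3 = n ^ 3 + 6 * n ^ 2 + 12 * n + 8 := by ring
    nlinarith

open scoped Classical in
/-- A generator of the form `I ⊗ g`, `Z ⊗ g`, `X ⊗ g` or `Y ⊗ g` is admitted only if `g` maps the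
two halves of the state to each other as required. -/
theorem readOnly_stabilizerGens_some {v₀ v₁ : ℕ} {B : LIM n} (hB : B.coeff ≠ 0)
    {φ₀ φ₁ : Ket n} (hφ₀ : φ₀ ≠ 0) (hφ₁ : φ₁ ≠ 0) (hv : v₀ = v₁ → φ₀ = φ₁) {s : Store}
    (hs₀ : s.GensSound n v₀ φ₀) (hs₁ : s.GensSound n v₁ φ₁) :
    ReadOnly (300 * (n + 2) ^ 3) s (stabilizerGens v₀ (some B) v₁) fun G =>
      G.length ≤ 2 * (n + 1) ∧ ∀ g ∈ G, Stabilizes g (join φ₀ (B.act φ₁)) := by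
  unfold stabilizerGens
  refine (ReadOnly.bind (c₂ := 1 + ((4 * n + 1) * (n + 1) + (40 * (n + 1) ^ 3 +
    ((8 * n + 1) * (n + 1) + (14 * (n + 1) ^ 2 + (14 * (n + 1) ^ 2 + (14 * (n + 1) ^ 2 +
      60 * (n + 2) ^ 3))))))) (readOnly_getGens s n v₀) ?_).mono ?_ fun _ h => h
  swap
  · have h1 : (n + 2) ^ 3 = n ^ 3 + 6 * n ^ 2 + 12 * n + 8 := by ring
    have h2 : (n + 1) ^ 3 = n ^ 3 + 3 * n ^ 2 + 3 * n + 1 := by ring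
    nlinarith
  rintro _ k rfl
  refine ReadOnly.bind (readOnly_getGens _ n v₁) ?_
  rintro _ k₁ rfl
  change ReadOnly _ _ (charge (2 * (s.gensOf n v₁).length + 1) n >>= _) _
  have hl₀ := hs₀.1
  have hl₁ := hs₁.1
  refine ReadOnly.bind (ReadOnly.charge (Nat.mul_le_mul_right _ (by omega))) fun _ k₂ _ => ?_
  have hG₁ : ∀ g ∈ (s.gensOf n v₁).map (fun g => B * g * B⁻¹), Stabilizes g (B.act φ₁) := by
    intro g hg
    obtain ⟨g, hg', rfl⟩ := List.mem_map.mp hg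
    rw [Stabilizes, LIM.act_mul, LIM.act_inv_act hB, LIM.act_mul, hs₁.2 g hg']
  have hBφ : B.act φ₁ ≠ 0 := fun h => hφ₁ ((LIM.act_eq_zero hB).mp h)
  refine ReadOnly.bind (readOnly_eliminatePair (by
    change (s.gensOf n v₀).length + ((s.gensOf n v₁).map _).length ≤ _
    rw [List.length_map]; omega) _) ?_
  rintro ⟨pivots, nulls⟩ k₃ ⟨h1, h2, h3, h4⟩
  change _ ≤ (s.gensOf n v₀).length + ((s.gensOf n v₁).map _).length at h2
  rw [List.length_map] at h2
  dsimp only at h1 h2 h4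
  obtain ⟨h5, h6⟩ := h3 φ₀ (B.act φ₁) hs₀.2 hG₁
  dsimp only at h5 h6
  refine ReadOnly.bind (ReadOnly.charge (Nat.mul_le_mul_right _ (by omega))) fun _ k₄ _ => ?_
  rw [List.partition_eq_filter_filter]
  have he : ∀ r ∈ nulls.filter (fun r => decide (r.1 = r.2)),
      Row.Stab φ₀ (B.act φ₁) r ∧ r.1 = r.2 := by
    intro r hr
    exact ⟨h6 r (List.mem_filter.mp hr).1, by simpa using (List.mem_filter.mp hr).2⟩
  have ho : ∀ r ∈ nulls.filter (not ∘ fun r => decide (r.1 = r.2)),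
      Row.Stab φ₀ (B.act φ₁) r ∧ r.2 = LIM.scale (-1) r.1 := by
    intro r hr
    have hr' := h6 r (List.mem_filter.mp hr).1
    exact ⟨hr', hr'.1.eq_or_neg hφ₀ hBφ hr'.2 (h4 r (List.mem_filter.mp hr).1)
      (by simpa using (List.mem_filter.mp hr).2)⟩
  have hle : (nulls.filter (fun r => decide (r.1 = r.2))).length +
      (nulls.filter (not ∘ fun r => decide (r.1 = r.2))).length = nulls.length :=
    (List.length_eq_length_filter_add _).symm
  generalize nulls.filter (fun r => decide (r.1 = r.2)) = equal at *
  generalize nulls.filter (not ∘ fun r => decide (r.1 = r.2)) = opp at *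
  dsimp only
  -- An equal pair is a common stabilizer, and so is the product of two pairs `(h, -h)`.
  have hcommon : ∀ g ∈ equal.map Prod.fst ++
      (match (generalizing := false) opp with
        | [] => []
        | h :: rest => rest.map (fun r => r.1 * h.1)),
      Stabilizes g φ₀ ∧ Stabilizes g (B.act φ₁) := by
    intro g hg
    rcases List.mem_append.mp hg with hg | hg
    · obtain ⟨r, hr, rfl⟩ := List.mem_map.mp hg
      obtain ⟨hr1, hr2⟩ := he r hr
      exact ⟨hr1.1, hr2 ▸ hr1.2⟩
    · rcases opp with _ | ⟨h, rest⟩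
      · exact absurd hg List.not_mem_nil
      · obtain ⟨r, hr, rfl⟩ := List.mem_map.mp hg
        obtain ⟨hr1, hr2⟩ := ho r (List.mem_cons_of_mem _ hr)
        obtain ⟨hh1, hh2⟩ := ho h List.mem_cons_self
        have hneg : ∀ r : Row n, Stabilizes r.2 (B.act φ₁) → r.2 = LIM.scale (-1) r.1 →
            r.1.act (B.act φ₁) = -B.act φ₁ := by
          intro r hr hr'
          rw [Stabilizes, hr', LIM.act_scale, neg_one_smul] at hr
          exact neg_eq_iff_eq_neg.mp hr
        refine ⟨hr1.1.mul hh1.1, ?_⟩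
        rw [Stabilizes, LIM.act_mul, hneg h hh1.2 hh2, ← neg_one_smul ℂ, LIM.act_smul,
          hneg r hr1.2 hr2, neg_one_smul, neg_neg]
  have hclen : (equal.map Prod.fst ++
      (match (generalizing := false) opp with
        | [] => []
        | h :: rest => rest.map (fun r => r.1 * h.1))).length ≤ 4 * n := by
    rw [List.length_append, List.length_map]
    rcases opp with _ | ⟨h, rest⟩ <;> simp at hle ⊢ <;> omega
  generalize equal.map Prod.fst ++ (match (generalizing := false) opp with
        | [] => []
        | h :: rest => rest.map (fun r => r.1 * h.1)) = common at *
  refine ReadOnly.bind (readOnly_cosetMeet h1 h5 ho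
    (by simp [LIM.scale, LIM.coeff_one_ne_zero]) _) fun z k₅ hz => ?_
  have tail : ∀ x y : Option (LIM n),
      (∀ g, x = some g → g.act φ₀ = B.act φ₁ ∧ g.act (B.act φ₁) = φ₀) →
      (∀ g, y = some g → g.act φ₀ = -Complex.I • B.act φ₁ ∧
        g.act (B.act φ₁) = Complex.I • φ₀) →
      ∀ g ∈ common.map (LIM.cons Pauli.I) ++ z.toList.map (LIM.cons Pauli.Z) ++
        x.toList.map (LIM.cons Pauli.X) ++ y.toList.map (LIM.cons Pauli.Y),
        Stabilizes g (join φ₀ (B.act φ₁)) := by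
    intro x y hx hy g hg
    simp only [List.mem_append, List.mem_map, Option.mem_toList] at hg
    rcases hg with ((⟨g, hg, rfl⟩ | ⟨g, hg, rfl⟩) | ⟨g, hg, rfl⟩) | ⟨g, hg, rfl⟩
    · exact stabilizes_cons_I (hcommon g hg).1 (hcommon g hg).2
    · obtain ⟨hz1, hz2⟩ := hz g hg
      rw [LIM.act_one] at hz1
      rw [LIM.act_scale, LIM.act_one, neg_one_smul] at hz2
      rw [Stabilizes, act_cons_Z, hz1, hz2, neg_neg]
    · obtain ⟨hx1, hx2⟩ := hx g hg
      rw [Stabilizes, act_cons_X, hx1, hx2]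
    · obtain ⟨hy1, hy2⟩ := hy g hg
      rw [Stabilizes, act_cons_Y, hy1, hy2, smul_smul, smul_smul]
      simp
  -- The generators that swap the two halves are sought only if both halves are the same node.
  by_cases hvv : v₀ = v₁
  · simp only [if_pos hvv]
    obtain rfl := hv hvv
    refine ReadOnly.bind (readOnly_cosetMeet h1 h5 ho (LIM.coeff_inv_ne_zero hB) _)
      fun x k₆ hx => ?_
    have hC : (LIM.scale (-Complex.I) B).coeff ≠ 0 := mul_ne_zero (by simp) hB
    refine ReadOnly.bind (readOnly_cosetMeet h1 h5 ho (LIM.coeff_inv_ne_zero hC) _)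
      fun y k₇ hy => ?_
    refine readOnly_independentGens hclen (tail x y (fun g hg => ?_) fun g hg => ?_) _
    · obtain ⟨hx1, hx2⟩ := hx g hg
      exact ⟨hx1, by rw [hx2, LIM.act_inv_act hB]⟩
    · obtain ⟨hy1, hy2⟩ := hy g hg
      refine ⟨by rw [hy1, LIM.act_scale], ?_⟩
      have h7 : B.act φ₀ = Complex.I • (LIM.scale (-Complex.I) B).act φ₀ := by
        rw [LIM.act_scale, smul_smul]; simp
      rw [hy2, h7, LIM.act_smul, LIM.act_inv_act hC]
  · simp only [if_neg hvv]
    refine ReadOnly.bind (ReadOnly.pure (a := (none : Option (LIM n))) (Q := fun x => x = none) rfl)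
      fun x k₆ hx => ?_
    refine ReadOnly.bind (ReadOnly.pure (a := (none : Option (LIM n))) (Q := fun x => x = none) rfl)
      fun y k₇ hy => ?_
    subst hx hy
    exact readOnly_independentGens hclen (tail none none (by simp) (by simp)) _

theorem argMin_mem {α : Type} (f : α → ℂ) (d : α) (l : List α) : argMin f d l ∈ d :: l := by
  classical
  unfold argMin
  induction l generalizing d with
  | nil => simp
  | cons b l ih =>
    rw [List.foldl_cons]
    have h := ih (if scalarLT (f b) (f d) then b else d)
    rcases List.mem_cons.mp h with h | h
    · split_ifs at h with hc
      · simp only [if_pos hc]; rw [h]; simp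
      · simp only [if_neg hc]; rw [h]; simp
    · exact List.mem_cons_of_mem _ (List.mem_cons_of_mem _ h)

/-- The root label undoes the changes by which the high label is brought into canonical form. -/
theorem readOnly_getLabels {A : LIM n} (hA : A.coeff ≠ 0) {v₀ v₁ : ℕ} {φ₀ φ₁ : Ket n}
    (hφ₀ : φ₀ ≠ 0) (hφ₁ : φ₁ ≠ 0) (hv : v₀ = v₁ → φ₀ = φ₁) {s : Store}
    (hs₀ : s.GensSound n v₀ φ₀) (hs₁ : s.GensSound n v₁ φ₁) :
    ReadOnly (80 * (n + 2) ^ 3) s (getLabels A v₀ v₁) fun q =>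
      q.1.coeff ≠ 0 ∧ q.2.coeff ≠ 0 ∧ q.2.act (join φ₀ (q.1.act φ₁)) = join φ₀ (A.act φ₁) := by
  unfold getLabels
  refine (ReadOnly.bind (c₂ := 1 + (40 * (n + 1) ^ 3 + (6 * (n + 1) ^ 2 + (20 * (n + 2) + 0))))
    (readOnly_getGens s n v₀) ?_).mono ?_ fun _ h => h
  swap
  · have h1 : (n + 2) ^ 3 = n ^ 3 + 6 * n ^ 2 + 12 * n + 8 := by ring
    have h2 : (n + 1) ^ 3 = n ^ 3 + 3 * n ^ 2 + 3 * n + 1 := by ring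
    nlinarith
  rintro _ k rfl
  refine ReadOnly.bind (readOnly_getGens _ n v₁) ?_
  rintro _ k₁ rfl
  have hl₀ := hs₀.1
  have hl₁ := hs₁.1
  refine ReadOnly.bind (readOnly_eliminatePair (by
    change (s.gensOf n v₀).length + (s.gensOf n v₁).length ≤ _
    omega) _) ?_
  rintro ⟨pivots, nulls⟩ k₃ ⟨h1, -, h3, -⟩
  refine ReadOnly.bind (readOnly_reduceRow_stab A h1 (h3 φ₀ φ₁ hs₀.2 hs₁.2).1 _) ?_
  rintro ⟨g₀, g₁⟩ k₄ ⟨hg₀, hg₁⟩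
  dsimp only at hg₀ hg₁ ⊢
  refine ReadOnly.bind (ReadOnly.charge le_rfl) fun _ _ _ => ReadOnly.pure ?_
  have hP : A.pauliString.coeff ≠ 0 := one_ne_zero (α := ℂ)
  have hR : (g₀ * A.pauliString * g₁).coeff ≠ 0 :=
    LIM.coeff_mul_ne_zero (LIM.coeff_mul_ne_zero (hg₀.coeff_ne_zero hφ₀) hP)
      (hg₁.coeff_ne_zero hφ₁)
  have hRφ : (g₀ * A.pauliString * g₁).act φ₁ = g₀.act (A.pauliString.act φ₁) := by
    rw [LIM.act_mul, hg₁, LIM.act_mul]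
  have hi₀ := hg₀.inv hφ₀
  have hc₀ : g₀⁻¹.coeff ≠ 0 := LIM.coeff_inv_ne_zero (hg₀.coeff_ne_zero hφ₀)
  have hinv : ∀ φ, g₀⁻¹.act (g₀.act φ) = φ := LIM.act_inv_act (hg₀.coeff_ne_zero hφ₀)
  have hmem := argMin_mem (fun c : Bool × Bool => (LIM.scale ((if c.2 then -1 else 1) *
    (if c.1 then A.coeff⁻¹ else A.coeff)) (g₀ * A.pauliString * g₁)).coeff) (false, false)
    (if v₀ = v₁ then [(false, true), (true, false), (true, true)] else [(false, true)])
  generalize argMin _ (false, false) _ = c at hmem ⊢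
  have hz : ∀ (b : Bool) (μ : ℂ), (LIM.cons (if b then Pauli.Z else Pauli.I) g₀⁻¹).act
      (join φ₀ ((LIM.scale ((if b then -1 else 1) * μ) (g₀ * A.pauliString * g₁)).act φ₁)) =
      join φ₀ (μ • A.pauliString.act φ₁) := by
    intro b μ
    rw [LIM.act_scale, hRφ]
    cases b
    · simp only [Bool.false_eq_true, if_false, act_cons_I, LIM.act_smul, hinv, one_mul]
      rw [hi₀]
    · simp only [if_true, act_cons_Z, LIM.act_smul, hinv]
      rw [hi₀]; simp
  obtain ⟨x, b⟩ := c
  cases x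
  · refine ⟨mul_ne_zero (mul_ne_zero (by cases b <;> simp) (by simpa using hA)) hR, hc₀, ?_⟩
    have := hz b A.coeff
    rw [← LIM.act_pauliString] at this
    exact this
  · -- The scalar was inverted, so the two children coincide and the root label swaps them.
    have hvv : v₀ = v₁ := by
      by_contra hne
      rw [if_neg hne] at hmem
      simp at hmem
    obtain rfl := hv hvv
    refine ⟨mul_ne_zero (mul_ne_zero (by cases b <;> simp) (by simpa using hA)) hR,
      LIM.coeff_mul_ne_zero (A := LIM.cons Pauli.X A) hA (by exact hc₀), ?_⟩
    have := hz b A.coeff⁻¹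
    have hi : A.coeff⁻¹ • A.pauliString.act φ₀ = A⁻¹.act φ₀ := by
      rw [LIM.act_pauliString A⁻¹]; rfl
    simp only [if_true]
    rw [LIM.act_mul, this, act_cons_X, hi, LIM.act_act_inv hA]

end Canonical

/-! ### Tables of nodes -/

namespace Table

/-- The nodes of `T` keep their identifiers in `T'`. -/
def Ext (T T' : Table) : Prop := ∀ m, T m <+: T' m

/-- In `T`, the edge `e` is valid and denotes `φ`. -/
def Den (T : Table) {n : ℕ} (e : Edge n) (φ : Ket n) : Prop :=
  (∀ A i, e = some (A, i) → A.coeff ≠ 0 ∧ T.HasNode n i) ∧ edgeKet T e = φ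

/-- All nodes have the low label `1`.  Hence no node denotes the zero vector. -/
structure Good (T : Table) : Prop where
  wf : T.WellFormed
  low : ∀ m, ∀ v ∈ T m, v.lowLabel = some 1

variable {T T' : Table} {n m : ℕ}

theorem Ext.refl (T : Table) : T.Ext T := fun _ => List.prefix_refl _

theorem Ext.trans {T'' : Table} (h : T.Ext T') (h' : T'.Ext T'') : T.Ext T'' :=
  fun m => (h m).trans (h' m)

theorem Ext.getElem? (h : T.Ext T') {i : ℕ} {v : Node m} (hi : (T m)[i]? = some v) :
    (T' m)[i]? = some v := by
  obtain ⟨l, hl⟩ := h m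
  rw [← hl, List.getElem?_append_left (List.getElem?_eq_some_iff.mp hi).1, hi]

theorem Ext.hasNode (h : T.Ext T') {i : ℕ} (hi : T.HasNode n i) : T'.HasNode n i := by
  cases n with
  | zero => exact hi
  | succ m => exact lt_of_lt_of_le hi (h m).length_le

theorem HasNode.exists_node {i : ℕ} (hi : T.HasNode (m + 1) i) :
    ∃ v, (T m)[i]? = some v ∧ v ∈ T m :=
  ⟨(T m)[i]'hi, List.getElem?_eq_getElem hi, List.getElem_mem hi⟩

theorem nodeKet_succ {i : ℕ} {v : Node m} (hi : (T m)[i]? = some v) :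
    nodeKet T (m + 1) i =
      join (actLabel v.lowLabel (nodeKet T m v.low))
        (actLabel v.highLabel (nodeKet T m v.high)) := by
  rw [nodeKet, hi]; rfl

theorem Ext.nodeKet (h : T.Ext T') (hwf : T.WellFormed) {i : ℕ} (hi : T.HasNode n i) :
    nodeKet T' n i = nodeKet T n i := by
  induction n generalizing i with
  | zero => rfl
  | succ m ih =>
    obtain ⟨v, hv, hmem⟩ := hi.exists_node
    obtain ⟨h1, h2, -, -⟩ := hwf m v hmem
    rw [nodeKet_succ hv, nodeKet_succ (h.getElem? hv), ih h1, ih h2]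

theorem den_none : T.Den (none : Edge n) 0 := ⟨by simp, rfl⟩

theorem den_some {A : LIM n} (hA : A.coeff ≠ 0) {i : ℕ} (hi : T.HasNode n i) :
    T.Den (some (A, i)) (A.act (nodeKet T n i)) := by
  refine ⟨?_, LIM.toMatrix_mulVec _ _⟩
  rintro A' i' h
  cases h
  exact ⟨hA, hi⟩

theorem Den.some_elim {A : LIM n} {i : ℕ} {φ : Ket n} (h : T.Den (some (A, i)) φ) :
    A.coeff ≠ 0 ∧ T.HasNode n i ∧ φ = A.act (nodeKet T n i) :=
  ⟨(h.1 A i rfl).1, (h.1 A i rfl).2, by rw [← h.2]; exact LIM.toMatrix_mulVec _ _⟩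

theorem Den.none_elim {φ : Ket n} (h : T.Den (none : Edge n) φ) : φ = 0 := h.2.symm

theorem Den.ext {e : Edge n} {φ : Ket n} (h : T.Den e φ) (hx : T.Ext T') (hwf : T.WellFormed) :
    T'.Den e φ := by
  match e with
  | none => obtain rfl := h.none_elim; exact den_none
  | some (A, i) =>
    obtain ⟨hA, hi, rfl⟩ := h.some_elim
    rw [← hx.nodeKet hwf hi]
    exact den_some hA (hx.hasNode hi)

/-- The low edge of a node has label `1`, so a node inherits a nonzero amplitude from its low
child. -/
theorem Good.nodeKet_ne_zero (hT : T.Good) {i : ℕ} (hi : T.HasNode n i) : nodeKet T n i ≠ 0 := by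
  induction n generalizing i with
  | zero => exact Function.ne_iff.mpr ⟨Fin.elim0, one_ne_zero⟩
  | succ m ih =>
    obtain ⟨v, hv, hmem⟩ := hi.exists_node
    rw [nodeKet_succ hv, hT.low m v hmem]
    intro h
    have h0 := (join_eq_zero.mp h).1
    rw [actLabel, LIM.toMatrix_mulVec, LIM.act_one] at h0
    exact ih (hT.wf m v hmem).1 h0

theorem Den.ne_zero (hT : T.Good) {A : LIM n} {i : ℕ} {φ : Ket n} (h : T.Den (some (A, i)) φ) :
    φ ≠ 0 := by
  obtain ⟨hA, hi, rfl⟩ := h.some_elim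
  exact fun h0 => hT.nodeKet_ne_zero hi ((LIM.act_eq_zero hA).mp h0)

theorem Den.act {e : Edge n} {φ : Ket n} (h : T.Den e φ) {A : LIM n} (hA : A.coeff ≠ 0) :
    T.Den (Edge.act A e) (A.act φ) := by
  match e with
  | none => obtain rfl := h.none_elim; rw [LIM.act_zero]; exact den_none
  | some (B, i) =>
    obtain ⟨hB, hi, rfl⟩ := h.some_elim
    rw [← LIM.act_mul]
    exact den_some (LIM.coeff_mul_ne_zero hA hB) hi

theorem Den.scale {e : Edge n} {φ : Ket n} (h : T.Den e φ) {c : ℂ} (hc : c ≠ 0) :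
    T.Den (Edge.scale c e) (c • φ) := by
  match e with
  | none => obtain rfl := h.none_elim; rw [smul_zero]; exact den_none
  | some (B, i) =>
    obtain ⟨hB, hi, rfl⟩ := h.some_elim
    rw [← LIM.act_scale]
    exact den_some (mul_ne_zero hc hB) hi

end Table

/-! ### Matrices as amplitude vectors -/

/-- One of the four quadrants of a matrix that is given as a vector with alternating row and column
bits. -/
def quad {n : ℕ} (r c : Bool) (U : Ket (2 * (n + 1))) : Ket (2 * n) :=
  sub c (sub (m := 2 * n + 1) r U)

/-- The product of a matrix, given as a vector with alternating row and column bits, with a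
vector. -/
noncomputable def applyKet : (n : ℕ) → Ket (2 * n) → Ket n → Ket n
  | 0, U, φ => fun x => U (fun i => Fin.elim0 i) * φ x
  | n + 1, U, φ =>
    join
      (applyKet n (quad false false U) (sub false φ) + applyKet n (quad false true U) (sub true φ))
      (applyKet n (quad true false U) (sub false φ) + applyKet n (quad true true U) (sub true φ))

/-- The squared norm of an amplitude vector. -/
noncomputable def sqNorm {n : ℕ} (φ : Ket n) : ℝ := ∑ x, ‖φ x‖ ^ 2

/-! ### The invariant of the store -/

/-- All stored data are correct. -/
structure Store.Inv (s : Store) : Prop where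
  good : s.nodes.Good
  gens_length : ∀ m, (s.gens m).length = (s.nodes m).length
  gens : ∀ n v, s.nodes.HasNode n v → s.GensSound n v (s.nodes.nodeKet n v)
  add : ∀ m v C w a, ((v, C, w), a) ∈ s.addCache m →
    s.nodes.HasNode m v ∧ s.nodes.HasNode m w ∧
      s.nodes.Den a (s.nodes.nodeKet m v + C.act (s.nodes.nodeKet m w))
  apply : ∀ n P v Q w a, (((P, v), (Q, w)), a) ∈ s.applyCache n →
    s.nodes.HasNode (2 * n) v ∧ s.nodes.HasNode n w ∧
      s.nodes.Den a (applyKet n (P.act (s.nodes.nodeKet (2 * n) v)) (Q.act (s.nodes.nodeKet n w)))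
  norm : ∀ n v a, (v, a) ∈ s.normCache n →
    s.nodes.HasNode n v ∧ a = sqNorm (s.nodes.nodeKet n v)
  proj : ∀ n v q b a, ((v, q, b), a) ∈ s.projCache n →
    s.nodes.HasNode n v ∧ a = sqNorm (projectKet q b (s.nodes.nodeKet n v))
  post : ∀ n v q b a, ((v, q, b), a) ∈ s.postCache n →
    s.nodes.HasNode n v ∧ s.nodes.Den a (projectKet q b (s.nodes.nodeKet n v))

theorem Store.Inv.addSteps {s : Store} (h : s.Inv) (k : ℕ) : (s.addSteps k).Inv :=
  ⟨h.good, h.gens_length, fun n v hv => by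
    have := h.gens n v hv
    cases n <;> exact this, h.add, h.apply, h.norm, h.proj, h.post⟩

/-- No table and no cache has more than `b` entries per level. -/
structure Store.Bounded (b : ℕ) (s : Store) : Prop where
  nodes : ∀ m, (s.nodes m).length ≤ b
  add : ∀ m, (s.addCache m).length ≤ b
  apply : ∀ m, (s.applyCache m).length ≤ b
  norm : ∀ m, (s.normCache m).length ≤ b
  proj : ∀ m, (s.projCache m).length ≤ b
  post : ∀ m, (s.postCache m).length ≤ b

theorem Store.Bounded.mono {b b' : ℕ} {s : Store} (h : s.Bounded b) (hb : b ≤ b') : s.Bounded b' :=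
  ⟨fun m => (h.nodes m).trans hb, fun m => (h.add m).trans hb, fun m => (h.apply m).trans hb,
    fun m => (h.norm m).trans hb, fun m => (h.proj m).trans hb, fun m => (h.post m).trans hb⟩

/-! ### A program logic with a count of elementary operations -/

/-- A bound for the steps of one operation on levels up to `D` while all tables have at most `b`
entries per level.  The cubic factor covers a Gaussian elimination, and the last factor a linear
search. -/
def opCost (D b : ℕ) : ℕ := 300 * (D + 2) ^ 3 * (b + 1)

theorem opCost_mono (D : ℕ) {b b' : ℕ} (h : b ≤ b') : opCost D b ≤ opCost D b' := by
  unfold opCost; gcongr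

/-- `s'` arises from `s` by at most `k` operations, each of which adds at most one entry to a table.
The cost of an operation is bounded in terms of the tables at the end, which are the largest. -/
def StepsTo (D k : ℕ) (s s' : Store) : Prop :=
  ∀ b, s.Bounded b → s'.Bounded (b + k) ∧ s'.steps ≤ s.steps + k * opCost D (b + k)

theorem StepsTo.trans {D k k' : ℕ} {s s' s'' : Store} (h : StepsTo D k s s')
    (h' : StepsTo D k' s' s'') : StepsTo D (k + k') s s'' := by
  intro b hb
  obtain ⟨h1, h2⟩ := h b hb
  obtain ⟨h3, h4⟩ := h' _ h1
  refine ⟨by rwa [← Nat.add_assoc], ?_⟩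
  have h5 : k * opCost D (b + k) ≤ k * opCost D (b + (k + k')) :=
    Nat.mul_le_mul_left _ (opCost_mono D (by omega))
  rw [Nat.add_assoc] at h4
  rw [Nat.add_mul]
  omega

theorem StepsTo.mono {D k k' : ℕ} {s s' : Store} (h : StepsTo D k s s') (hk : k ≤ k') :
    StepsTo D k' s s' := by
  intro b hb
  obtain ⟨h1, h2⟩ := h b hb
  have : k * opCost D (b + k) ≤ k' * opCost D (b + k') :=
    Nat.mul_le_mul hk (opCost_mono D (by omega))
  exact ⟨h1.mono (by omega), by omega⟩

/-- A Hoare triple: run from `s`, the computation `x` keeps all stored data correct and all nodes,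
performs at most `K` operations on levels up to `D`, and its result and final store satisfy `Q`. -/
def Spec (D K : ℕ) (s : Store) {α : Type} (x : Sim α) (Q : α → Store → Prop) : Prop :=
  s.Inv → (x.run s).2.Inv ∧ s.nodes.Ext (x.run s).2.nodes ∧ StepsTo D K s (x.run s).2 ∧
    Q (x.run s).1 (x.run s).2

section Spec

variable {D K K₁ : ℕ} {s : Store} {α β : Type}

theorem Spec.intro {x : Sim α} {Q : α → Store → Prop} (h : s.Inv → Spec D K s x Q) :
    Spec D K s x Q := fun hs => h hs hs

theorem Spec.mono {x : Sim α} {Q R : α → Store → Prop} (h : Spec D K₁ s x Q) (hK : K₁ ≤ K)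
    (hQ : ∀ a s', s'.Inv → s.nodes.Ext s'.nodes → Q a s' → R a s') : Spec D K s x R := by
  intro hs
  obtain ⟨h1, h2, h3, h4⟩ := h hs
  exact ⟨h1, h2, h3.mono hK, hQ _ _ h1 h2 h4⟩

/-- `K` is the budget for both parts; the second one has what the first one leaves. -/
theorem Spec.bind {x : Sim α} {f : α → Sim β} {Q : α → Store → Prop} {R : β → Store → Prop}
    (hx : Spec D K₁ s x Q) (hK : K₁ ≤ K)
    (hf : ∀ a s', s'.Inv → s.nodes.Ext s'.nodes → Q a s' → Spec D (K - K₁) s' (f a) R) :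
    Spec D K s (x >>= f) R := by
  intro hs
  obtain ⟨h1, h2, h3, h4⟩ := hx hs
  obtain ⟨h5, h6, h7, h8⟩ := hf _ _ h1 h2 h4 h1
  exact ⟨h5, h2.trans h6, by
    have := h3.trans h7
    rwa [Nat.add_sub_of_le hK] at this, h8⟩

theorem StepsTo.refl (D k : ℕ) (s : Store) : StepsTo D k s s :=
  fun _ hb => ⟨hb.mono (by omega), by omega⟩

theorem Spec.pure {a : α} {Q : α → Store → Prop} (h : s.Inv → Q a s) : Spec D K s (pure a) Q :=
  fun hs => ⟨hs, Table.Ext.refl _, .refl _ _ _, h hs⟩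

theorem Spec.get : Spec D 0 s get fun a s' => s = a ∧ s = s' :=
  fun hs => ⟨hs, Table.Ext.refl _, .refl _ _ _, rfl, rfl⟩

theorem Spec.readOnly {c : ℕ} {x : Sim α} {Q : α → Prop} (h : s.Inv → ReadOnly c s x Q)
    (hc : ∀ b, s.Bounded b → c ≤ opCost D b) :
    Spec D 1 s x fun a s' => Q a ∧ ∃ k, s' = s.addSteps k := by
  intro hs
  obtain ⟨a, k, hx, hk, ha⟩ := h hs
  rw [hx]
  refine ⟨hs.addSteps k, Table.Ext.refl _, fun b hb => ⟨?_, ?_⟩, ha, k, rfl⟩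
  · exact Store.Bounded.mono (b := b) ⟨hb.nodes, hb.add, hb.apply, hb.norm, hb.proj, hb.post⟩
      (by omega)
  · have := (hc b hb).trans (opCost_mono D (Nat.le_add_right b 1))
    change s.steps + k ≤ _
    omega

theorem Spec.tick {k : ℕ} (hk : k ≤ 300 * (D + 2) ^ 3) :
    Spec D 1 s (tick k) fun _ s' => ∃ k, s' = s.addSteps k := by
  refine (Spec.readOnly (c := k) (fun _ => ReadOnly.tick le_rfl) fun b _ => hk.trans ?_).mono le_rfl
    fun a s' _ _ h => h.2
  exact Nat.le_mul_of_pos_right _ (Nat.succ_pos b)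

theorem Spec.charge {k m : ℕ} (hk : k ≤ 300) (hm : m ≤ D) :
    Spec D 1 s (charge k m) fun _ s' => ∃ k, s' = s.addSteps k := by
  refine Spec.tick (Nat.mul_le_mul hk ?_)
  calc m + 1 ≤ (D + 2) ^ 1 := by rw [pow_one]; omega
    _ ≤ (D + 2) ^ 3 := Nat.pow_le_pow_right (by omega) (by omega)

theorem Spec.modify {f : Store → Store} (hinv : s.Inv → (f s).Inv)
    (hext : s.nodes.Ext (f s).nodes) (hsteps : StepsTo D 1 s (f s)) :
    Spec D 1 s (modify f) fun _ s' => s' = f s :=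
  fun hs => ⟨hinv hs, hext, hsteps, rfl⟩

theorem Spec.scan {κ : Type} {w : ℕ} {key : κ} {l : List (κ × β)}
    (hw : w ≤ 300 * (D + 2) ^ 3 - 1) (hl : ∀ b, s.Bounded b → l.length ≤ b) :
    Spec D 1 s (scan w key l) fun r s' => (∀ b, r = some b → (key, b) ∈ l) ∧
      ∃ k, s' = s.addSteps k := by
  refine Spec.readOnly (fun _ => readOnly_scan w key l s) fun b hb => ?_
  have h1 : 1 ≤ 300 * (D + 2) ^ 3 := Nat.one_le_iff_ne_zero.mpr (by positivity)
  unfold opCost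
  generalize 300 * (D + 2) ^ 3 = X at *
  calc w * l.length + 1 ≤ (X - 1) * b + 1 := by gcongr; exact hl b hb
    _ ≤ X * b + X := by
      have : (X - 1) * b ≤ X * b := by gcongr; omega
      omega
    _ = X * (b + 1) := by ring

end Spec

/-! ### Creating nodes -/

/-- The store after a new node `v` of level `m + 1`, with stabilizer generators `G`, is appended. -/
noncomputable def Store.addNode (s : Store) {m : ℕ} (v : Node m) (G : List (LIM (m + 1))) : Store :=
  { s with
    nodes := Function.update s.nodes m (s.nodes m ++ [v])
    gens := Function.update s.gens m (s.gens m ++ [G]) }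

section AddNode

variable {s : Store} {m : ℕ} {v : Node m} {G : List (LIM (m + 1))}

theorem Store.addNode_ext : s.nodes.Ext (s.addNode v G).nodes := by
  intro m'
  by_cases h : m' = m
  · subst h
    simp [Store.addNode]
  · simp [Store.addNode, h]

theorem Store.addNode_stepsTo (D : ℕ) : StepsTo D 1 s (s.addNode v G) := by
  intro b hb
  refine ⟨⟨fun m' => ?_, fun m' => (hb.add m').trans (by omega),
    fun m' => (hb.apply m').trans (by omega), fun m' => (hb.norm m').trans (by omega),
    fun m' => (hb.proj m').trans (by omega), fun m' => (hb.post m').trans (by omega)⟩,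
    Nat.le_add_right _ _⟩
  have := hb.nodes m'
  by_cases h : m' = m
  · subst h
    simpa [Store.addNode] using this
  · simp only [Store.addNode, Function.update_of_ne h]
    omega

theorem Store.addNode_getElem? : ((s.addNode v G).nodes m)[(s.nodes m).length]? = some v := by
  simp [Store.addNode]

theorem Store.Inv.addNode (hs : s.Inv) (hlow : v.lowLabel = some 1)
    (hv₀ : s.nodes.HasNode m v.low) (hv₁ : s.nodes.HasNode m v.high)
    (hB : ∀ A, v.highLabel = some A → A.coeff ≠ 0) (hlen : G.length ≤ 2 * (m + 1))
    (hG : ∀ g ∈ G, Stabilizes g (join (s.nodes.nodeKet m v.low)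
      (Table.actLabel v.highLabel (s.nodes.nodeKet m v.high)))) : (s.addNode v G).Inv := by
  have hext : s.nodes.Ext (s.addNode v G).nodes := Store.addNode_ext
  have hwf := hs.good.wf
  have hmem : ∀ m', ∀ w ∈ (s.addNode v G).nodes m', w ∈ s.nodes m' ∨ (∃ h : m' = m, h ▸ w = v) := by
    intro m' w hw
    by_cases h : m' = m
    · subst h
      simp only [Store.addNode, Function.update_self, List.mem_append, List.mem_singleton] at hw
      rcases hw with hw | hw
      · exact Or.inl hw
      · exact Or.inr ⟨rfl, hw⟩
    · simp only [Store.addNode, Function.update_of_ne h] at hw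
      exact Or.inl hw
  have hgood : (s.addNode v G).nodes.Good := by
    constructor
    · intro m' w hw
      rcases hmem m' w hw with hw | ⟨rfl, rfl⟩
      · obtain ⟨h1, h2, h3, h4⟩ := hwf m' w hw
        exact ⟨hext.hasNode h1, hext.hasNode h2, h3, h4⟩
      · refine ⟨hext.hasNode hv₀, hext.hasNode hv₁, fun A hA => ?_, hB⟩
        rw [hlow] at hA
        obtain rfl := Option.some.inj hA
        exact LIM.coeff_one_ne_zero
    · intro m' w hw
      rcases hmem m' w hw with hw | ⟨rfl, rfl⟩
      · exact hs.good.low m' w hw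
      · exact hlow
  refine ⟨hgood, fun m' => ?_, fun n i hi => ?_, fun m' v C w a h => ?_, fun n P v Q w a h => ?_,
    fun n v a h => ?_, fun n v q b a h => ?_, fun n v q b a h => ?_⟩
  · have := hs.gens_length m'
    by_cases h : m' = m
    · subst h
      simpa [Store.addNode] using this
    · simpa [Store.addNode, h] using this
  · have hold : s.nodes.HasNode n i → (s.addNode v G).gensOf n i = s.gensOf n i →
        (s.addNode v G).GensSound n i ((s.addNode v G).nodes.nodeKet n i) := by
      intro h he
      rw [Store.GensSound, he, hext.nodeKet hwf h]
      exact hs.gens n i h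
    match n with
    | 0 => exact hold hi rfl
    | m' + 1 =>
      by_cases h : m' = m
      · subst h
        have hl := hs.gens_length m'
        have hi' : i < (s.nodes m').length + 1 := by
          simpa [Table.HasNode, Store.addNode] using hi
        by_cases hlt : i < (s.nodes m').length
        · refine hold hlt ?_
          simp only [Store.gensOf, Store.addNode, Function.update_self]
          rw [List.getElem?_append_left (by omega)]
        · obtain rfl : i = (s.nodes m').length := by omega
          have he : (s.addNode v G).gensOf (m' + 1) (s.nodes m').length = G := by
            simp only [Store.gensOf, Store.addNode, Function.update_self]
            rw [← hl]; simp
          rw [Store.GensSound, he, Table.nodeKet_succ Store.addNode_getElem?, hlow,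
            hext.nodeKet hwf hv₀, hext.nodeKet hwf hv₁, Table.actLabel, LIM.toMatrix_mulVec,
            LIM.act_one]
          exact ⟨hlen, hG⟩
      · refine hold ?_ ?_
        · simpa [Table.HasNode, Store.addNode, h] using hi
        · simp [Store.gensOf, Store.addNode, h]
  · obtain ⟨h1, h2, h3⟩ := hs.add m' v C w a h
    rw [hext.nodeKet hwf h1, hext.nodeKet hwf h2]
    exact ⟨hext.hasNode h1, hext.hasNode h2, h3.ext hext hwf⟩
  · obtain ⟨h1, h2, h3⟩ := hs.apply n P v Q w a h
    rw [hext.nodeKet hwf h1, hext.nodeKet hwf h2]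
    exact ⟨hext.hasNode h1, hext.hasNode h2, h3.ext hext hwf⟩
  · obtain ⟨h1, h2⟩ := hs.norm n v a h
    rw [hext.nodeKet hwf h1]
    exact ⟨hext.hasNode h1, h2⟩
  · obtain ⟨h1, h2⟩ := hs.proj n v q b a h
    rw [hext.nodeKet hwf h1]
    exact ⟨hext.hasNode h1, h2⟩
  · obtain ⟨h1, h2⟩ := hs.post n v q b a h
    rw [hext.nodeKet hwf h1]
    exact ⟨hext.hasNode h1, h2.ext hext hwf⟩

end AddNode

section Operations

variable {D K m : ℕ} {s : Store}

theorem pow_three_le_opCost {a n : ℕ} (ha : a ≤ 300) (hn : n ≤ D + 2) (b : ℕ) :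
    a * n ^ 3 ≤ opCost D b := by
  calc a * n ^ 3 ≤ 300 * (D + 2) ^ 3 := by gcongr
    _ ≤ opCost D b := Nat.le_mul_of_pos_right _ (Nat.succ_pos b)

theorem spec_rootLabel {n : ℕ} {A : LIM n} (hA : A.coeff ≠ 0) {v : ℕ} (hv : s.nodes.HasNode n v)
    (hn : n ≤ D) :
    Spec D 1 s (rootLabel A v) fun C s' =>
      (C.coeff ≠ 0 ∧ C.act (s.nodes.nodeKet n v) = A.act (s.nodes.nodeKet n v)) ∧
        ∃ k, s' = s.addSteps k :=
  Spec.readOnly (fun hs => readOnly_rootLabel hA (hs.good.nodeKet_ne_zero hv) (hs.gens n v hv))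
    fun b _ => pow_three_le_opCost (by norm_num) (by omega) b

theorem spec_follow {e : Edge (m + 1)} {φ : Ket (m + 1)} (he : s.nodes.Den e φ) (b : Bool)
    (hm : m + 1 ≤ D) :
    Spec D 1 s (follow b e) fun f s' =>
      s.nodes.Den f (sub b φ) ∧ ∃ k, s' = s.addSteps k := by
  refine Spec.readOnly (c := 4 * (m + 2) + 1) (fun hs => ?_) fun c _ => ?_
  · unfold follow
    refine ReadOnly.bind (ReadOnly.charge le_rfl) fun _ k _ => ?_
    match e with
    | none =>
      obtain rfl := he.none_elim
      exact ReadOnly.pure Table.den_none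
    | some (A, v) =>
      obtain ⟨hA, hv, rfl⟩ := he.some_elim
      obtain ⟨u, hu, hmem⟩ := hv.exists_node
      obtain ⟨h1, h2, h3, h4⟩ := hs.good.wf m u hmem
      have hget : ReadOnly 1 (s.addSteps k) (getNode m v) fun r => r = some u :=
        ⟨_, 1, rfl, le_rfl, hu⟩
      refine (ReadOnly.bind (c₂ := 0) hget ?_).mono le_rfl fun _ h => h
      rintro _ l rfl
      refine ReadOnly.pure ?_
      rw [sub_act, Table.nodeKet_succ hu]
      have hrest : (LIM.mk (A.coeff * (A.ops 0).mat b (xor b (A.ops 0).xbit))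
          (Fin.tail A.ops)).coeff ≠ 0 := mul_ne_zero hA (Pauli.mat_ne_zero _ _)
      generalize LIM.mk (A.coeff * (A.ops 0).mat b (xor b (A.ops 0).xbit)) (Fin.tail A.ops) = R
        at hrest ⊢
      have hlabel : ∀ (L : Option (LIM m)) (i : ℕ), (∀ B, L = some B → B.coeff ≠ 0) →
          s.nodes.HasNode m i →
          s.nodes.Den (L.map fun L => (R * L, i))
            (R.act (Table.actLabel L (s.nodes.nodeKet m i))) := by
        intro L i hL hi
        match L with
        | none => rw [Table.actLabel, LIM.act_zero]; exact Table.den_none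
        | some B =>
          rw [Table.actLabel, LIM.toMatrix_mulVec, ← LIM.act_mul]
          exact Table.den_some (LIM.coeff_mul_ne_zero hrest (hL B rfl)) hi
      cases xor b (A.ops 0).xbit
      · rw [sub_false_join]
        exact hlabel _ _ h3 h1
      · rw [sub_true_join]
        exact hlabel _ _ h4 h2
  · have : 4 * (m + 2) + 1 ≤ 300 * (m + 1) ^ 3 := by
      have : (m + 1) ^ 3 = m ^ 3 + 3 * m ^ 2 + 3 * m + 1 := by ring
      nlinarith
    exact this.trans (pow_three_le_opCost le_rfl (by omega) c)

theorem spec_intern {v₀ v₁ : ℕ} {B : Option (LIM m)} (hv₀ : s.nodes.HasNode m v₀)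
    (hv₁ : s.nodes.HasNode m v₁) (hB : ∀ A, B = some A → A.coeff ≠ 0) (hm : m + 1 ≤ D) :
    Spec D 4 s (intern v₀ B v₁) fun i s' =>
      s'.nodes.HasNode (m + 1) i ∧ s'.nodes.nodeKet (m + 1) i =
        join (s.nodes.nodeKet m v₀) (Table.actLabel B (s.nodes.nodeKet m v₁)) := by
  refine Spec.intro fun hs => ?_
  have hwf := hs.good.wf
  have key : ∀ (s' : Store) (i : ℕ), s.nodes.Ext s'.nodes →
      (s'.nodes m)[i]? = some ⟨v₀, some 1, v₁, B⟩ →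
      s'.nodes.HasNode (m + 1) i ∧ s'.nodes.nodeKet (m + 1) i =
        join (s.nodes.nodeKet m v₀) (Table.actLabel B (s.nodes.nodeKet m v₁)) := by
    intro s' i hext hi
    refine ⟨(List.getElem?_eq_some_iff.mp hi).1, ?_⟩
    rw [Table.nodeKet_succ hi, hext.nodeKet hwf hv₀, hext.nodeKet hwf hv₁, Table.actLabel,
      LIM.toMatrix_mulVec, LIM.act_one]
  unfold intern
  refine Spec.bind Spec.get (Nat.zero_le _) ?_
  rintro _ _ - - ⟨rfl, rfl⟩
  refine Spec.bind (Spec.readOnly (fun _ => readOnly_findNode _ _ 0 _) fun b hb => ?_)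
    (by norm_num) ?_
  · have h1 := hb.nodes m
    have h2 : 4 * (m + 1) ≤ 299 * (D + 2) ^ 3 := by
      have : m + 1 ≤ (D + 2) ^ 3 := by
        calc m + 1 ≤ (D + 2) ^ 1 := by rw [pow_one]; omega
          _ ≤ (D + 2) ^ 3 := Nat.pow_le_pow_right (by omega) (by omega)
      omega
    have h3 : 1 ≤ (D + 2) ^ 3 := Nat.one_le_pow _ _ (by omega)
    unfold opCost
    generalize (D + 2) ^ 3 = X at *
    have h4 : 4 * (m + 1) * (s.nodes m).length ≤ 299 * X * b := Nat.mul_le_mul h2 h1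
    nlinarith
  rintro found s₁ - - ⟨hfound, k, rfl⟩
  match found with
  | some i =>
    obtain ⟨d, rfl, hd⟩ := hfound i rfl
    rw [Nat.zero_add]
    exact Spec.pure fun _ => key (s.addSteps k) d (Table.Ext.refl _) hd
  | none =>
    have hgens : ReadOnly (300 * (m + 2) ^ 3) (s.addSteps k) (stabilizerGens v₀ B v₁) fun G =>
        G.length ≤ 2 * (m + 1) ∧ ∀ g ∈ G, Stabilizes g (join (s.nodes.nodeKet m v₀)
          (Table.actLabel B (s.nodes.nodeKet m v₁))) := by
      have hs' := hs.addSteps k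
      match B with
      | none => exact readOnly_stabilizerGens_none (hs'.gens m v₀ hv₀)
      | some B =>
        rw [Table.actLabel, LIM.toMatrix_mulVec]
        exact readOnly_stabilizerGens_some (hB B rfl) (hs.good.nodeKet_ne_zero hv₀)
          (hs.good.nodeKet_ne_zero hv₁) (by rintro rfl; rfl) (hs'.gens m v₀ hv₀)
          (hs'.gens m v₁ hv₁)
    refine Spec.bind (Spec.readOnly (fun _ => hgens) fun b _ =>
      pow_three_le_opCost le_rfl (by omega) b) (by norm_num) ?_
    rintro G _ - - ⟨⟨hlen, hG⟩, l, rfl⟩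
    refine Spec.bind (Spec.readOnly (c := (2 * (m + 1) + 4) * (m + 2)) (fun _ =>
      ReadOnly.charge (Nat.mul_le_mul_right _ (by omega))) fun b _ => ?_) (by norm_num) ?_
    · have : (2 * (m + 1) + 4) * (m + 2) ≤ 300 * (m + 2) ^ 3 := by
        have h1 : (m + 2) ^ 3 = m ^ 3 + 6 * m ^ 2 + 12 * m + 8 := by ring
        nlinarith
      exact this.trans (pow_three_le_opCost le_rfl (by omega) b)
    rintro _ _ hs₃ - ⟨-, j, rfl⟩
    refine Spec.bind (Q := fun _ s' => s' = (((s.addSteps k).addSteps l).addSteps j).addNode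
      ⟨v₀, some 1, v₁, B⟩ G) (Spec.modify (fun h => h.addNode rfl hv₀ hv₁ hB hlen hG)
        Store.addNode_ext (Store.addNode_stepsTo D)) (by norm_num) ?_
    rintro _ _ - hext rfl
    exact Spec.pure fun _ => key _ _ hext Store.addNode_getElem?

theorem spec_makeOrdered {A : LIM m} (hA : A.coeff ≠ 0) {v₀ : ℕ} (hv₀ : s.nodes.HasNode m v₀)
    {e₁ : Edge m} {φ₁ : Ket m} (he₁ : s.nodes.Den e₁ φ₁) (hm : m + 1 ≤ D) :
    Spec D 6 s (makeOrdered A v₀ e₁) fun e s' =>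
      s'.nodes.Den e (join (A.act (s.nodes.nodeKet m v₀)) φ₁) := by
  refine Spec.intro fun hs => ?_
  unfold makeOrdered
  refine Spec.bind (Spec.charge (by norm_num) hm) (by norm_num) ?_
  rintro _ _ - - ⟨k, rfl⟩
  match e₁ with
  | none =>
    obtain rfl := he₁.none_elim
    refine Spec.bind (spec_intern (v₀ := v₀) (v₁ := v₀) (B := none) hv₀ hv₀ (by simp) hm)
      (by norm_num) ?_
    rintro i s' - - ⟨hi, hket⟩
    refine Spec.pure fun _ => ?_
    have h : s'.nodes.Den _ _ := Table.den_some (A := LIM.cons Pauli.I A) hA hi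
    rw [hket, act_cons_I] at h
    change s'.nodes.Den _ (join _ (A.act 0)) at h
    rwa [LIM.act_zero] at h
  | some (B, v₁) =>
    obtain ⟨hB, hv₁, rfl⟩ := he₁.some_elim
    have hs' := hs.addSteps k
    refine Spec.bind (Spec.readOnly (fun _ => readOnly_getLabels
      (LIM.coeff_mul_ne_zero (LIM.coeff_inv_ne_zero hA) hB) (hs.good.nodeKet_ne_zero hv₀)
      (hs.good.nodeKet_ne_zero hv₁) (by rintro rfl; rfl) (hs'.gens m v₀ hv₀) (hs'.gens m v₁ hv₁))
      fun b _ => pow_three_le_opCost (by norm_num) (by omega) b) (by norm_num) ?_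
    rintro ⟨high, root⟩ _ - - ⟨⟨hhigh, hroot, hact⟩, l, rfl⟩
    dsimp only at hhigh hroot hact
    refine Spec.bind (spec_intern (v₀ := v₀) (v₁ := v₁) (B := some high) hv₀ hv₁
      (by rintro _ ⟨⟩; exact hhigh) hm) (by norm_num) ?_
    rintro i s' - - ⟨hi, hket⟩
    refine Spec.pure fun _ => ?_
    have h : s'.nodes.Den _ _ := Table.den_some (A := LIM.cons Pauli.I A * root)
      (LIM.coeff_mul_ne_zero (A := LIM.cons Pauli.I A) hA hroot) hi
    rw [hket, LIM.act_mul, Table.actLabel, LIM.toMatrix_mulVec] at h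
    change s'.nodes.Den _ ((LIM.cons Pauli.I A).act (root.act (join (s.nodes.nodeKet m v₀)
      (high.act (s.nodes.nodeKet m v₁))))) at h
    rwa [hact, act_cons_I, LIM.act_mul, LIM.act_act_inv hA] at h

theorem spec_makeEdge {e₀ e₁ : Edge m} {φ₀ φ₁ : Ket m} (he₀ : s.nodes.Den e₀ φ₀)
    (he₁ : s.nodes.Den e₁ φ₁) (hm : m + 1 ≤ D) :
    Spec D 7 s (makeEdge e₀ e₁) fun e s' => s'.nodes.Den e (join φ₀ φ₁) := by
  have hswap : ∀ (s' : Store) (e : Edge (m + 1)), s'.nodes.Den e (join φ₁ φ₀) →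
      s'.nodes.Den (e.act (LIM.cons Pauli.X 1)) (join φ₀ φ₁) := by
    intro s' e h
    have := h.act (A := LIM.cons Pauli.X 1) (LIM.coeff_one_ne_zero (n := m))
    rwa [act_cons_X, LIM.act_one, LIM.act_one] at this
  unfold makeEdge
  refine Spec.bind (Spec.charge (by norm_num) hm) (by norm_num) ?_
  rintro _ _ - - ⟨k, rfl⟩
  match e₀, e₁ with
  | none, none =>
    obtain rfl := he₀.none_elim
    obtain rfl := he₁.none_elim
    exact Spec.pure fun _ => by rw [join_zero]; exact Table.den_none
  | some (A, v), none =>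
    obtain ⟨hA, hv, rfl⟩ := he₀.some_elim
    exact spec_makeOrdered (s := s.addSteps k) hA hv he₁ hm
  | none, some (B, w) =>
    obtain ⟨hB, hw, rfl⟩ := he₁.some_elim
    refine Spec.bind (spec_makeOrdered (s := s.addSteps k) hB hw he₀ hm) le_rfl ?_
    rintro e s' - - h
    exact Spec.pure fun _ => hswap s' e h
  | some (A, v), some (B, w) =>
    obtain ⟨hA, hv, rfl⟩ := he₀.some_elim
    obtain ⟨hB, hw, rfl⟩ := he₁.some_elim
    dsimp only
    split_ifs
    · exact spec_makeOrdered (s := s.addSteps k) hA hv he₁ hm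
    · refine Spec.bind (spec_makeOrdered (s := s.addSteps k) hB hw he₀ hm) le_rfl ?_
      rintro e s' - - h
      exact Spec.pure fun _ => hswap s' e h

end Operations

/-! ### Cache entries -/

section Caches

variable {D m : ℕ} {s : Store}

theorem length_update_cons_le {κ : ℕ → Type} {l : (m : ℕ) → List (κ m)} {b : ℕ}
    (hl : ∀ m, (l m).length ≤ b) (m : ℕ) (x : κ m) (m' : ℕ) :
    (Function.update l m (x :: l m) m').length ≤ b + 1 := by
  by_cases h : m' = m
  · subst h
    simpa using hl m'
  · rw [Function.update_of_ne h]
    exact (hl m').trans (Nat.le_succ b)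

theorem forall_mem_update_cons {κ : ℕ → Type} {l : (m : ℕ) → List (κ m)} {P : ∀ m, κ m → Prop}
    (hl : ∀ m, ∀ y ∈ l m, P m y) {m : ℕ} {x : κ m} (hx : P m x) (m' : ℕ) :
    ∀ y ∈ Function.update l m (x :: l m) m', P m' y := by
  by_cases h : m' = m
  · subst h
    simpa [hx] using hl m'
  · rw [Function.update_of_ne h]
    exact hl m'

theorem Store.Inv.gensSound_of_eq {s s' : Store} (hs : s.Inv) (hnodes : s'.nodes = s.nodes)
    (hgens : s'.gens = s.gens) (n v : ℕ) (hv : s'.nodes.HasNode n v) :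
    s'.GensSound n v (s'.nodes.nodeKet n v) := by
  rw [hnodes] at hv ⊢
  have := hs.gens n v hv
  cases n
  · exact this
  · simpa only [Store.GensSound, Store.gensOf, hgens] using this

theorem spec_insertAdd {v w : ℕ} {C : LIM m} {a : Edge m} (hv : s.nodes.HasNode m v)
    (hw : s.nodes.HasNode m w)
    (ha : s.nodes.Den a (s.nodes.nodeKet m v + C.act (s.nodes.nodeKet m w))) :
    Spec D 1 s (modify fun s => { s with
      addCache := Function.update s.addCache m (((v, C, w), a) :: s.addCache m) })
      fun _ s' => s'.nodes = s.nodes :=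
  (Spec.modify (fun hs => ⟨hs.good, hs.gens_length, hs.gensSound_of_eq rfl rfl,
      fun m' v' C' w' a' h => forall_mem_update_cons
        (P := fun m' x => s.nodes.HasNode m' x.1.1 ∧ s.nodes.HasNode m' x.1.2.2 ∧
          s.nodes.Den x.2 (s.nodes.nodeKet m' x.1.1 + x.1.2.1.act (s.nodes.nodeKet m' x.1.2.2)))
        (fun m' x hx => hs.add m' _ _ _ _ hx) ⟨hv, hw, ha⟩ m' _ h,
      hs.apply, hs.norm, hs.proj, hs.post⟩)
    (Table.Ext.refl _) fun _ hb => ⟨⟨fun m' => (hb.nodes m').trans (Nat.le_succ _),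
      length_update_cons_le hb.add m _, fun m' => (hb.apply m').trans (Nat.le_succ _),
      fun m' => (hb.norm m').trans (Nat.le_succ _), fun m' => (hb.proj m').trans (Nat.le_succ _),
      fun m' => (hb.post m').trans (Nat.le_succ _)⟩, Nat.le_add_right _ _⟩).mono le_rfl
    fun _ _ _ _ h => by rw [h]

theorem spec_insertApply {v w : ℕ} {P : LIM (2 * m)} {Q : LIM m} {a : Edge m}
    (hv : s.nodes.HasNode (2 * m) v) (hw : s.nodes.HasNode m w)
    (ha : s.nodes.Den a (applyKet m (P.act (s.nodes.nodeKet (2 * m) v))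
      (Q.act (s.nodes.nodeKet m w)))) :
    Spec D 1 s (modify fun s => { s with
      applyCache := Function.update s.applyCache m ((((P, v), (Q, w)), a) :: s.applyCache m) })
      fun _ s' => s'.nodes = s.nodes :=
  (Spec.modify (fun hs => ⟨hs.good, hs.gens_length, hs.gensSound_of_eq rfl rfl, hs.add,
      fun m' P' v' Q' w' a' h => forall_mem_update_cons
        (P := fun m' x => s.nodes.HasNode (2 * m') x.1.1.2 ∧ s.nodes.HasNode m' x.1.2.2 ∧
          s.nodes.Den x.2 (applyKet m' (x.1.1.1.act (s.nodes.nodeKet (2 * m') x.1.1.2))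
            (x.1.2.1.act (s.nodes.nodeKet m' x.1.2.2))))
        (fun m' x hx => hs.apply m' _ _ _ _ _ hx) ⟨hv, hw, ha⟩ m' _ h,
      hs.norm, hs.proj, hs.post⟩)
    (Table.Ext.refl _) fun _ hb => ⟨⟨fun m' => (hb.nodes m').trans (Nat.le_succ _),
      fun m' => (hb.add m').trans (Nat.le_succ _), length_update_cons_le hb.apply m _,
      fun m' => (hb.norm m').trans (Nat.le_succ _), fun m' => (hb.proj m').trans (Nat.le_succ _),
      fun m' => (hb.post m').trans (Nat.le_succ _)⟩, Nat.le_add_right _ _⟩).mono le_rfl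
    fun _ _ _ _ h => by rw [h]

theorem spec_insertNorm {v : ℕ} {a : ℝ} (hv : s.nodes.HasNode m v)
    (ha : a = sqNorm (s.nodes.nodeKet m v)) :
    Spec D 1 s (modify fun s => { s with
      normCache := Function.update s.normCache m ((v, a) :: s.normCache m) })
      fun _ s' => s'.nodes = s.nodes :=
  (Spec.modify (fun hs => ⟨hs.good, hs.gens_length, hs.gensSound_of_eq rfl rfl, hs.add, hs.apply,
      fun m' v' a' h => forall_mem_update_cons
        (P := fun m' x => s.nodes.HasNode m' x.1 ∧ x.2 = sqNorm (s.nodes.nodeKet m' x.1))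
        (fun m' x hx => hs.norm m' _ _ hx) ⟨hv, ha⟩ m' _ h,
      hs.proj, hs.post⟩)
    (Table.Ext.refl _) fun _ hb => ⟨⟨fun m' => (hb.nodes m').trans (Nat.le_succ _),
      fun m' => (hb.add m').trans (Nat.le_succ _), fun m' => (hb.apply m').trans (Nat.le_succ _),
      length_update_cons_le (κ := fun _ => ℕ × ℝ) hb.norm m _,
      fun m' => (hb.proj m').trans (Nat.le_succ _),
      fun m' => (hb.post m').trans (Nat.le_succ _)⟩, Nat.le_add_right _ _⟩).mono le_rfl
    fun _ _ _ _ h => by rw [h]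

theorem spec_insertProj {v : ℕ} {q : Fin m} {b : Bool} {a : ℝ} (hv : s.nodes.HasNode m v)
    (ha : a = sqNorm (projectKet q b (s.nodes.nodeKet m v))) :
    Spec D 1 s (modify fun s => { s with
      projCache := Function.update s.projCache m (((v, q, b), a) :: s.projCache m) })
      fun _ s' => s'.nodes = s.nodes :=
  (Spec.modify (fun hs => ⟨hs.good, hs.gens_length, hs.gensSound_of_eq rfl rfl, hs.add, hs.apply,
      hs.norm, fun m' v' q' b' a' h => forall_mem_update_cons
        (κ := fun m => (ℕ × Fin m × Bool) × ℝ)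
        (P := fun m' x => s.nodes.HasNode m' x.1.1 ∧
          x.2 = sqNorm (projectKet x.1.2.1 x.1.2.2 (s.nodes.nodeKet m' x.1.1)))
        (fun m' x hx => hs.proj m' _ _ _ _ hx) ⟨hv, ha⟩ m' _ h,
      hs.post⟩)
    (Table.Ext.refl _) fun _ hb => ⟨⟨fun m' => (hb.nodes m').trans (Nat.le_succ _),
      fun m' => (hb.add m').trans (Nat.le_succ _), fun m' => (hb.apply m').trans (Nat.le_succ _),
      fun m' => (hb.norm m').trans (Nat.le_succ _),
      length_update_cons_le (κ := fun m => (ℕ × Fin m × Bool) × ℝ) hb.proj m _,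
      fun m' => (hb.post m').trans (Nat.le_succ _)⟩, Nat.le_add_right _ _⟩).mono le_rfl
    fun _ _ _ _ h => by rw [h]

theorem spec_insertPost {v : ℕ} {q : Fin m} {b : Bool} {a : Edge m} (hv : s.nodes.HasNode m v)
    (ha : s.nodes.Den a (projectKet q b (s.nodes.nodeKet m v))) :
    Spec D 1 s (modify fun s => { s with
      postCache := Function.update s.postCache m (((v, q, b), a) :: s.postCache m) })
      fun _ s' => s'.nodes = s.nodes :=
  (Spec.modify (fun hs => ⟨hs.good, hs.gens_length, hs.gensSound_of_eq rfl rfl, hs.add, hs.apply,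
      hs.norm, hs.proj, fun m' v' q' b' a' h => forall_mem_update_cons
        (P := fun m' x => s.nodes.HasNode m' x.1.1 ∧
          s.nodes.Den x.2 (projectKet x.1.2.1 x.1.2.2 (s.nodes.nodeKet m' x.1.1)))
        (fun m' x hx => hs.post m' _ _ _ _ hx) ⟨hv, ha⟩ m' _ h⟩)
    (Table.Ext.refl _) fun _ hb => ⟨⟨fun m' => (hb.nodes m').trans (Nat.le_succ _),
      fun m' => (hb.add m').trans (Nat.le_succ _), fun m' => (hb.apply m').trans (Nat.le_succ _),
      fun m' => (hb.norm m').trans (Nat.le_succ _), fun m' => (hb.proj m').trans (Nat.le_succ _),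
      length_update_cons_le hb.post m _⟩, Nat.le_add_right _ _⟩).mono le_rfl
    fun _ _ _ _ h => by rw [h]

theorem scan_weight_le {w : ℕ} (hw : w ≤ 3 * D + 8) : w ≤ 300 * (D + 2) ^ 3 - 1 := by
  have : D + 2 ≤ (D + 2) ^ 3 := by
    calc D + 2 = (D + 2) ^ 1 := (pow_one _).symm
      _ ≤ (D + 2) ^ 3 := Nat.pow_le_pow_right (by omega) (by omega)
  omega

end Caches

/-! ### Addition -/

section Add

variable {D : ℕ}

/-- Addition descends only where both summands are nonzero.  At each level the supports of the pairs
of summands on which it is called are disjoint, so there are at most as many calls as nonzero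
amplitudes. -/
theorem spec_addEdges (n : ℕ) (hn : n ≤ D) {s : Store} {e f : Edge n} {φ ψ : Ket n}
    (he : s.nodes.Den e φ) (hf : s.nodes.Den f ψ) :
    Spec D (1 + 8 * n * (compRank φ + compRank ψ)) s (addEdges n e f)
      fun a s' => s'.nodes.Den a (φ + ψ) := by
  induction n generalizing s with
  | zero =>
    unfold addEdges
    refine Spec.bind (Spec.tick (k := 3) (by
      have : 1 ≤ (D + 2) ^ 3 := Nat.one_le_pow _ _ (by omega)
      omega)) (by omega) ?_
    rintro _ _ - - ⟨k, rfl⟩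
    match e, f with
    | none, f =>
      obtain rfl := he.none_elim
      rw [zero_add]
      exact Spec.pure fun _ => hf
    | some e, none =>
      obtain rfl := hf.none_elim
      rw [add_zero]
      exact Spec.pure fun _ => he
    | some (A, v), some (B, w) =>
      obtain ⟨hA, hv, rfl⟩ := he.some_elim
      obtain ⟨hB, hw, rfl⟩ := hf.some_elim
      refine Spec.pure fun _ => ?_
      have hact : ∀ (C : LIM 0) (i : ℕ), C.act (s.nodes.nodeKet 0 i) = fun _ => C.coeff := by
        intro C i
        funext x
        simp [LIM.act, LIM.entry, Table.nodeKet]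
      rw [hact, hact]
      split_ifs with h
      · have h0 : ((fun _ => A.coeff) + (fun _ => B.coeff) : Ket 0) = 0 := by
          funext x; exact h
        rw [h0]
        exact Table.den_none
      · have := Table.den_some (T := s.nodes) (A := (⟨A.coeff + B.coeff, A.ops⟩ : LIM 0)) h
          (i := 0) rfl
        rwa [hact] at this
  | succ m ih =>
    refine Spec.intro fun hs => ?_
    have hwf := hs.good.wf
    unfold addEdges
    refine Spec.bind (Spec.charge (by norm_num) hn) (by omega) ?_
    rintro _ _ hs₁ - ⟨k, rfl⟩
    match e, f with
    | none, f =>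
      obtain rfl := he.none_elim
      rw [zero_add]
      exact Spec.pure fun _ => hf
    | some e, none =>
      obtain rfl := hf.none_elim
      rw [add_zero]
      exact Spec.pure fun _ => he
    | some e, some f =>
      dsimp only
      obtain ⟨A, v, B, w, φ', ψ', h1, h2, hA, hB, hsum, hrank⟩ : ∃ (A : LIM (m + 1)) (v : ℕ)
          (B : LIM (m + 1)) (w : ℕ) (φ' ψ' : Ket (m + 1)),
          (if e.2 ≤ f.2 then e else f) = (A, v) ∧ (if e.2 ≤ f.2 then f else e) = (B, w) ∧
          s.nodes.Den (some (A, v)) φ' ∧ s.nodes.Den (some (B, w)) ψ' ∧ φ + ψ = φ' + ψ' ∧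
          compRank φ + compRank ψ = compRank φ' + compRank ψ' := by
        split_ifs
        · exact ⟨e.1, e.2, f.1, f.2, φ, ψ, rfl, rfl, he, hf, rfl, rfl⟩
        · exact ⟨f.1, f.2, e.1, e.2, ψ, φ, rfl, rfl, hf, he, add_comm _ _, add_comm _ _⟩
      rw [h1, h2, hsum, hrank]
      have hφ0 := one_le_compRank (hA.ne_zero hs.good)
      have hψ0 := one_le_compRank (hB.ne_zero hs.good)
      -- The 17 operations of this call are paid for by the additional level, since each of the two
      -- summands has a nonzero amplitude.
      have hK : 17 + 8 * m * (compRank (sub false φ') + compRank (sub false ψ')) +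
          8 * m * (compRank (sub true φ') + compRank (sub true ψ')) ≤
          1 + 8 * (m + 1) * (compRank φ' + compRank ψ') := by
        rw [compRank_sub φ', compRank_sub ψ'] at *
        nlinarith
      generalize 1 + 8 * (m + 1) * (compRank φ' + compRank ψ') = K at hK ⊢
      obtain ⟨hA0, hv, hφ'⟩ := hA.some_elim
      obtain ⟨hB0, hw, hψ'⟩ := hB.some_elim
      dsimp only
      refine Spec.bind (spec_rootLabel (LIM.coeff_mul_ne_zero (LIM.coeff_inv_ne_zero hA0) hB0)
        hw hn) (by omega) ?_
      rintro C _ hs₂ - ⟨⟨hC0, hC⟩, k₂, rfl⟩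
      refine Spec.bind Spec.get (by omega) ?_
      rintro _ _ - - ⟨rfl, rfl⟩
      refine Spec.bind (Spec.scan (scan_weight_le (by omega)) fun b hb => hb.add _) (by omega) ?_
      rintro hit _ - - ⟨hhit, k₃, rfl⟩
      have hC' : C.act (s.nodes.nodeKet (m + 1) w) = A⁻¹.act ψ' := by
        rw [hψ', ← LIM.act_mul]; exact hC
      match hit with
      | some a =>
        obtain ⟨-, -, h3⟩ := hs₂.add _ _ _ _ _ (hhit a rfl)
        refine Spec.pure fun _ => ?_
        have h4 : s.nodes.Den _ _ := Table.Den.act h3 hA0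
        change s.nodes.Den _ (A.act (s.nodes.nodeKet (m + 1) v +
          C.act (s.nodes.nodeKet (m + 1) w))) at h4
        rwa [hC', LIM.act_add, LIM.act_act_inv hA0, ← hφ'] at h4
      | none =>
        dsimp only
        refine Spec.bind (spec_follow (s := ((s.addSteps k).addSteps k₂).addSteps k₃) hA false hn)
          (by omega) ?_
        rintro e₀ _ - - ⟨he₀, k₄, rfl⟩
        refine Spec.bind (spec_follow (s := (((s.addSteps k).addSteps k₂).addSteps k₃).addSteps k₄)
          hB false hn) (by omega) ?_
        rintro f₀ s₅ hs₅ hext₅ ⟨hf₀, k₅, rfl⟩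
        refine Spec.bind (ih (s := ((((s.addSteps k).addSteps k₂).addSteps k₃).addSteps k₄).addSteps
          k₅) (by omega) he₀ hf₀) (by omega) ?_
        rintro a₀ s₆ hs₆ hext₆ ha₀
        have hext₆' : s.nodes.Ext s₆.nodes := hext₆
        refine Spec.bind (spec_follow (hA.ext hext₆' hwf) true hn) (by omega) ?_
        rintro e₁ _ - - ⟨he₁, k₇, rfl⟩
        refine Spec.bind (spec_follow (s := s₆.addSteps k₇) (hB.ext hext₆' hwf) true hn)
          (by omega) ?_
        rintro f₁ _ - - ⟨hf₁, k₈, rfl⟩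
        refine Spec.bind (ih (s := (s₆.addSteps k₇).addSteps k₈) (by omega) he₁ hf₁) (by omega) ?_
        rintro a₁ s₉ hs₉ hext₉ ha₁
        have hext₉' : s₆.nodes.Ext s₉.nodes := hext₉
        refine Spec.bind (spec_makeEdge (ha₀.ext hext₉' hs₆.good.wf) ha₁ hn) (by omega) ?_
        rintro a s' hs' hext' ha
        rw [← join_add, join_sub, join_sub] at ha
        have hext : s.nodes.Ext s'.nodes := (hext₆'.trans hext₉').trans hext'
        refine Spec.bind (spec_insertAdd (hext.hasNode hv) (hext.hasNode hw) ?_) (by omega) ?_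
        · have h3 := ha.act (LIM.coeff_inv_ne_zero hA0)
          rw [LIM.act_add, hφ', LIM.act_inv_act hA0] at h3
          rw [hext.nodeKet hwf hv, hext.nodeKet hwf hw, hC']
          exact h3
        · rintro _ s'' - - hnodes
          exact Spec.pure fun _ => by rw [hnodes]; exact ha

end Add

/-! ### Gate application -/

section Apply

variable {n : ℕ}

@[simp] theorem quad_smul (r c : Bool) (a : ℂ) (U : Ket (2 * (n + 1))) :
    quad r c (a • U) = a • quad r c U := rfl

theorem applyKet_smul (a b : ℂ) (U : Ket (2 * n)) (φ : Ket n) :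
    applyKet n (a • U) (b • φ) = (a * b) • applyKet n U φ := by
  induction n with
  | zero => funext x; simp only [applyKet, Pi.smul_apply, smul_eq_mul]; ring
  | succ n ih => simp only [applyKet, quad_smul, sub_smul, ih, smul_join, smul_add]

theorem applyKet_zero_left (φ : Ket n) : applyKet n 0 φ = 0 := by
  have := applyKet_smul 0 1 (0 : Ket (2 * n)) φ
  simpa using this

theorem applyKet_zero_right (U : Ket (2 * n)) : applyKet n U 0 = 0 := by
  have := applyKet_smul 1 0 U (0 : Ket n)
  simpa using this

open scoped Classical in
/-- The number of pairs of a block of the matrix `U` and a subvector of `φ` at the same level that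
meet in the product and are both nonzero: a bound for the recursive calls of `applyGate`. -/
noncomputable def calls : (n : ℕ) → Ket (2 * n) → Ket n → ℕ
  | 0, U, φ => if U = 0 ∨ φ = 0 then 0 else 1
  | n + 1, U, φ => if U = 0 ∨ φ = 0 then 0 else
      1 + (calls n (quad false false U) (sub false φ) + calls n (quad false true U) (sub true φ) +
        calls n (quad true false U) (sub false φ) + calls n (quad true true U) (sub true φ))

theorem compRank_ket_zero_le (φ : Ket 0) : compRank φ ≤ 1 := by
  refine (Set.ncard_le_card _).trans ?_
  simp

theorem compRank_applyKet_le (U : Ket (2 * n)) (φ : Ket n) :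
    compRank (applyKet n U φ) ≤ calls n U φ := by
  induction n with
  | zero =>
    unfold calls
    split_ifs with h
    · rcases h with rfl | rfl
      · rw [applyKet_zero_left, compRank_zero]
      · rw [applyKet_zero_right, compRank_zero]
    · exact compRank_ket_zero_le _
  | succ n ih =>
    rw [calls]
    split_ifs with h
    · rcases h with rfl | rfl
      · rw [applyKet_zero_left, compRank_zero]
      · rw [applyKet_zero_right, compRank_zero]
    · rw [applyKet, compRank_join]
      have h1 := compRank_add_le (applyKet n (quad false false U) (sub false φ))
        (applyKet n (quad false true U) (sub true φ))
      have h2 := compRank_add_le (applyKet n (quad true false U) (sub false φ))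
        (applyKet n (quad true true U) (sub true φ))
      have h3 := ih (quad false false U) (sub false φ)
      have h4 := ih (quad false true U) (sub true φ)
      have h5 := ih (quad true false U) (sub false φ)
      have h6 := ih (quad true true U) (sub true φ)
      omega

/-- The recursion descends only to pairs that are counted by `calls`, and each addition is paid for
by the supports of the summands, which `calls` bounds as well. -/
theorem spec_applyGate {D : ℕ} (n : ℕ) (hn : 2 * n ≤ D) {s : Store} {u : Edge (2 * n)} {e : Edge n}
    {U : Ket (2 * n)} {φ : Ket n} (hu : s.nodes.Den u U) (he : s.nodes.Den e φ) :
    Spec D (1 + (30 + 8 * n ^ 2) * calls n U φ) s (applyGate n u e)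
      fun a s' => s'.nodes.Den a (applyKet n U φ) := by
  induction n generalizing s with
  | zero =>
    unfold applyGate
    refine Spec.bind (Spec.tick (k := 3) (by
      have : 1 ≤ (D + 2) ^ 3 := Nat.one_le_pow _ _ (by omega)
      omega)) (by omega) ?_
    rintro _ _ - - ⟨k, rfl⟩
    match u, e with
    | none, e =>
      obtain rfl := hu.none_elim
      rw [applyKet_zero_left]
      exact Spec.pure fun _ => Table.den_none
    | some _, none =>
      obtain rfl := he.none_elim
      rw [applyKet_zero_right]
      exact Spec.pure fun _ => Table.den_none
    | some (A, v), some (B, w) =>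
      obtain ⟨hA, hv, rfl⟩ := hu.some_elim
      obtain ⟨hB, hw, rfl⟩ := he.some_elim
      refine Spec.pure fun _ => ?_
      have hact : ∀ (C : LIM 0) (i : ℕ), C.act (s.nodes.nodeKet 0 i) = fun _ => C.coeff := by
        intro C i
        funext x
        simp [LIM.act, LIM.entry, Table.nodeKet]
      have h1 : applyKet 0 (A.act (s.nodes.nodeKet (2 * 0) v)) (B.act (s.nodes.nodeKet 0 w)) =
          fun _ => A.coeff * B.coeff := by
        rw [hact B]
        funext x
        exact congrArg (· * B.coeff) (congrFun (hact A v) _)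
      rw [h1]
      have := Table.den_some (T := s.nodes) (A := (⟨A.coeff * B.coeff, B.ops⟩ : LIM 0))
        (mul_ne_zero hA hB) (i := 0) rfl
      rwa [hact] at this
  | succ n ih =>
    refine Spec.intro fun hs => ?_
    have hwf := hs.good.wf
    unfold applyGate
    refine Spec.bind (Spec.charge (by norm_num) hn) (by omega) ?_
    rintro _ _ hs₁ - ⟨k, rfl⟩
    match u, e with
    | none, e =>
      obtain rfl := hu.none_elim
      rw [applyKet_zero_left]
      exact Spec.pure fun _ => Table.den_none
    | some _, none =>
      obtain rfl := he.none_elim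
      rw [applyKet_zero_right]
      exact Spec.pure fun _ => Table.den_none
    | some (A, v), some (B, w) =>
      obtain ⟨hA, hv, hU⟩ := hu.some_elim
      obtain ⟨hB, hw, hφ⟩ := he.some_elim
      have hU0 := hu.ne_zero hs.good
      have hφ0 := he.ne_zero hs.good
      have r1 := compRank_applyKet_le (quad false false U) (sub false φ)
      have r2 := compRank_applyKet_le (quad false true U) (sub true φ)
      have r3 := compRank_applyKet_le (quad true false U) (sub false φ)
      have r4 := compRank_applyKet_le (quad true true U) (sub true φ)
      -- The 29 operations of this call and the two additions are paid for by the increase of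
      -- `30 + 8 * n ^ 2` and by the count of this call itself.
      have hK : 29 + ((1 + (30 + 8 * n ^ 2) * calls n (quad false false U) (sub false φ)) +
          (1 + (30 + 8 * n ^ 2) * calls n (quad false true U) (sub true φ)) +
          (1 + (30 + 8 * n ^ 2) * calls n (quad true false U) (sub false φ)) +
          (1 + (30 + 8 * n ^ 2) * calls n (quad true true U) (sub true φ))) +
          8 * n * (compRank (applyKet n (quad false false U) (sub false φ)) +
            compRank (applyKet n (quad false true U) (sub true φ))) +
          8 * n * (compRank (applyKet n (quad true false U) (sub false φ)) +
            compRank (applyKet n (quad true true U) (sub true φ))) ≤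
          1 + (30 + 8 * (n + 1) ^ 2) * calls (n + 1) U φ := by
        rw [calls, if_neg (by simp [hU0, hφ0])]
        generalize calls n (quad false false U) (sub false φ) = c1 at *
        generalize calls n (quad false true U) (sub true φ) = c2 at *
        generalize calls n (quad true false U) (sub false φ) = c3 at *
        generalize calls n (quad true true U) (sub true φ) = c4 at *
        generalize compRank (applyKet n (quad false false U) (sub false φ)) = d1 at *
        generalize compRank (applyKet n (quad false true U) (sub true φ)) = d2 at *
        generalize compRank (applyKet n (quad true false U) (sub false φ)) = d3 at *
        generalize compRank (applyKet n (quad true true U) (sub true φ)) = d4 at *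
        have h1 : 8 * n * (d1 + d2) ≤ 8 * n * (c1 + c2) := by gcongr
        have h2 : 8 * n * (d3 + d4) ≤ 8 * n * (c3 + c4) := by gcongr
        nlinarith
      generalize 1 + (30 + 8 * (n + 1) ^ 2) * calls (n + 1) U φ = K at hK ⊢
      dsimp only
      have hP : A.pauliString.coeff ≠ 0 := one_ne_zero (α := ℂ)
      have hQ : B.pauliString.coeff ≠ 0 := one_ne_zero (α := ℂ)
      refine Spec.bind (spec_rootLabel hP hv hn) (by omega) ?_
      rintro P _ hs₂ - ⟨⟨-, hPv⟩, k₂, rfl⟩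
      refine Spec.bind (spec_rootLabel (s := (s.addSteps k).addSteps k₂) hQ hw (by omega))
        (by omega) ?_
      rintro Q _ hs₃ - ⟨⟨-, hQw⟩, k₃, rfl⟩
      refine Spec.bind Spec.get (by omega) ?_
      rintro _ _ - - ⟨rfl, rfl⟩
      refine Spec.bind (Spec.scan (scan_weight_le (by omega)) fun b hb => hb.apply _) (by omega) ?_
      rintro hit _ - - ⟨hhit, k₄, rfl⟩
      have hPv' : P.act (s.nodes.nodeKet (2 * (n + 1)) v) =
        A.pauliString.act (s.nodes.nodeKet (2 * (n + 1)) v) := hPv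
      have hQw' : Q.act (s.nodes.nodeKet (n + 1) w) =
        B.pauliString.act (s.nodes.nodeKet (n + 1) w) := hQw
      have hprod : applyKet (n + 1) U φ = (A.coeff * B.coeff) • applyKet (n + 1)
          (P.act (s.nodes.nodeKet (2 * (n + 1)) v)) (Q.act (s.nodes.nodeKet (n + 1) w)) := by
        rw [hPv', hQw', ← applyKet_smul, ← LIM.act_pauliString, ← LIM.act_pauliString, ← hφ, ← hU]
      have hc : A.coeff * B.coeff ≠ 0 := mul_ne_zero hA hB
      match hit with
      | some a =>
        obtain ⟨-, -, h3⟩ := hs₃.apply _ _ _ _ _ _ (hhit a rfl)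
        refine Spec.pure fun _ => ?_
        rw [hprod]
        exact Table.Den.scale h3 hc
      | none =>
        dsimp only
        have hchild : ∀ (r c : Bool) (s₁ : Store), s₁.Inv → s.nodes.Ext s₁.nodes →
            Spec D (4 + (30 + 8 * n ^ 2) * calls n (quad r c U) (sub c φ)) s₁ (do
              let row ← follow (m := 2 * n + 1) r (some (A, v))
              let entry ← follow (m := 2 * n) c row
              let sub ← follow c (some (B, w))
              applyGate n entry sub) fun a s' =>
                s'.nodes.Den a (applyKet n (quad r c U) (sub c φ)) := by
          intro r c s₁ hs₁ hext
          refine Spec.bind (spec_follow (m := 2 * n + 1) (hu.ext hext hwf) r (by omega))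
            (by omega) ?_
          rintro row _ - - ⟨hrow, j₁, rfl⟩
          refine Spec.bind (spec_follow (s := s₁.addSteps j₁) (m := 2 * n) hrow c (by omega))
            (by omega) ?_
          rintro entry _ - - ⟨hentry, j₂, rfl⟩
          refine Spec.bind (spec_follow (s := (s₁.addSteps j₁).addSteps j₂) (he.ext hext hwf) c
            (by omega)) (by omega) ?_
          rintro part _ - - ⟨hpart, j₃, rfl⟩
          exact (ih (U := quad r c U) (s := ((s₁.addSteps j₁).addSteps j₂).addSteps j₃) (by omega)
            hentry hpart).mono (by omega) fun _ _ _ _ h => h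
        refine Spec.bind (hchild false false _ (hs₃.addSteps _) (Table.Ext.refl _)) (by omega) ?_
        rintro f₀₀ s₅ hs₅ hx₅ hf₀₀
        have hy₅ : s.nodes.Ext s₅.nodes := hx₅
        refine Spec.bind (hchild false true _ hs₅ hy₅) (by omega) ?_
        rintro f₀₁ s₆ hs₆ hx₆ hf₀₁
        have hy₆ := hy₅.trans hx₆
        refine Spec.bind (hchild true false _ hs₆ hy₆) (by omega) ?_
        rintro f₁₀ s₇ hs₇ hx₇ hf₁₀
        have hy₇ := hy₆.trans hx₇
        refine Spec.bind (hchild true true _ hs₇ hy₇) (by omega) ?_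
        rintro f₁₁ s₈ hs₈ hx₈ hf₁₁
        have hy₈ := hy₇.trans hx₈
        refine Spec.bind (spec_addEdges n (by omega)
          (hf₀₀.ext ((hx₆.trans hx₇).trans hx₈) hs₅.good.wf)
          (hf₀₁.ext (hx₇.trans hx₈) hs₆.good.wf)) (by omega) ?_
        rintro e₀ s₉ hs₉ hx₉ he₀
        refine Spec.bind (spec_addEdges n (by omega) (hf₁₀.ext (hx₈.trans hx₉) hs₇.good.wf)
          (hf₁₁.ext hx₉ hs₈.good.wf)) (by omega) ?_
        rintro e₁ s₁₀ hs₁₀ hx₁₀ he₁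
        refine Spec.bind (spec_makeEdge (he₀.ext hx₁₀ hs₉.good.wf) he₁ (by omega)) (by omega) ?_
        rintro a s' hs' hx' ha
        have hext : s.nodes.Ext s'.nodes := ((hy₈.trans hx₉).trans hx₁₀).trans hx'
        change s'.nodes.Den a (applyKet (n + 1) U φ) at ha
        refine Spec.bind (spec_insertApply (hext.hasNode hv) (hext.hasNode hw) ?_) (by omega) ?_
        · have h3 := ha.scale (inv_ne_zero hc)
          rw [hprod, smul_smul, inv_mul_cancel₀ hc, one_smul] at h3
          rw [hext.nodeKet hwf hv, hext.nodeKet hwf hw]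
          exact h3
        · rintro _ s'' - - hnodes
          exact Spec.pure fun _ => by rw [hnodes]; exact ha

end Apply

/-! ### Diagrams of gates -/

section Matrices

variable {n : ℕ}

theorem sum_split_first {M : Type*} [AddCommMonoid M] (f : (Fin (n + 1) → Bool) → M) :
    ∑ x, f x = ∑ x, f (Fin.cons false x) + ∑ x, f (Fin.cons true x) := by
  rw [← (Fin.consEquiv fun _ => Bool).sum_comp, Fintype.sum_prod_type, Fintype.sum_bool, add_comm]
  rfl

/-- One of the four quadrants of a matrix. -/
def quadrant (r c : Bool) (M : Matrix (Fin (n + 1) → Bool) (Fin (n + 1) → Bool) ℂ) :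
    Matrix (Fin n → Bool) (Fin n → Bool) ℂ := fun x y => M (Fin.cons r x) (Fin.cons c y)

/-- A matrix as a vector with alternating row and column bits. -/
def ketOf : (n : ℕ) → Matrix (Fin n → Bool) (Fin n → Bool) ℂ → Ket (2 * n)
  | 0, M => fun _ => M (fun i => Fin.elim0 i) (fun i => Fin.elim0 i)
  | n + 1, M => join
      (join (ketOf n (quadrant false false M)) (ketOf n (quadrant false true M)) : Ket (2 * n + 1))
      (join (ketOf n (quadrant true false M)) (ketOf n (quadrant true true M)) : Ket (2 * n + 1))

theorem quad_ketOf (r c : Bool) (M : Matrix (Fin (n + 1) → Bool) (Fin (n + 1) → Bool) ℂ) :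
    quad r c (ketOf (n + 1) M) = ketOf n (quadrant r c M) := by
  cases r <;> cases c <;> simp [quad, ketOf]

theorem ketOf_zero : ketOf n 0 = 0 := by
  induction n with
  | zero => rfl
  | succ n ih =>
    have h : ∀ r c, quadrant r c (0 : Matrix (Fin (n + 1) → Bool) (Fin (n + 1) → Bool) ℂ) = 0 :=
      fun _ _ => rfl
    simp only [ketOf, h, ih, join_zero]

theorem ketOf_smul (a : ℂ) (M : Matrix (Fin n → Bool) (Fin n → Bool) ℂ) :
    ketOf n (a • M) = a • ketOf n M := by
  induction n with
  | zero => rfl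
  | succ n ih =>
    have h : ∀ r c, quadrant r c (a • M) = a • quadrant r c M := fun _ _ => rfl
    simp only [ketOf, h, ih]
    rw [← smul_join, ← smul_join, ← smul_join]

theorem applyKet_ketOf (M : Matrix (Fin n → Bool) (Fin n → Bool) ℂ) (φ : Ket n) :
    applyKet n (ketOf n M) φ = M.mulVec φ := by
  induction n with
  | zero =>
    funext x
    simp only [applyKet, ketOf, Matrix.mulVec, dotProduct, Fintype.sum_unique]
    congr 2 <;> exact Subsingleton.elim _ _
  | succ n ih =>
    have h : ∀ r, sub r (M.mulVec φ) = (quadrant r false M).mulVec (sub false φ) +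
        (quadrant r true M).mulVec (sub true φ) := by
      intro r
      funext x
      simp only [sub, Matrix.mulVec, dotProduct, Pi.add_apply, sum_split_first, quadrant]
    rw [← join_sub (M.mulVec φ), h, h, applyKet]
    simp only [quad_ketOf, ih]

/-- Products of `M` with vectors `φ` need at most `a * compRank φ` recursive calls on each of the
`n + 1` levels. -/
def CallsLe (M : Matrix (Fin n → Bool) (Fin n → Bool) ℂ) (a : ℕ) : Prop :=
  ∀ φ, calls n (ketOf n M) φ ≤ a * (n + 1) * compRank φ

theorem callsLe_zero : CallsLe (0 : Matrix (Fin n → Bool) (Fin n → Bool) ℂ) 0 := by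
  intro φ
  rw [ketOf_zero]
  cases n <;> simp [calls]

theorem callsLe_dim_zero (M : Matrix (Fin 0 → Bool) (Fin 0 → Bool) ℂ) {a : ℕ} (ha : 1 ≤ a) :
    CallsLe M a := by
  intro φ
  unfold calls
  split_ifs with h
  · exact Nat.zero_le _
  · have := one_le_compRank (not_or.mp h).2
    nlinarith

/-- Bounds `b r c` for the quadrants give a bound for the matrix, the larger of the two column sums:
both quadrants of a column meet the same half of the vector. -/
theorem callsLe_succ {M : Matrix (Fin (n + 1) → Bool) (Fin (n + 1) → Bool) ℂ} {a : ℕ} (ha : 1 ≤ a)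
    (b : Bool → Bool → ℕ) (h : ∀ r c, CallsLe (quadrant r c M) (b r c))
    (hb : ∀ c, b false c + b true c ≤ a) : CallsLe M a := by
  intro φ
  unfold calls
  split_ifs with h0
  · exact Nat.zero_le _
  · simp only [quad_ketOf]
    have hφ := one_le_compRank (not_or.mp h0).2
    have h1 := h false false (sub false φ)
    have h2 := h false true (sub true φ)
    have h3 := h true false (sub false φ)
    have h4 := h true true (sub true φ)
    have h5 := compRank_sub φ
    have h6 := Nat.mul_le_mul_right ((n + 1) * compRank (sub false φ)) (hb false)
    have h7 := Nat.mul_le_mul_right ((n + 1) * compRank (sub true φ)) (hb true)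
    have h8 : 1 ≤ a * compRank φ := Nat.one_le_iff_ne_zero.mpr (by positivity)
    rw [h5] at h8 ⊢
    nlinarith

theorem quadrant_smul_one (a : ℂ) (r c : Bool) :
    quadrant r c (a • (1 : Matrix (Fin (n + 1) → Bool) (Fin (n + 1) → Bool) ℂ)) =
      if r = c then a • 1 else 0 := by
  ext x y
  by_cases h : r = c
  · subst h
    simp [quadrant, Matrix.one_apply, Fin.cons_inj]
  · simp [quadrant, Fin.cons_inj, h]

theorem quadrant_one (r c : Bool) :
    quadrant r c (1 : Matrix (Fin (n + 1) → Bool) (Fin (n + 1) → Bool) ℂ) =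
      if r = c then 1 else 0 := by
  simpa using quadrant_smul_one (n := n) 1 r c

theorem callsLe_smul_one (a : ℂ) :
    CallsLe (a • (1 : Matrix (Fin n → Bool) (Fin n → Bool) ℂ)) 1 := by
  induction n with
  | zero => exact callsLe_dim_zero _ le_rfl
  | succ n ih =>
    refine callsLe_succ le_rfl (fun r c => if r = c then 1 else 0) (fun r c => ?_) ?_
    · rw [quadrant_smul_one]
      split_ifs
      · exact ih
      · exact callsLe_zero
    · decide

theorem callsLe_one : CallsLe (1 : Matrix (Fin n → Bool) (Fin n → Bool) ℂ) 1 := by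
  simpa using callsLe_smul_one (n := n) 1

theorem quadrant_hadamard_zero (r c : Bool) :
    quadrant r c (Gate.hadamard (0 : Fin (n + 1))).mat =
      (((1 / Real.sqrt 2 : ℝ) : ℂ) * (if r && c then -1 else 1)) • 1 := by
  ext x y
  have h : (∀ i : Fin (n + 1), i ≠ 0 → (Fin.cons r x : Fin (n + 1) → Bool) i =
      (Fin.cons c y : Fin (n + 1) → Bool) i) ↔ x = y := by
    constructor
    · intro h
      funext i
      simpa using h i.succ (Fin.succ_ne_zero i)
    · rintro rfl i hi
      obtain ⟨j, rfl⟩ := Fin.exists_succ_eq.mpr hi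
      simp
  simp only [quadrant, Gate.mat, h, Fin.cons_zero, Matrix.smul_apply, Matrix.one_apply, smul_eq_mul]
  split_ifs <;> simp

theorem quadrant_hadamard_succ (j : Fin n) (r c : Bool) :
    quadrant r c (Gate.hadamard j.succ).mat = if r = c then (Gate.hadamard j).mat else 0 := by
  ext x y
  have h : (∀ i : Fin (n + 1), i ≠ j.succ → (Fin.cons r x : Fin (n + 1) → Bool) i =
      (Fin.cons c y : Fin (n + 1) → Bool) i) ↔ r = c ∧ ∀ i, i ≠ j → x i = y i := by
    constructor
    · intro h
      refine ⟨by simpa using h 0 (Fin.succ_ne_zero j).symm, fun i hi => ?_⟩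
      simpa using h i.succ (fun h' => hi (Fin.succ_injective _ h'))
    · rintro ⟨rfl, h⟩ i hi
      refine Fin.cases (fun _ => by simp) (fun i hi => ?_) i hi
      simpa using h i (fun h' => hi (h' ▸ rfl))
  simp only [quadrant, Gate.mat, h, Fin.cons_succ]
  by_cases hrc : r = c
  · simp [hrc]
  · simp [hrc]

theorem callsLe_hadamard (j : Fin n) : CallsLe (Gate.hadamard j).mat 2 := by
  induction n with
  | zero => exact j.elim0
  | succ n ih =>
    refine Fin.cases ?_ (fun j => ?_) j
    · refine callsLe_succ (by norm_num) (fun r c => 1) (fun r c => ?_) (by decide)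
      rw [quadrant_hadamard_zero]
      exact callsLe_smul_one _
    · refine callsLe_succ (by norm_num) (fun r c => if r = c then 2 else 0) (fun r c => ?_)
        (by decide)
      rw [quadrant_hadamard_succ]
      split_ifs
      · exact ih j
      · exact callsLe_zero

/-- All controls of a controlled-X gate are satisfied. -/
def Fires (role : Fin n → Role) (c : Fin n → Bool) : Prop :=
  ∀ j b, role j = Role.control b → c j = b

/-- The basis state in which all targets are flipped. -/
def flipAll (role : Fin n → Role) (c : Fin n → Bool) : Fin n → Bool :=
  fun i => if role i = Role.target then !(c i) else c i

open scoped Classical in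
/-- The part of a controlled-X gate that acts if all controls are satisfied. -/
noncomputable def fireMat (role : Fin n → Role) : Matrix (Fin n → Bool) (Fin n → Bool) ℂ :=
  fun r c => if Fires role c ∧ r = flipAll role c then 1 else 0

open scoped Classical in
/-- The part of a controlled-X gate that acts if some control is not satisfied. -/
noncomputable def restMat (role : Fin n → Role) : Matrix (Fin n → Bool) (Fin n → Bool) ℂ :=
  fun r c => if ¬ Fires role c ∧ r = c then 1 else 0

theorem flipTargets_of_fires {role : Fin n → Role} {c : Fin n → Bool} (h : Fires role c) :
    flipTargets role c = flipAll role c := by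
  funext i
  have h' : ∀ j b, role j = Role.control b → c j = b := h
  simp only [flipTargets, flipAll]
  by_cases hi : role i = Role.target
  · rw [if_pos ⟨h', hi⟩, if_pos hi]
  · rw [if_neg fun h => hi h.2, if_neg hi]

theorem flipTargets_of_not_fires {role : Fin n → Role} {c : Fin n → Bool} (h : ¬ Fires role c) :
    flipTargets role c = c := by
  funext i
  simp only [flipTargets]
  rw [if_neg fun h' => h h'.1]

theorem controlledX_mat (role : Fin n → Role) :
    (Gate.controlledX role).mat = fireMat role + restMat role := by
  ext r c
  simp only [Gate.mat, fireMat, restMat, Matrix.add_apply]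
  by_cases h : Fires role c
  · simp [h, flipTargets_of_fires h]
  · simp [h, flipTargets_of_not_fires h]

theorem fires_cons {role : Fin (n + 1) → Role} {c : Bool} {y : Fin n → Bool} :
    Fires role (Fin.cons c y) ↔
      (∀ b, role 0 = Role.control b → c = b) ∧ Fires (Fin.tail role) y := by
  constructor
  · intro h
    exact ⟨fun b hb => by simpa using h 0 b hb, fun j b hb => by simpa using h j.succ b hb⟩
  · rintro ⟨h0, h⟩ j
    refine Fin.cases (fun b hb => by simpa using h0 b hb) (fun j b hb => ?_) j
    simpa using h j b hb

theorem cons_eq_flipAll_cons {role : Fin (n + 1) → Role} {r c : Bool} {x y : Fin n → Bool} :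
    Fin.cons r x = flipAll role (Fin.cons c y) ↔
      r = (if role 0 = Role.target then !c else c) ∧ x = flipAll (Fin.tail role) y := by
  have h : flipAll role (Fin.cons c y) =
      Fin.cons (if role 0 = Role.target then !c else c) (flipAll (Fin.tail role) y) := by
    funext i
    refine Fin.cases ?_ (fun i => ?_) i
    · simp [flipAll]
    · simp only [flipAll, Fin.cons_succ]
      rfl
  rw [h, Fin.cons_inj]

theorem quadrant_fireMat_idle {role : Fin (n + 1) → Role} (h0 : role 0 = Role.idle) (r c : Bool) :
    quadrant r c (fireMat role) = if r = c then fireMat (Fin.tail role) else 0 := by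
  classical
  ext x y
  simp only [quadrant, fireMat]
  rw [if_congr (and_congr fires_cons cons_eq_flipAll_cons) rfl rfl]
  by_cases h : r = c <;> simp [h, h0, fireMat]

theorem quadrant_restMat_idle {role : Fin (n + 1) → Role} (h0 : role 0 = Role.idle) (r c : Bool) :
    quadrant r c (restMat role) = if r = c then restMat (Fin.tail role) else 0 := by
  classical
  ext x y
  simp only [quadrant, restMat]
  rw [if_congr (and_congr (not_congr fires_cons) (Fin.cons_inj (α := fun _ => Bool))) rfl rfl]
  by_cases h : r = c <;> simp [h, h0, restMat]

theorem quadrant_fireMat_target {role : Fin (n + 1) → Role} (h0 : role 0 = Role.target)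
    (r c : Bool) : quadrant r c (fireMat role) = if r = c then 0 else fireMat (Fin.tail role) := by
  classical
  ext x y
  simp only [quadrant, fireMat]
  rw [if_congr (and_congr fires_cons cons_eq_flipAll_cons) rfl rfl]
  cases r <;> cases c <;> simp [h0, fireMat]

theorem quadrant_restMat_target {role : Fin (n + 1) → Role} (h0 : role 0 = Role.target)
    (r c : Bool) : quadrant r c (restMat role) = if r = c then restMat (Fin.tail role) else 0 := by
  classical
  ext x y
  simp only [quadrant, restMat]
  rw [if_congr (and_congr (not_congr fires_cons) (Fin.cons_inj (α := fun _ => Bool))) rfl rfl]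
  by_cases h : r = c <;> simp [h, h0, restMat]

theorem quadrant_fireMat_control {role : Fin (n + 1) → Role} {b : Bool}
    (h0 : role 0 = Role.control b) (r c : Bool) :
    quadrant r c (fireMat role) = if r = c ∧ c = b then fireMat (Fin.tail role) else 0 := by
  classical
  ext x y
  simp only [quadrant, fireMat]
  rw [if_congr (and_congr fires_cons cons_eq_flipAll_cons) rfl rfl]
  cases r <;> cases c <;> cases b <;> simp [h0, fireMat]

theorem quadrant_restMat_control {role : Fin (n + 1) → Role} {b : Bool}
    (h0 : role 0 = Role.control b) (r c : Bool) :
    quadrant r c (restMat role) =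
      if r = c then (if c = b then restMat (Fin.tail role) else 1) else 0 := by
  classical
  ext x y
  simp only [quadrant, restMat]
  rw [if_congr (and_congr (not_congr fires_cons) (Fin.cons_inj (α := fun _ => Bool))) rfl rfl]
  cases r <;> cases c <;> cases b <;> simp [h0, restMat, Matrix.one_apply]

theorem quadrant_add (r c : Bool) (M N : Matrix (Fin (n + 1) → Bool) (Fin (n + 1) → Bool) ℂ) :
    quadrant r c (M + N) = quadrant r c M + quadrant r c N := rfl

theorem callsLe_fireMat (role : Fin n → Role) : CallsLe (fireMat role) 1 := by
  induction n with
  | zero => exact callsLe_dim_zero _ le_rfl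
  | succ n ih =>
    rcases h0 : role 0 with _ | b | _
    · refine callsLe_succ le_rfl (fun r c => if r = c then 1 else 0) (fun r c => ?_) (by decide)
      rw [quadrant_fireMat_idle h0]
      split_ifs
      exacts [ih _, callsLe_zero]
    · refine callsLe_succ le_rfl (fun r c => if r = c ∧ c = b then 1 else 0) (fun r c => ?_)
        (by cases b <;> decide)
      rw [quadrant_fireMat_control h0]
      split_ifs
      exacts [ih _, callsLe_zero]
    · refine callsLe_succ le_rfl (fun r c => if r = c then 0 else 1) (fun r c => ?_) (by decide)
      rw [quadrant_fireMat_target h0]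
      split_ifs
      exacts [callsLe_zero, ih _]

theorem callsLe_restMat (role : Fin n → Role) : CallsLe (restMat role) 1 := by
  induction n with
  | zero => exact callsLe_dim_zero _ le_rfl
  | succ n ih =>
    refine callsLe_succ le_rfl (fun r c => if r = c then 1 else 0) (fun r c => ?_) (by decide)
    rcases h0 : role 0 with _ | b | _
    · rw [quadrant_restMat_idle h0]
      split_ifs
      exacts [ih _, callsLe_zero]
    · rw [quadrant_restMat_control h0]
      split_ifs
      exacts [ih _, callsLe_one, callsLe_zero]
    · rw [quadrant_restMat_target h0]
      split_ifs
      exacts [ih _, callsLe_zero]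

theorem CallsLe.mono {M : Matrix (Fin n → Bool) (Fin n → Bool) ℂ} {a b : ℕ} (h : CallsLe M a)
    (hab : a ≤ b) : CallsLe M b := fun φ => (h φ).trans (by gcongr)

/-- The bound `2` is needed where the gate is split into the two parts, at a target; below it, each
part has the bound `1`. -/
theorem callsLe_controlledX (role : Fin n → Role) : CallsLe (Gate.controlledX role).mat 2 := by
  rw [controlledX_mat]
  induction n with
  | zero => exact callsLe_dim_zero _ (by norm_num)
  | succ n ih =>
    rcases h0 : role 0 with _ | b | _
    · refine callsLe_succ (by norm_num) (fun r c => if r = c then 2 else 0) (fun r c => ?_)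
        (by decide)
      rw [quadrant_add, quadrant_fireMat_idle h0, quadrant_restMat_idle h0]
      split_ifs
      · exact ih _
      · rw [add_zero]; exact callsLe_zero
    · refine callsLe_succ (by norm_num) (fun r c => if r = c then 2 else 0) (fun r c => ?_)
        (by decide)
      rw [quadrant_add, quadrant_fireMat_control h0, quadrant_restMat_control h0]
      by_cases hrc : r = c
      · by_cases hcb : c = b
        · simpa [hrc, hcb] using ih (Fin.tail role)
        · simpa [hrc, hcb] using callsLe_one.mono (by norm_num)
      · simpa [hrc] using callsLe_zero
    · refine callsLe_succ (by norm_num) (fun r c => 1) (fun r c => ?_) (by decide)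
      rw [quadrant_add, quadrant_fireMat_target h0, quadrant_restMat_target h0]
      split_ifs
      · rw [zero_add]; exact callsLe_restMat _
      · rw [add_zero]; exact callsLe_fireMat _

theorem callsLe_gate (U : Gate n) : CallsLe U.mat 2 := by
  cases U
  exacts [callsLe_hadamard _, callsLe_controlledX _]

end Matrices

section Diagrams

variable {D n : ℕ} {s : Store}

theorem one_le_tick : 1 ≤ 300 * (D + 2) ^ 3 := Nat.one_le_iff_ne_zero.mpr (by positivity)

theorem spec_block {M : Matrix (Fin (n + 1) → Bool) (Fin (n + 1) → Bool) ℂ}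
    {e₀₀ e₀₁ e₁₀ e₁₁ : Edge (2 * n)}
    (h₀₀ : s.nodes.Den e₀₀ (ketOf n (quadrant false false M)))
    (h₀₁ : s.nodes.Den e₀₁ (ketOf n (quadrant false true M)))
    (h₁₀ : s.nodes.Den e₁₀ (ketOf n (quadrant true false M)))
    (h₁₁ : s.nodes.Den e₁₁ (ketOf n (quadrant true true M))) (hn : 2 * (n + 1) ≤ D) :
    Spec D 21 s (block e₀₀ e₀₁ e₁₀ e₁₁) fun e s' =>
      s'.nodes.Den (n := 2 * (n + 1)) e (ketOf (n + 1) M) := by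
  refine Spec.intro fun hs => ?_
  unfold block
  refine Spec.bind (spec_makeEdge h₀₀ h₀₁ (by omega)) (by norm_num) ?_
  rintro e₀ s₁ hs₁ hx₁ he₀
  refine Spec.bind (spec_makeEdge (h₁₀.ext hx₁ hs.good.wf) (h₁₁.ext hx₁ hs.good.wf) (by omega))
    (by norm_num) ?_
  rintro e₁ s₂ hs₂ hx₂ he₁
  exact spec_makeEdge (he₀.ext hx₂ hs₁.good.wf) he₁ (by omega)

theorem spec_identityEdge (n : ℕ) (hn : 2 * n ≤ D) :
    Spec D (1 + 21 * n) s (identityEdge n) fun e s' => s'.nodes.Den e (ketOf n 1) := by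
  induction n generalizing s with
  | zero =>
    unfold identityEdge
    refine Spec.bind (Spec.tick (k := 1) one_le_tick) (by omega) ?_
    rintro _ _ - - ⟨k, rfl⟩
    refine Spec.pure fun _ => ?_
    have h := Table.den_some (T := s.nodes) (A := (1 : LIM 0)) LIM.coeff_one_ne_zero (i := 0) rfl
    rw [LIM.act_one] at h
    have h1 : ketOf 0 1 = s.nodes.nodeKet 0 0 := by
      funext x; simp [ketOf, Table.nodeKet]
    rw [h1]
    exact h
  | succ n ih =>
    unfold identityEdge
    refine Spec.bind (ih (by omega)) (by omega) ?_
    rintro e s' - - he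
    refine (spec_block (M := 1) ?_ ?_ ?_ ?_ hn).mono (by omega) fun _ _ _ _ h => h
    · rw [quadrant_one]; exact he
    · rw [quadrant_one, if_neg (by decide), ketOf_zero]; exact Table.den_none
    · rw [quadrant_one, if_neg (by decide), ketOf_zero]; exact Table.den_none
    · rw [quadrant_one]; exact he

theorem spec_hadamardEdge (n : ℕ) (j : Fin n) (hn : 2 * n ≤ D) :
    Spec D (1 + 22 * n) s (hadamardEdge n j) fun e s' =>
      s'.nodes.Den e (ketOf n (Gate.hadamard j).mat) := by
  induction n generalizing s with
  | zero => exact j.elim0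
  | succ n ih =>
    unfold hadamardEdge
    refine Spec.bind (Spec.charge (by norm_num) (by omega)) (by omega) ?_
    rintro _ _ - - ⟨k, rfl⟩
    split_ifs with h
    · subst h
      refine Spec.bind (spec_identityEdge n (by omega)) (by omega) ?_
      rintro e s' - - he
      have hc : ((1 / Real.sqrt 2 : ℝ) : ℂ) ≠ 0 := by
        rw [Complex.ofReal_ne_zero]; positivity
      have hf := he.scale hc
      have hf' := hf.scale (c := -1) (by norm_num)
      rw [← ketOf_smul] at hf hf'
      rw [← ketOf_smul, smul_smul, mul_comm (-1 : ℂ)] at hf'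
      refine (spec_block (M := (Gate.hadamard 0).mat) ?_ ?_ ?_ ?_ hn).mono (by omega)
        fun _ _ _ _ h => h
      · rw [quadrant_hadamard_zero]; simpa using hf
      · rw [quadrant_hadamard_zero]; simpa using hf
      · rw [quadrant_hadamard_zero]; simpa using hf
      · rw [quadrant_hadamard_zero]; simpa using hf'
    · obtain ⟨j, rfl⟩ := Fin.exists_succ_eq.mpr h
      rw [Fin.pred_succ]
      refine Spec.bind (ih j (by omega)) (by omega) ?_
      rintro e s' - - he
      refine (spec_block (M := (Gate.hadamard j.succ).mat) ?_ ?_ ?_ ?_ hn).mono (by omega)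
        fun _ _ _ _ h => h
      · rw [quadrant_hadamard_succ]; exact he
      · rw [quadrant_hadamard_succ, if_neg (by decide), ketOf_zero]; exact Table.den_none
      · rw [quadrant_hadamard_succ, if_neg (by decide), ketOf_zero]; exact Table.den_none
      · rw [quadrant_hadamard_succ]; exact he

/-- The four edges denote the matrices that they stand for. -/
structure XEdges.Den (T : Table) (d : XEdges n) (role : Fin n → Role) : Prop where
  ident : T.Den d.ident (ketOf n 1)
  fire : T.Den d.fire (ketOf n (fireMat role))
  rest : T.Den d.rest (ketOf n (restMat role))
  full : T.Den d.full (ketOf n (fireMat role + restMat role))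

theorem XEdges.Den.ext {T T' : Table} {d : XEdges n} {role : Fin n → Role} (h : d.Den T role)
    (hx : T.Ext T') (hwf : T.WellFormed) : d.Den T' role :=
  ⟨h.ident.ext hx hwf, h.fire.ext hx hwf, h.rest.ext hx hwf, h.full.ext hx hwf⟩

/-- Four blocks, one for each of the matrices. -/
theorem spec_blocks {role : Fin (n + 1) → Role} {i : Edge (2 * (n + 1))}
    {f₀₀ f₀₁ f₁₀ f₁₁ r₀₀ r₀₁ r₁₀ r₁₁ u₀₀ u₀₁ u₁₀ u₁₁ : Edge (2 * n)}
    (hi : s.nodes.Den i (ketOf (n + 1) 1))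
    (h : ∀ T : Table, s.nodes.Ext T →
      (T.Den f₀₀ (ketOf n (quadrant false false (fireMat role))) ∧
      T.Den f₀₁ (ketOf n (quadrant false true (fireMat role))) ∧
      T.Den f₁₀ (ketOf n (quadrant true false (fireMat role))) ∧
      T.Den f₁₁ (ketOf n (quadrant true true (fireMat role)))) ∧
      (T.Den r₀₀ (ketOf n (quadrant false false (restMat role))) ∧
      T.Den r₀₁ (ketOf n (quadrant false true (restMat role))) ∧
      T.Den r₁₀ (ketOf n (quadrant true false (restMat role))) ∧
      T.Den r₁₁ (ketOf n (quadrant true true (restMat role)))) ∧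
      (T.Den u₀₀ (ketOf n (quadrant false false (fireMat role + restMat role))) ∧
      T.Den u₀₁ (ketOf n (quadrant false true (fireMat role + restMat role))) ∧
      T.Den u₁₀ (ketOf n (quadrant true false (fireMat role + restMat role))) ∧
      T.Den u₁₁ (ketOf n (quadrant true true (fireMat role + restMat role)))))
    (hn : 2 * (n + 1) ≤ D) :
    Spec D 63 s (do
      let fire ← block f₀₀ f₀₁ f₁₀ f₁₁
      let rest ← block r₀₀ r₀₁ r₁₀ r₁₁
      let full ← block u₀₀ u₀₁ u₁₀ u₁₁
      pure (⟨i, fire, rest, full⟩ : XEdges (n + 1))) fun d s' => d.Den s'.nodes role := by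
  refine Spec.intro fun hs => ?_
  obtain ⟨h1, h2, h3, h4⟩ := (h _ (Table.Ext.refl _)).1
  refine Spec.bind (spec_block h1 h2 h3 h4 hn) (by norm_num) ?_
  rintro fire s₁ hs₁ hx₁ hfire
  obtain ⟨h1, h2, h3, h4⟩ := (h _ hx₁).2.1
  refine Spec.bind (spec_block h1 h2 h3 h4 hn) (by norm_num) ?_
  rintro rest s₂ hs₂ hx₂ hrest
  obtain ⟨h1, h2, h3, h4⟩ := (h _ (hx₁.trans hx₂)).2.2
  refine Spec.bind (spec_block h1 h2 h3 h4 hn) (by norm_num) ?_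
  rintro full s₃ hs₃ hx₃ hfull
  exact Spec.pure fun _ => ⟨hi.ext ((hx₁.trans hx₂).trans hx₃) hs.good.wf,
    hfire.ext (hx₂.trans hx₃) hs₁.good.wf, hrest.ext hx₃ hs₂.good.wf, hfull⟩

theorem spec_controlledXEdges (n : ℕ) (role : Fin n → Role) (hn : 2 * n ≤ D) :
    Spec D (1 + 85 * n) s (controlledXEdges n role) fun d s' => d.Den s'.nodes role := by
  induction n generalizing s with
  | zero =>
    unfold controlledXEdges
    refine Spec.bind (Spec.tick (k := 4) (by
      have : 1 ≤ (D + 2) ^ 3 := Nat.one_le_pow _ _ (by omega)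
      omega)) (by omega) ?_
    rintro _ _ - - ⟨k, rfl⟩
    refine Spec.pure fun _ => ?_
    have h := Table.den_some (T := s.nodes) (A := (1 : LIM 0)) LIM.coeff_one_ne_zero (i := 0) rfl
    rw [LIM.act_one] at h
    have hket : ∀ M : Matrix (Fin 0 → Bool) (Fin 0 → Bool) ℂ,
        M (fun i => Fin.elim0 i) (fun i => Fin.elim0 i) = 1 → ketOf 0 M = s.nodes.nodeKet 0 0 := by
      intro M hM
      funext x; exact hM
    have hfires : ∀ c, Fires role c := fun c j => j.elim0
    have hfire : fireMat role (fun i => Fin.elim0 i) (fun i => Fin.elim0 i) = 1 := by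
      rw [fireMat, if_pos ⟨hfires _, Subsingleton.elim _ _⟩]
    have hrest : restMat role = 0 := by
      ext x y
      rw [restMat, if_neg fun h => h.1 (hfires _)]; rfl
    refine ⟨?_, ?_, ?_, ?_⟩
    · rw [hket 1 (Matrix.one_apply_eq _)]; exact h
    · rw [hket _ hfire]; exact h
    · rw [hrest, ketOf_zero]; exact Table.den_none
    · rw [hrest, add_zero, hket _ hfire]; exact h
  | succ n ih =>
    unfold controlledXEdges
    refine Spec.bind (Spec.tick (k := 4) (by
      have : 1 ≤ (D + 2) ^ 3 := Nat.one_le_pow _ _ (by omega)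
      omega)) (by omega) ?_
    rintro _ _ - - ⟨k, rfl⟩
    refine Spec.bind (ih (Fin.tail role) (by omega)) (by omega) ?_
    rintro d s₁ hs₁ - hd
    have hnone : ∀ T : Table, T.Den (none : Edge (2 * n)) (ketOf n 0) := by
      intro T; rw [ketOf_zero]; exact Table.den_none
    refine Spec.bind (spec_block (M := 1) (e₀₀ := d.ident) (e₀₁ := none) (e₁₀ := none)
      (e₁₁ := d.ident) ?_ ?_ ?_ ?_ hn) (by omega) ?_
    · rw [quadrant_one]; exact hd.ident
    · rw [quadrant_one]; exact hnone _
    · rw [quadrant_one]; exact hnone _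
    · rw [quadrant_one]; exact hd.ident
    rintro i s₂ hs₂ hx₂ hi
    have hd' : ∀ T : Table, s₂.nodes.Ext T → d.Den T (Fin.tail role) :=
      fun T hT => hd.ext (hx₂.trans hT) hs₁.good.wf
    rcases h0 : role 0 with _ | b | _
    · refine (spec_blocks hi (fun T hT => ?_) hn).mono (by omega) fun _ _ _ _ h => h
      simp only [quadrant_add, quadrant_fireMat_idle h0, quadrant_restMat_idle h0]
      simp [hnone, (hd' T hT).fire, (hd' T hT).rest, (hd' T hT).full]
    · cases b
      · refine (spec_blocks hi (fun T hT => ?_) hn).mono (by omega) fun _ _ _ _ h => h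
        simp only [quadrant_add, quadrant_fireMat_control h0, quadrant_restMat_control h0]
        simp [hnone, (hd' T hT).fire, (hd' T hT).rest, (hd' T hT).full, (hd' T hT).ident]
      · refine (spec_blocks hi (fun T hT => ?_) hn).mono (by omega) fun _ _ _ _ h => h
        simp only [quadrant_add, quadrant_fireMat_control h0, quadrant_restMat_control h0]
        simp [hnone, (hd' T hT).fire, (hd' T hT).rest, (hd' T hT).full, (hd' T hT).ident]
    · refine (spec_blocks hi (fun T hT => ?_) hn).mono (by omega) fun _ _ _ _ h => h
      simp only [quadrant_add, quadrant_fireMat_target h0, quadrant_restMat_target h0]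
      simp [hnone, (hd' T hT).fire, (hd' T hT).rest]

theorem spec_gateEdge (U : Gate n) (hn : 2 * n ≤ D) :
    Spec D (1 + 85 * n) s (gateEdge U) fun e s' => s'.nodes.Den e (ketOf n U.mat) := by
  cases U with
  | hadamard j => exact (spec_hadamardEdge n j hn).mono (by omega) fun _ _ _ _ h => h
  | controlledX role =>
    refine Spec.bind (spec_controlledXEdges n role hn) le_rfl ?_
    rintro d s' - - hd
    exact Spec.pure fun _ => by rw [controlledX_mat]; exact hd.full

end Diagrams

/-! ### Simulation of circuits -/

section Simulation

variable {D n : ℕ} {s : Store}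

theorem zeroKet_succ : zeroKet (n + 1) = join (zeroKet n) 0 := by
  refine ket_ext_sub fun b => ?_
  funext x
  have h : (Fin.cons b x : Fin (n + 1) → Bool) = (fun _ => false) ↔
      b = false ∧ x = fun _ => false := by
    rw [← Fin.cons_inj (α := fun _ => Bool)]
    have : (Fin.cons false fun _ => false : Fin (n + 1) → Bool) = fun _ => false := by
      funext i; refine Fin.cases rfl (fun i => rfl) i
    rw [this]
  simp only [zeroKet, sub, h]
  cases b <;> simp [join, zeroKet]

theorem spec_zeroEdge (n : ℕ) (hn : n ≤ D) :
    Spec D (1 + 7 * n) s (zeroEdge n) fun e s' => s'.nodes.Den e (zeroKet n) := by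
  induction n generalizing s with
  | zero =>
    unfold zeroEdge
    refine Spec.bind (Spec.tick (k := 1) one_le_tick) (by omega) ?_
    rintro _ _ - - ⟨k, rfl⟩
    refine Spec.pure fun _ => ?_
    have h := Table.den_some (T := s.nodes) (A := (1 : LIM 0)) LIM.coeff_one_ne_zero (i := 0) rfl
    rw [LIM.act_one] at h
    have h1 : zeroKet 0 = s.nodes.nodeKet 0 0 := by
      funext x; simp [zeroKet, Table.nodeKet, Subsingleton.elim x fun _ => false]
    rw [h1]
    exact h
  | succ n ih =>
    unfold zeroEdge
    refine Spec.bind (ih (by omega)) (by omega) ?_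
    rintro e s' - - he
    rw [zeroKet_succ]
    exact (spec_makeEdge he Table.den_none hn).mono (by omega) fun _ _ _ _ h => h

end Simulation

section Simulation

variable {D n : ℕ} {s : Store}

/-- The state to which a circuit takes `φ`. -/
noncomputable def evolve (φ : Ket n) (C : List (Gate n)) : Ket n :=
  C.foldl (fun φ U => U.mat.mulVec φ) φ

/-- Every gate costs a polynomial number of operations as long as all states have few nonzero
amplitudes. -/
theorem spec_simulateFrom (C : List (Gate n)) {N : ℕ} (hn : 2 * n ≤ D) {e : Edge n} {φ : Ket n}
    (he : s.nodes.Den e φ) (hN : ∀ t, compRank (evolve φ (C.take t)) ≤ N) :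
    Spec D (1 + C.length * (3 + 85 * n + (30 + 8 * n ^ 2) * (2 * (n + 1) * N))) s
      (simulateFrom C e) fun l s' => l.length = C.length + 1 ∧
        ∀ t f, l[t]? = some f → s'.nodes.Den f (evolve φ (C.take t)) := by
  induction C generalizing s e φ with
  | nil =>
    unfold simulateFrom
    refine Spec.bind (Spec.tick one_le_tick) (by omega) ?_
    rintro _ _ - - ⟨k, rfl⟩
    refine Spec.pure fun _ => ⟨rfl, fun t f hf => ?_⟩
    obtain ⟨rfl, rfl⟩ : t = 0 ∧ e = f := by
      cases t <;> simp_all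
    exact he
  | cons U C ih =>
    refine Spec.intro fun hs => ?_
    unfold simulateFrom
    have hcalls : 1 + (30 + 8 * n ^ 2) * calls n (ketOf n U.mat) φ ≤
        1 + (30 + 8 * n ^ 2) * (2 * (n + 1) * N) := by
      have := (callsLe_gate U φ).trans (Nat.mul_le_mul_left (2 * (n + 1)) (hN 0))
      gcongr
    rw [List.length_cons, Nat.add_mul, Nat.one_mul]
    refine Spec.bind (Spec.tick one_le_tick) (by omega) ?_
    rintro _ _ - - ⟨k, rfl⟩
    refine Spec.bind (spec_gateEdge U hn) (by omega) ?_
    rintro u s₁ hs₁ hx₁ hu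
    have hx₁' : s.nodes.Ext s₁.nodes := hx₁
    have he₁ := he.ext hx₁' hs.good.wf
    refine Spec.bind (spec_applyGate n hn hu he₁) (by omega) ?_
    rintro f s₂ hs₂ hx₂ hf
    rw [applyKet_ketOf] at hf
    refine Spec.bind (ih hf fun t => hN (t + 1)) (by omega) ?_
    rintro l s₃ hs₃ hx₃ ⟨hl, hden⟩
    refine Spec.pure fun _ => ⟨by simp [hl], fun t g hg => ?_⟩
    cases t with
    | zero =>
      obtain rfl : e = g := by simpa using hg
      exact he₁.ext (hx₂.trans hx₃) hs₁.good.wf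
    | succ t => exact hden t g (by simpa using hg)

theorem spec_simulate (C : List (Gate n)) {N : ℕ} (hn : 2 * n ≤ D)
    (hN : ∀ t, compRank (runCircuit (C.take t)) ≤ N) :
    Spec D (2 + 7 * n + C.length * (3 + 85 * n + (30 + 8 * n ^ 2) * (2 * (n + 1) * N))) s
      (simulate C) fun l s' => l.length = C.length + 1 ∧
        ∀ t f, l[t]? = some f → s'.nodes.Den f (runCircuit (C.take t)) := by
  unfold simulate
  refine Spec.bind (spec_zeroEdge n (by omega)) (by omega) ?_
  rintro e s₁ - - he
  exact (spec_simulateFrom C hn he hN).mono (by omega) fun _ _ _ _ h => h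

end Simulation

/-! ### Reading amplitudes and measuring -/

section Readout

variable {D n : ℕ}

theorem act_ket_zero (A : LIM 0) (φ : Ket 0) : A.act φ = A.coeff • φ := by
  funext x
  simp only [LIM.act, LIM.entry, Finset.univ_eq_empty, Finset.prod_empty, mul_one, Pi.smul_apply,
    smul_eq_mul]
  congr 2
  exact Subsingleton.elim _ _

theorem spec_amplitude (n : ℕ) (hn : n ≤ D) {s : Store} {e : Edge n} {φ : Ket n}
    (he : s.nodes.Den e φ) (x : Fin n → Bool) :
    Spec D (1 + 2 * n) s (amplitude n e x) fun a _ => a = φ x := by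
  induction n generalizing s with
  | zero =>
    unfold amplitude
    refine Spec.bind (Spec.tick one_le_tick) (by omega) ?_
    rintro _ _ - - ⟨k, rfl⟩
    match e with
    | none =>
      obtain rfl := he.none_elim
      exact Spec.pure fun _ => rfl
    | some (A, i) =>
      obtain ⟨hA, hi, rfl⟩ := he.some_elim
      refine Spec.pure fun _ => ?_
      rw [act_ket_zero]
      simp [Table.nodeKet]
  | succ n ih =>
    unfold amplitude
    refine Spec.bind (Spec.tick one_le_tick) (by omega) ?_
    rintro _ _ - - ⟨k, rfl⟩
    refine Spec.bind (spec_follow (s := s.addSteps k) he (x 0) hn) (by omega) ?_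
    rintro f _ - - ⟨hf, k, rfl⟩
    refine (ih (s := (s.addSteps _).addSteps k) (by omega) hf (Fin.tail x)).mono (by omega)
      fun a _ _ _ h => ?_
    rw [h, sub, Fin.cons_self_tail]

theorem sqNorm_act (A : LIM n) (φ : Ket n) : sqNorm (A.act φ) = ‖A.coeff‖ ^ 2 * sqNorm φ := by
  simp only [sqNorm, LIM.act, norm_mul, LIM.norm_entry, mul_pow]
  rw [← Finset.mul_sum]
  congr 1
  exact Function.Bijective.sum_comp A.flip_bijective fun x => ‖φ x‖ ^ 2

theorem sqNorm_sub (φ : Ket (n + 1)) : sqNorm φ = sqNorm (sub false φ) + sqNorm (sub true φ) :=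
  sum_split_first _

theorem sqNorm_zero : sqNorm (0 : Ket n) = 0 := by simp [sqNorm]

theorem projectKet_act (A : LIM n) (q : Fin n) (y : Bool) (φ : Ket n) :
    projectKet q y (A.act φ) = A.act (projectKet q (xor y (A.ops q).xbit) φ) := by
  funext x
  have h : A.flip x q = xor y (A.ops q).xbit ↔ x q = y := by
    simp [LIM.flip]
  simp only [projectKet, LIM.act, h]
  split_ifs <;> simp

theorem projectKet_zero (q : Fin n) (y : Bool) : projectKet q y (0 : Ket n) = 0 := by
  funext x; simp [projectKet]

theorem sub_projectKet_zero (b y : Bool) (φ : Ket (n + 1)) :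
    sub b (projectKet 0 y φ) = if b = y then sub b φ else 0 := by
  funext x
  by_cases h : b = y <;> simp [sub, projectKet, h]

theorem sub_projectKet_succ (b y : Bool) (q : Fin n) (φ : Ket (n + 1)) :
    sub b (projectKet q.succ y φ) = projectKet q y (sub b φ) := rfl

theorem Table.den_one {T : Table} {i : ℕ} (hi : T.HasNode n i) :
    T.Den (some (1, i)) (T.nodeKet n i) := by
  have := Table.den_some LIM.coeff_one_ne_zero hi
  rwa [LIM.act_one] at this

theorem spec_squaredNorm (n : ℕ) (hn : n ≤ D) {s : Store} {e : Edge n} {φ : Ket n}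
    (he : s.nodes.Den e φ) :
    Spec D (1 + 8 * n * compRank φ) s (squaredNorm n e) fun a _ => a = sqNorm φ := by
  induction n generalizing s with
  | zero =>
    unfold squaredNorm
    refine Spec.bind (Spec.tick (k := 2) (by have := one_le_tick (D := D); omega)) (by omega) ?_
    rintro _ _ - - ⟨k, rfl⟩
    match e with
    | none =>
      obtain rfl := he.none_elim
      exact Spec.pure fun _ => sqNorm_zero.symm
    | some (A, i) =>
      obtain ⟨hA, hi, rfl⟩ := he.some_elim
      refine Spec.pure fun _ => ?_
      rw [sqNorm_act]
      simp [sqNorm, Table.nodeKet]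
  | succ m ih =>
    refine Spec.intro fun hs => ?_
    unfold squaredNorm
    refine Spec.bind (Spec.charge (by norm_num) hn) (by omega) ?_
    rintro _ _ hs₁ - ⟨k, rfl⟩
    match e with
    | none =>
      obtain rfl := he.none_elim
      exact Spec.pure fun _ => sqNorm_zero.symm
    | some (A, v) =>
      have hφ0 := one_le_compRank (he.ne_zero hs.good)
      obtain ⟨hA, hv, rfl⟩ := he.some_elim
      rw [sqNorm_act]
      rw [compRank_act hA] at hφ0 ⊢
      have hone := Table.den_one hv
      have hsum := compRank_sub (s.nodes.nodeKet (m + 1) v)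
      have hK : 7 + 8 * m * compRank (sub false (s.nodes.nodeKet (m + 1) v)) +
          8 * m * compRank (sub true (s.nodes.nodeKet (m + 1) v)) ≤
          1 + 8 * (m + 1) * compRank (s.nodes.nodeKet (m + 1) v) := by
        rw [hsum] at hφ0 ⊢
        nlinarith
      generalize 1 + 8 * (m + 1) * compRank (s.nodes.nodeKet (m + 1) v) = K at hK ⊢
      refine Spec.bind Spec.get (by omega) ?_
      rintro _ _ - - ⟨rfl, rfl⟩
      refine Spec.bind (Spec.scan (scan_weight_le (by omega)) fun b hb => hb.norm _) (by omega) ?_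
      rintro hit _ - - ⟨hhit, k₃, rfl⟩
      match hit with
      | some a =>
        obtain ⟨-, h3⟩ := hs₁.norm _ _ _ (hhit a rfl)
        exact Spec.pure fun _ => by rw [h3]; rfl
      | none =>
        dsimp only
        refine Spec.bind (spec_follow (s := (s.addSteps k).addSteps k₃) hone false hn) (by omega) ?_
        rintro e₀ _ - - ⟨he₀, k₄, rfl⟩
        refine Spec.bind (ih (s := ((s.addSteps k).addSteps k₃).addSteps k₄) (by omega) he₀)
          (by omega) ?_
        rintro a₀ s₅ hs₅ hx₅ rfl
        have hx₅' : s.nodes.Ext s₅.nodes := hx₅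
        refine Spec.bind (spec_follow (hone.ext hx₅' hs.good.wf) true hn) (by omega) ?_
        rintro e₁ _ - - ⟨he₁, k₆, rfl⟩
        refine Spec.bind (ih (s := s₅.addSteps k₆) (by omega) he₁) (by omega) ?_
        rintro a₁ s₇ hs₇ hx₇ rfl
        have hx : s.nodes.Ext s₇.nodes := hx₅'.trans hx₇
        refine Spec.bind (spec_insertNorm (hx.hasNode hv) ?_) (by omega) ?_
        · rw [hx.nodeKet hs.good.wf hv, ← sqNorm_sub]
        · rintro _ _ - - -
          exact Spec.pure fun _ => by rw [← sqNorm_sub]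

theorem spec_squaredNormProjected (n : ℕ) (hn : n ≤ D) {s : Store} {e : Edge n} {φ : Ket n}
    (he : s.nodes.Den e φ) (q : Fin n) (y : Bool) :
    Spec D (1 + 8 * n * compRank φ) s (squaredNormProjected n e q y)
      fun a _ => a = sqNorm (projectKet q y φ) := by
  induction n generalizing s y with
  | zero => exact q.elim0
  | succ m ih =>
    refine Spec.intro fun hs => ?_
    unfold squaredNormProjected
    refine Spec.bind (Spec.charge (by norm_num) hn) (by omega) ?_
    rintro _ _ hs₁ - ⟨k, rfl⟩
    match e with
    | none =>
      obtain rfl := he.none_elim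
      exact Spec.pure fun _ => by rw [projectKet_zero, sqNorm_zero]
    | some (A, v) =>
      have hφ0 := one_le_compRank (he.ne_zero hs.good)
      obtain ⟨hA, hv, rfl⟩ := he.some_elim
      rw [projectKet_act, sqNorm_act]
      rw [compRank_act hA] at hφ0 ⊢
      have hone := Table.den_one hv
      have hsum := compRank_sub (s.nodes.nodeKet (m + 1) v)
      have hK : 7 + 8 * m * compRank (sub false (s.nodes.nodeKet (m + 1) v)) +
          8 * m * compRank (sub true (s.nodes.nodeKet (m + 1) v)) ≤
          1 + 8 * (m + 1) * compRank (s.nodes.nodeKet (m + 1) v) := by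
        rw [hsum] at hφ0 ⊢
        nlinarith
      generalize 1 + 8 * (m + 1) * compRank (s.nodes.nodeKet (m + 1) v) = K at hK ⊢
      dsimp only
      generalize xor y (A.ops q).xbit = b
      refine Spec.bind Spec.get (by omega) ?_
      rintro _ _ - - ⟨rfl, rfl⟩
      refine Spec.bind (Spec.scan (scan_weight_le (by omega)) fun b hb => hb.proj _) (by omega) ?_
      rintro hit _ - - ⟨hhit, k₃, rfl⟩
      match hit with
      | some a =>
        obtain ⟨-, h3⟩ := hs₁.proj _ _ _ _ _ (hhit a rfl)
        exact Spec.pure fun _ => by rw [h3]; rfl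
      | none =>
        dsimp only
        -- The common end of both cases: the value `a` is stored and scaled.
        have finish : ∀ (s' : Store) (a : ℝ) (K' : ℕ), 1 ≤ K' → s.nodes.Ext s'.nodes →
            a = sqNorm (projectKet q b (s.nodes.nodeKet (m + 1) v)) →
            Spec D K' s' (do
              modify fun s =>
                { s with
                  projCache := Function.update s.projCache (m + 1)
                    (((v, q, b), a) :: s.projCache (m + 1)) }
              pure (‖A.coeff‖ ^ 2 * a)) fun a _ =>
                a = ‖A.coeff‖ ^ 2 * sqNorm (projectKet q b (s.nodes.nodeKet (m + 1) v)) := by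
          rintro s' a K' hK' hx rfl
          refine Spec.bind (spec_insertProj (hx.hasNode hv) ?_) hK' ?_
          · rw [hx.nodeKet hs.good.wf hv]
          · rintro _ _ - - -
            exact Spec.pure fun _ => rfl
        split_ifs with hq
        · subst hq
          refine Spec.bind (spec_follow (s := (s.addSteps k).addSteps k₃) hone b hn) (by omega) ?_
          rintro f _ - - ⟨hf, k₄, rfl⟩
          refine Spec.bind (spec_squaredNorm (s := ((s.addSteps k).addSteps k₃).addSteps k₄) m
            (by omega) hf) (by cases b <;> omega) ?_
          rintro a s₅ - hx rfl
          refine finish _ _ _ (by cases b <;> omega) hx ?_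
          rw [sqNorm_sub (projectKet _ _ _), sub_projectKet_zero, sub_projectKet_zero]
          cases b <;> simp [sqNorm_zero]
        · obtain ⟨q, rfl⟩ := Fin.exists_succ_eq.mpr hq
          simp only [Fin.pred_succ]
          refine Spec.bind (spec_follow (s := (s.addSteps k).addSteps k₃) hone false hn)
            (by omega) ?_
          rintro e₀ _ - - ⟨he₀, k₄, rfl⟩
          refine Spec.bind (ih (s := ((s.addSteps k).addSteps k₃).addSteps k₄) (by omega) he₀ q b)
            (by omega) ?_
          rintro a₀ s₅ hs₅ hx₅ rfl
          have hx₅' : s.nodes.Ext s₅.nodes := hx₅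
          refine Spec.bind (spec_follow (hone.ext hx₅' hs.good.wf) true hn) (by omega) ?_
          rintro e₁ _ - - ⟨he₁, k₆, rfl⟩
          refine Spec.bind (ih (s := s₅.addSteps k₆) (by omega) he₁ q b) (by omega) ?_
          rintro a₁ s₇ hs₇ hx₇ rfl
          refine finish _ _ _ (by omega) (hx₅'.trans hx₇) ?_
          rw [sqNorm_sub (projectKet _ _ _), sub_projectKet_succ, sub_projectKet_succ]

theorem spec_measurementProbability (hn : n ≤ D) {s : Store} {e : Edge n} {φ : Ket n}
    (he : s.nodes.Den e φ) (hφ : sqNorm φ = 1) (q : Fin n) (y : Bool) :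
    Spec D (3 + 16 * n * compRank φ) s (measurementProbability e q y)
      fun a _ => a = bornProbability q y φ := by
  refine Spec.intro fun hs => ?_
  unfold measurementProbability
  refine Spec.bind (Spec.tick one_le_tick) (by omega) ?_
  rintro _ _ hs₁ - ⟨k, rfl⟩
  have h8 : 16 * n * compRank φ = 8 * n * compRank φ + 8 * n * compRank φ := by ring
  refine Spec.bind (spec_squaredNormProjected (s := s.addSteps k) n hn he q y) (by omega) ?_
  rintro p s₂ - hx rfl
  refine Spec.bind (spec_squaredNorm n hn (he.ext hx hs.good.wf)) (by omega) ?_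
  rintro t s₃ - - rfl
  exact Spec.pure fun _ => by rw [hφ, div_one]; rfl

theorem spec_updatePostMeas (n : ℕ) (hn : n ≤ D) {s : Store} {e : Edge n} {φ : Ket n}
    (he : s.nodes.Den e φ) (q : Fin n) (y : Bool) :
    Spec D (1 + 16 * n * compRank φ) s (updatePostMeas n e q y)
      fun a s' => s'.nodes.Den a (projectKet q y φ) := by
  induction n generalizing s y with
  | zero => exact q.elim0
  | succ m ih =>
    refine Spec.intro fun hs => ?_
    unfold updatePostMeas
    refine Spec.bind (Spec.charge (by norm_num) hn) (by omega) ?_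
    rintro _ _ hs₁ - ⟨k, rfl⟩
    match e with
    | none =>
      obtain rfl := he.none_elim
      exact Spec.pure fun _ => by rw [projectKet_zero]; exact Table.den_none
    | some (A, v) =>
      have hφ0 := one_le_compRank (he.ne_zero hs.good)
      obtain ⟨hA, hv, rfl⟩ := he.some_elim
      rw [projectKet_act]
      rw [compRank_act hA] at hφ0 ⊢
      have hone := Table.den_one hv
      have hsum := compRank_sub (s.nodes.nodeKet (m + 1) v)
      have hK : 14 + 16 * m * compRank (sub false (s.nodes.nodeKet (m + 1) v)) +
          16 * m * compRank (sub true (s.nodes.nodeKet (m + 1) v)) ≤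
          1 + 16 * (m + 1) * compRank (s.nodes.nodeKet (m + 1) v) := by
        rw [hsum] at hφ0 ⊢
        nlinarith
      generalize 1 + 16 * (m + 1) * compRank (s.nodes.nodeKet (m + 1) v) = K at hK ⊢
      dsimp only
      generalize xor y (A.ops q).xbit = b
      refine Spec.bind Spec.get (by omega) ?_
      rintro _ _ - - ⟨rfl, rfl⟩
      refine Spec.bind (Spec.scan (scan_weight_le (by omega)) fun b hb => hb.post _) (by omega) ?_
      rintro hit _ - - ⟨hhit, k₃, rfl⟩
      match hit with
      | some a =>
        obtain ⟨-, h3⟩ := hs₁.post _ _ _ _ _ (hhit a rfl)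
        exact Spec.pure fun _ => Table.Den.act h3 hA
      | none =>
        dsimp only
        -- The common end of both cases: the edge `a` is stored and multiplied by `A`.
        have finish : ∀ (s' : Store) (a : Edge (m + 1)) (K' : ℕ), 1 ≤ K' → s.nodes.Ext s'.nodes →
            s'.nodes.Den a (projectKet q b (s.nodes.nodeKet (m + 1) v)) →
            Spec D K' s' (do
              modify fun s =>
                { s with
                  postCache := Function.update s.postCache (m + 1)
                    (((v, q, b), a) :: s.postCache (m + 1)) }
              pure (Edge.act A a)) fun a s' =>
                s'.nodes.Den a (A.act (projectKet q b (s.nodes.nodeKet (m + 1) v))) := by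
          intro s' a K' hK' hx ha
          refine Spec.bind (spec_insertPost (hx.hasNode hv) ?_) hK' ?_
          · rw [hx.nodeKet hs.good.wf hv]; exact ha
          · rintro _ _ - - hnodes
            exact Spec.pure fun _ => by rw [hnodes]; exact ha.act hA
        split_ifs with hq hb
        · subst hq
          subst hb
          refine Spec.bind (spec_follow (s := (s.addSteps k).addSteps k₃) hone _ hn) (by omega) ?_
          rintro f _ - - ⟨hf, k₄, rfl⟩
          refine Spec.bind (spec_makeEdge (s := ((s.addSteps k).addSteps k₃).addSteps k₄)
            Table.den_none hf hn) (by omega) ?_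
          rintro a s₅ - hx ha
          refine finish _ _ _ (by omega) hx ?_
          rw [← join_sub (projectKet _ _ _), sub_projectKet_zero, sub_projectKet_zero]
          simpa using ha
        · subst hq
          obtain rfl : b = false := by simpa using hb
          refine Spec.bind (spec_follow (s := (s.addSteps k).addSteps k₃) hone _ hn) (by omega) ?_
          rintro f _ - - ⟨hf, k₄, rfl⟩
          refine Spec.bind (spec_makeEdge (s := ((s.addSteps k).addSteps k₃).addSteps k₄)
            hf Table.den_none hn) (by omega) ?_
          rintro a s₅ - hx ha
          refine finish _ _ _ (by omega) hx ?_
          rw [← join_sub (projectKet _ _ _), sub_projectKet_zero, sub_projectKet_zero]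
          simpa using ha
        · obtain ⟨q, rfl⟩ := Fin.exists_succ_eq.mpr hq
          simp only [Fin.pred_succ]
          refine Spec.bind (spec_follow (s := (s.addSteps k).addSteps k₃) hone false hn)
            (by omega) ?_
          rintro e₀ _ - - ⟨he₀, k₄, rfl⟩
          refine Spec.bind (ih (s := ((s.addSteps k).addSteps k₃).addSteps k₄) (by omega) he₀ q b)
            (by omega) ?_
          rintro a₀ s₅ hs₅ hx₅ ha₀
          have hx₅' : s.nodes.Ext s₅.nodes := hx₅
          refine Spec.bind (spec_follow (hone.ext hx₅' hs.good.wf) true hn) (by omega) ?_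
          rintro e₁ _ - - ⟨he₁, k₆, rfl⟩
          refine Spec.bind (ih (s := s₅.addSteps k₆) (by omega) he₁ q b) (by omega) ?_
          rintro a₁ s₇ hs₇ hx₇ ha₁
          refine Spec.bind (spec_makeEdge (ha₀.ext hx₇ hs₅.good.wf) ha₁ hn) (by omega) ?_
          rintro a s₈ - hx₈ ha
          refine finish _ _ _ (by omega) ((hx₅'.trans hx₇).trans hx₈) ?_
          rw [← sub_projectKet_succ, ← sub_projectKet_succ, join_sub] at ha
          exact ha

end Readout

/-! ### The subfunction rank and the computational-basis rank -/

theorem subRank_le_compRank {n : ℕ} (φ : Ket n) : subRank φ ≤ compRank φ := by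
  refine Finset.sup_le fun l _ => ?_
  -- Every nonzero subfunction is fixed by the first bits of some nonzero amplitude.
  have h : {f : Ket n | f ≠ 0 ∧ ∃ y : Fin n → Bool,
      f = fun x => φ (fun i => if i.val < l then y i else x i)} ⊆
      (fun (y x : Fin n → Bool) => φ (fun i => if i.val < l then y i else x i)) ''
        {x | φ x ≠ 0} := by
    rintro f ⟨hf, y, rfl⟩
    obtain ⟨x, hx⟩ := Function.ne_iff.mp hf
    refine ⟨fun i => if i.val < l then y i else x i, hx, ?_⟩
    funext z
    dsimp only
    congr 1
    funext i
    split_ifs <;> rfl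
  exact (Set.ncard_le_ncard h (Set.toFinite _)).trans (Set.ncard_image_le (Set.toFinite _))

/-! ### Controlled-X gates as permutations of basis states -/

section Permutation

variable {n : ℕ}

theorem fires_flipAll {role : Fin n → Role} {c : Fin n → Bool} :
    Fires role (flipAll role c) ↔ Fires role c := by
  refine forall_congr' fun j => forall_congr' fun b => imp_congr_right fun h => ?_
  simp [flipAll, h]

theorem flipAll_flipAll (role : Fin n → Role) (c : Fin n → Bool) :
    flipAll role (flipAll role c) = c := by
  funext i
  simp only [flipAll]
  split_ifs <;> simp

theorem flipTargets_involutive (role : Fin n → Role) : Function.Involutive (flipTargets role) := by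
  intro c
  by_cases h : Fires role c
  · rw [flipTargets_of_fires h, flipTargets_of_fires (fires_flipAll.mpr h), flipAll_flipAll]
  · rw [flipTargets_of_not_fires h, flipTargets_of_not_fires h]

theorem controlledX_mulVec (role : Fin n → Role) (φ : Ket n) :
    (Gate.controlledX role).mat.mulVec φ = φ ∘ flipTargets role := by
  funext x
  simp only [Matrix.mulVec, dotProduct, Gate.mat, Function.comp]
  rw [Finset.sum_eq_single (flipTargets role x)]
  · rw [flipTargets_involutive role x]; simp
  · intro c _ hc
    rw [if_neg, zero_mul]
    rintro rfl
    exact hc (flipTargets_involutive role c).symm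
  · simp

theorem compRank_comp {φ : Ket n} {π : (Fin n → Bool) → (Fin n → Bool)} (hπ : π.Bijective) :
    compRank (φ ∘ π) = compRank φ := by
  have h : {x | φ x ≠ 0} = π '' {x | (φ ∘ π) x ≠ 0} := by
    ext x
    constructor
    · intro hx
      obtain ⟨y, rfl⟩ := hπ.2 x
      exact ⟨y, hx, rfl⟩
    · rintro ⟨y, hy, rfl⟩; exact hy
  rw [compRank, compRank, h, Set.ncard_image_of_injective _ hπ.1]

theorem sqNorm_comp {φ : Ket n} {π : (Fin n → Bool) → (Fin n → Bool)} (hπ : π.Bijective) :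
    sqNorm (φ ∘ π) = sqNorm φ :=
  hπ.sum_comp fun x => ‖φ x‖ ^ 2

theorem evolve_controlledX_invariants (φ : Ket n) (L : List (Fin n → Role)) :
    compRank (evolve φ (L.map Gate.controlledX)) = compRank φ ∧
      sqNorm (evolve φ (L.map Gate.controlledX)) = sqNorm φ := by
  induction L generalizing φ with
  | nil => exact ⟨rfl, rfl⟩
  | cons r L ih =>
    have h := ih ((Gate.controlledX r).mat.mulVec φ)
    rw [controlledX_mulVec, compRank_comp (flipTargets_involutive r).bijective,
      sqNorm_comp (flipTargets_involutive r).bijective, ← controlledX_mulVec] at h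
    exact h

/-- The basis state to which a sequence of controlled-X gates takes `y`. -/
def flipAlong (L : List (Fin n → Role)) (y : Fin n → Bool) : Fin n → Bool :=
  L.foldl (fun y r => flipTargets r y) y

theorem flipAlong_injective (L : List (Fin n → Role)) : Function.Injective (flipAlong L) := by
  induction L with
  | nil => exact fun _ _ h => h
  | cons r L ih => exact fun _ _ h => (flipTargets_involutive r).injective (ih h)

theorem evolve_controlledX_flipAlong (φ : Ket n) (L : List (Fin n → Role)) (y : Fin n → Bool) :
    evolve φ (L.map Gate.controlledX) (flipAlong L y) = φ y := by
  induction L generalizing φ y with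
  | nil => rfl
  | cons r L ih =>
    have h := ih ((Gate.controlledX r).mat.mulVec φ) (flipTargets r y)
    rw [controlledX_mulVec, Function.comp_apply, flipTargets_involutive r y,
      ← controlledX_mulVec] at h
    exact h

theorem flipAlong_append (L M : List (Fin n → Role)) (y : Fin n → Bool) :
    flipAlong (L ++ M) y = flipAlong M (flipAlong L y) := List.foldl_append

theorem flipAlong_of_not_fires {L : List (Fin n → Role)} {y : Fin n → Bool}
    (h : ∀ r ∈ L, ¬ Fires r y) : flipAlong L y = y := by
  induction L with
  | nil => rfl
  | cons r L ih =>
    change flipAlong L (flipTargets r y) = y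
    rw [flipTargets_of_not_fires (h r List.mem_cons_self)]
    exact ih fun r hr => h r (List.mem_cons_of_mem _ hr)

/-- If exactly one gate of a sequence fires, and firing does not activate any other one, then the
sequence acts like this gate. -/
theorem flipAlong_of_unique_fires {α : Type*} {L : List α} (hL : L.Nodup) {f : α → Fin n → Role}
    {y : Fin n → Bool} {a : α} (ha : a ∈ L) (hfire : Fires (f a) y)
    (h : ∀ b ∈ L, b ≠ a → ¬ Fires (f b) y ∧ ¬ Fires (f b) (flipAll (f a) y)) :
    flipAlong (L.map f) y = flipAll (f a) y := by
  obtain ⟨l₁, l₂, rfl⟩ := List.append_of_mem ha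
  rw [List.nodup_append] at hL
  obtain ⟨-, h2, h3⟩ := hL
  rw [List.map_append, flipAlong_append, flipAlong_of_not_fires (L := l₁.map f) (y := y)]
  · change flipAlong (l₂.map f) (flipTargets (f a) y) = _
    rw [flipTargets_of_fires hfire, flipAlong_of_not_fires]
    intro r hr
    obtain ⟨b, hb, rfl⟩ := List.mem_map.mp hr
    exact (h b (by simp [hb]) (by rintro rfl; exact (List.nodup_cons.mp h2).1 hb)).2
  · intro r hr
    obtain ⟨b, hb, rfl⟩ := List.mem_map.mp hr
    exact (h b (by simp [hb]) (h3 b hb a List.mem_cons_self)).1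

end Permutation

/-! ### Uniform superpositions -/

section Uniform

variable {n : ℕ}

/-- The uniform superposition over the bits in `S`; the other bits are `0`. -/
noncomputable def uniformKet (S : Finset (Fin n)) : Ket n := fun x =>
  if ∀ i, x i = true → i ∈ S then ((1 / Real.sqrt 2 : ℝ) : ℂ) ^ S.card else 0

theorem uniformKet_empty : uniformKet (∅ : Finset (Fin n)) = zeroKet n := by
  funext x
  have h : (∀ i, x i = true → i ∈ (∅ : Finset (Fin n))) ↔ x = fun _ => false := by
    simp [funext_iff]
  simp only [uniformKet, zeroKet, h, Finset.card_empty, pow_zero]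

/-- Only the basis state in which bit `j` is reset to `0` contributes to the amplitude. -/
theorem hadamard_mulVec_uniformKet {S : Finset (Fin n)} {j : Fin n} (hj : j ∉ S) :
    (Gate.hadamard j).mat.mulVec (uniformKet S) = uniformKet (insert j S) := by
  funext x
  simp only [Matrix.mulVec, dotProduct, Gate.mat]
  rw [Finset.sum_eq_single (Function.update x j false)]
  · have h1 : ∀ i, i ≠ j → x i = Function.update x j false i := fun i hi => by simp [hi]
    have h2 : (∀ i, Function.update x j false i = true → i ∈ S) ↔
        ∀ i, x i = true → i ∈ insert j S := by
      refine forall_congr' fun i => ?_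
      by_cases hi : i = j
      · subst hi; simp
      · simp [hi]
    rw [if_pos h1]
    simp only [uniformKet, h2, Function.update_self, Bool.and_false,
      Finset.card_insert_of_notMem hj]
    split_ifs <;> simp_all [pow_succ, mul_comm]
  · intro c _ hc
    by_cases h : ∀ i, i ≠ j → x i = c i
    · have hcj : c j = true := by
        by_contra hcj
        apply hc
        funext i
        by_cases hi : i = j
        · subst hi; simpa using hcj
        · simp [hi, h i hi]
      have h0 : uniformKet S c = 0 := if_neg fun h => hj (h j hcj)
      rw [h0, mul_zero]
    · rw [if_neg h, zero_mul]
  · simp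

theorem evolve_hadamard {L : List (Fin n)} (hL : L.Nodup) :
    evolve (zeroKet n) (L.map Gate.hadamard) = uniformKet L.toFinset := by
  suffices h : ∀ (L : List (Fin n)) (S : Finset (Fin n)), L.Nodup → (∀ j ∈ L, j ∉ S) →
      evolve (uniformKet S) (L.map Gate.hadamard) = uniformKet (S ∪ L.toFinset) by
    rw [← uniformKet_empty, h L ∅ hL (by simp), Finset.empty_union]
  intro L
  induction L with
  | nil => intro S _ _; simp [evolve]
  | cons j L ih =>
    intro S hL hS
    change evolve ((Gate.hadamard j).mat.mulVec (uniformKet S)) (L.map Gate.hadamard) = _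
    rw [hadamard_mulVec_uniformKet (hS j List.mem_cons_self), ih _ (List.nodup_cons.mp hL).2]
    · congr 1
      ext i
      simp only [Finset.mem_union, Finset.mem_insert, List.mem_toFinset, List.mem_cons]
      tauto
    · intro i hi
      rw [Finset.mem_insert, not_or]
      exact ⟨by rintro rfl; exact (List.nodup_cons.mp hL).1 hi, hS i (List.mem_cons_of_mem _ hi)⟩

theorem card_supported (S : Finset (Fin n)) :
    (Finset.univ.filter fun x : Fin n → Bool => ∀ i, x i = true → i ∈ S).card = 2 ^ S.card := by
  rw [← Finset.card_powerset]
  refine Finset.card_bij (fun x _ => Finset.univ.filter fun i => x i = true) ?_ ?_ ?_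
  · intro x hx
    rw [Finset.mem_powerset]
    intro i hi
    exact (Finset.mem_filter.mp hx).2 i (Finset.mem_filter.mp hi).2
  · intro x _ y _ h
    funext i
    have := Finset.ext_iff.mp h i
    simp only [Finset.mem_filter, Finset.mem_univ, true_and] at this
    exact Bool.eq_iff_iff.mpr this
  · intro T hT
    refine ⟨fun i => decide (i ∈ T), ?_, ?_⟩
    · simpa using fun i hi => Finset.mem_powerset.mp hT hi
    · ext i; simp

theorem compRank_uniformKet (S : Finset (Fin n)) : compRank (uniformKet S) = 2 ^ S.card := by
  have h : {x | uniformKet S x ≠ 0} =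
      ↑(Finset.univ.filter fun x : Fin n → Bool => ∀ i, x i = true → i ∈ S) := by
    ext x
    simp [uniformKet]
  rw [compRank, h, Set.ncard_coe_finset, card_supported]

theorem norm_inv_sqrt_two_pow_sq (m : ℕ) :
    ‖((1 / Real.sqrt 2 : ℝ) : ℂ) ^ m‖ ^ 2 = (1 / 2 : ℝ) ^ m := by
  rw [norm_pow, Complex.norm_real, ← pow_mul, mul_comm m 2, pow_mul]
  simp

theorem sqNorm_uniformKet (S : Finset (Fin n)) : sqNorm (uniformKet S) = 1 := by
  have h : ∀ x, ‖uniformKet S x‖ ^ 2 =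
      if ∀ i, x i = true → i ∈ S then (1 / 2 : ℝ) ^ S.card else 0 := by
    intro x
    simp only [uniformKet]
    split_ifs
    · exact norm_inv_sqrt_two_pow_sq _
    · simp
  simp only [sqNorm, h]
  rw [← Finset.sum_filter, Finset.sum_const, card_supported, nsmul_eq_mul]
  push_cast
  rw [← mul_pow]
  norm_num

end Uniform

/-! ### The circuit for the W state -/

section Circuit

variable {k : ℕ}

/-- The Hamming weight of the `k` lowest bits. -/
theorem length_filter_testBit (k a : ℕ) :
    ((List.range k).filter a.testBit).length =
      ((Finset.range k).filter fun i => a.testBit i = true).card := by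
  rw [← List.toFinset_card_of_nodup (List.nodup_range.filter _)]
  congr 1
  ext i; simp

theorem mem_patterns {a : ℕ} : a ∈ patterns k ↔
    a < 2 ^ k ∧ ((Finset.range k).filter fun i => a.testBit i = true).card ≠ 1 := by
  rw [← length_filter_testBit]
  simp [patterns]

theorem nodup_patterns : (patterns k).Nodup := List.nodup_range.filter _

/-- There are at least `k` patterns of weight `1`, so the qubits of register `B` suffice. -/
theorem length_patterns_le : (patterns k).length + k ≤ 2 ^ k := by
  have h1 := List.length_eq_length_filter_add (l := List.range (2 ^ k))
    (fun a => decide (((List.range k).filter a.testBit).length ≠ 1))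
  rw [List.length_range] at h1
  have h2 : k ≤ ((List.range (2 ^ k)).filter
      (fun a => !decide (((List.range k).filter a.testBit).length ≠ 1))).length := by
    have hnd : ((List.range k).map fun j => 2 ^ j).Nodup :=
      List.nodup_range.map (Nat.pow_right_injective le_rfl)
    have hsub : ((List.range k).map fun j => 2 ^ j) ⊆ (List.range (2 ^ k)).filter
        (fun a => !decide (((List.range k).filter a.testBit).length ≠ 1)) := by
      intro a ha
      obtain ⟨j, hj, rfl⟩ := List.mem_map.mp ha
      have hj' := List.mem_range.mp hj
      rw [List.mem_filter, List.mem_range, length_filter_testBit]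
      refine ⟨Nat.pow_lt_pow_right (by norm_num) hj', ?_⟩
      have : ((Finset.range k).filter fun i => (2 ^ j).testBit i = true) = {j} := by
        ext i
        simp only [Nat.testBit_two_pow, decide_eq_true_eq, Finset.mem_filter, Finset.mem_range,
          Finset.mem_singleton]
        constructor
        · rintro ⟨_, rfl⟩; rfl
        · rintro rfl; exact ⟨hj', rfl⟩
      simp [this]
    simpa using (hnd.subperm hsub).length_le
  unfold patterns
  omega

/-- The gate that flips the qubit of a pattern if register `A` is in that pattern. -/
def markRole (k : ℕ) (ai : ℕ × ℕ) : Fin (2 ^ k) → Role := fun q =>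
  if q.val < k then Role.control (ai.1.testBit q.val)
  else if q.val = k + ai.2 then Role.target else Role.idle

/-- The gate that erases a pattern from register `A` if its qubit is set. -/
def eraseRole (k : ℕ) (ai : ℕ × ℕ) : Fin (2 ^ k) → Role := fun q =>
  if q.val < k then (if ai.1.testBit q.val then Role.target else Role.idle)
  else if q.val = k + ai.2 then Role.control true else Role.idle

/-- The controlled-X gates of the circuit. -/
def flipRoles (k : ℕ) : List (Fin (2 ^ k) → Role) :=
  (patterns k).zipIdx.map (markRole k) ++
    ((patterns k).zipIdx.filter fun ai => decide (ai.1 ≠ 0)).map (eraseRole k)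

/-- The qubits of register `A`. -/
def registerA (k : ℕ) : List (Fin (2 ^ k)) :=
  (List.finRange (2 ^ k)).filter fun j => decide (j.val < k)

theorem wCircuit_eq : wCircuit k =
    (registerA k).map Gate.hadamard ++ (flipRoles k).map Gate.controlledX := by
  simp only [wCircuit, registerA, flipRoles, List.map_append, List.map_map, List.append_assoc]
  rfl

theorem nodup_registerA : (registerA k).Nodup := (List.nodup_finRange _).filter _

theorem card_registerA : (registerA k).toFinset.card = k := by
  have h : (registerA k).toFinset.map Fin.valEmbedding = Finset.range k := by
    ext i
    simp only [Finset.mem_map, List.mem_toFinset, registerA, List.mem_filter, List.mem_finRange,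
      true_and, decide_eq_true_eq, Fin.valEmbedding_apply, Finset.mem_range]
    constructor
    · rintro ⟨j, hj, rfl⟩; exact hj
    · intro hi; exact ⟨⟨i, hi.trans Nat.lt_two_pow_self⟩, hi, rfl⟩
  rw [← Finset.card_map, h, Finset.card_range]

theorem length_registerA : (registerA k).length = k := by
  rw [← List.toFinset_card_of_nodup nodup_registerA, card_registerA]

/-- All intermediate states are unit vectors with at most `2 ^ k` nonzero amplitudes. -/
theorem wCircuit_state (t : ℕ) : compRank (runCircuit ((wCircuit k).take t)) ≤ 2 ^ k ∧
    sqNorm (runCircuit ((wCircuit k).take t)) = 1 := by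
  have h : runCircuit ((wCircuit k).take t) =
      evolve (uniformKet ((registerA k).take t).toFinset)
        (((flipRoles k).take (t - (registerA k).length)).map Gate.controlledX) := by
    rw [← evolve_hadamard (nodup_registerA.sublist (List.take_sublist _ _)), wCircuit_eq,
      List.take_append, List.length_map, List.map_take, List.map_take]
    exact List.foldl_append
  obtain ⟨h1, h2⟩ := evolve_controlledX_invariants (uniformKet ((registerA k).take t).toFinset)
    ((flipRoles k).take (t - (registerA k).length))
  rw [h, h1, h2, compRank_uniformKet]
  refine ⟨Nat.pow_le_pow_right (by norm_num) ?_, sqNorm_uniformKet _⟩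
  refine (List.toFinset_card_le _).trans ?_
  rw [List.length_take, length_registerA]
  exact Nat.min_le_right _ _

theorem length_wCircuit_le : (wCircuit k).length ≤ 3 * 2 ^ k := by
  have h1 := length_patterns_le (k := k)
  have h2 : ((patterns k).zipIdx.filter fun ai => decide (ai.1 ≠ 0)).length ≤
      (patterns k).zipIdx.length := List.length_filter_le _ _
  have h3 : k < 2 ^ k := Nat.lt_two_pow_self
  rw [wCircuit_eq, flipRoles]
  simp only [List.length_append, List.length_map, length_registerA, List.length_zipIdx] at h2 ⊢
  omega

theorem registerA_lt {q : Fin (2 ^ k)} : q ∈ (registerA k).toFinset ↔ q.val < k := by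
  simp [registerA]

/-- The pattern that the qubits of register `A` form in a basis state. -/
def patternOf (y : Fin (2 ^ k) → Bool) : ℕ :=
  Nat.ofBits fun j : Fin k => y ⟨j.val, j.isLt.trans Nat.lt_two_pow_self⟩

theorem patternOf_lt (y : Fin (2 ^ k) → Bool) : patternOf y < 2 ^ k := Nat.ofBits_lt_two_pow _

theorem testBit_patternOf (y : Fin (2 ^ k) → Bool) {q : Fin (2 ^ k)} (hq : q.val < k) :
    (patternOf y).testBit q.val = y q := Nat.testBit_ofBits_lt _ _ hq

theorem eq_patternOf {y : Fin (2 ^ k) → Bool} {a : ℕ} (ha : a < 2 ^ k)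
    (h : ∀ q : Fin (2 ^ k), q.val < k → y q = a.testBit q.val) : a = patternOf y := by
  refine Nat.eq_of_testBit_eq fun i => ?_
  by_cases hi : i < k
  · have hi' : i < 2 ^ k := hi.trans Nat.lt_two_pow_self
    rw [← h ⟨i, hi'⟩ hi]
    exact (testBit_patternOf y (q := ⟨i, hi'⟩) hi).symm
  · have hle : 2 ^ k ≤ 2 ^ i := Nat.pow_le_pow_right (by norm_num) (not_lt.mp hi)
    rw [Nat.testBit_lt_two_pow (ha.trans_le hle),
      Nat.testBit_lt_two_pow ((patternOf_lt y).trans_le hle)]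

theorem fires_markRole {ai : ℕ × ℕ} (ha : ai.1 < 2 ^ k) {y : Fin (2 ^ k) → Bool} :
    Fires (markRole k ai) y ↔ ai.1 = patternOf y := by
  constructor
  · exact fun h => eq_patternOf ha fun q hq => h q _ (by simp [markRole, hq])
  · rintro h q b hb
    by_cases hq : q.val < k
    · simp only [markRole, hq, if_true, Role.control.injEq] at hb
      rw [← hb, h, testBit_patternOf y hq]
    · simp only [markRole, hq, if_false] at hb
      split_ifs at hb

theorem fires_eraseRole {ai : ℕ × ℕ} (hi : k + ai.2 < 2 ^ k) {y : Fin (2 ^ k) → Bool} :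
    Fires (eraseRole k ai) y ↔ y ⟨k + ai.2, hi⟩ = true := by
  constructor
  · exact fun h => h ⟨k + ai.2, hi⟩ true (by simp [eraseRole])
  · rintro h q b hb
    by_cases hq : q.val < k
    · simp only [eraseRole, hq, if_true] at hb
      split_ifs at hb
    · simp only [eraseRole, hq, if_false] at hb
      split_ifs at hb with hq'
      obtain rfl : q = ⟨k + ai.2, hi⟩ := Fin.ext hq'
      rw [h]
      simpa using hb

theorem mem_zipIdx_patterns {ai : ℕ × ℕ} (h : ai ∈ (patterns k).zipIdx) :
    ai.1 ∈ patterns k ∧ k + ai.2 < 2 ^ k := by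
  have h1 := List.mem_zipIdx_iff_getElem?.mp h
  obtain ⟨hlt, h2⟩ := List.getElem?_eq_some_iff.mp h1
  have := length_patterns_le (k := k)
  exact ⟨h2 ▸ List.getElem_mem hlt, by omega⟩

theorem zipIdx_patterns_injective {ai bj : ℕ × ℕ} (h : ai ∈ (patterns k).zipIdx)
    (h' : bj ∈ (patterns k).zipIdx) : ai.1 = bj.1 ↔ ai.2 = bj.2 := by
  obtain ⟨hlt, h1⟩ := List.getElem?_eq_some_iff.mp (List.mem_zipIdx_iff_getElem?.mp h)
  obtain ⟨hlt', h2⟩ := List.getElem?_eq_some_iff.mp (List.mem_zipIdx_iff_getElem?.mp h')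
  rw [← h1, ← h2]
  exact nodup_patterns.getElem_inj_iff

/-- The number of ones of a basis state. -/
def weight {n : ℕ} (x : Fin n → Bool) : ℕ := (Finset.univ.filter fun i => x i = true).card

theorem weight_patternOf {y : Fin (2 ^ k) → Bool} (hy : ∀ q, y q = true → q.val < k) :
    weight y = ((Finset.range k).filter fun i => (patternOf y).testBit i = true).card := by
  rw [weight, ← Finset.card_map Fin.valEmbedding]
  congr 1
  ext i
  simp only [Finset.mem_map, Finset.mem_filter, Finset.mem_univ, true_and, Fin.valEmbedding_apply,
    Finset.mem_range]
  constructor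
  · rintro ⟨q, hq, rfl⟩
    exact ⟨hy q hq, by rw [testBit_patternOf y (hy q hq)]; exact hq⟩
  · rintro ⟨hi, h⟩
    refine ⟨⟨i, hi.trans Nat.lt_two_pow_self⟩, ?_, rfl⟩
    rw [← testBit_patternOf y (q := ⟨i, hi.trans Nat.lt_two_pow_self⟩) hi]
    exact h

/-- A basis state with register `B` cleared is taken to a basis state of weight `1`: if its pattern
has another weight, then it is moved to the qubit of `B` that belongs to it. -/
theorem weight_flipAlong {y : Fin (2 ^ k) → Bool} (hy : ∀ q, y q = true → q.val < k) :
    weight (flipAlong (flipRoles k) y) = 1 := by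
  have hyB : ∀ q : Fin (2 ^ k), ¬ q.val < k → y q = false := fun q hq => by
    by_contra h; exact hq (hy q (by simpa using h))
  have herase : ∀ ai ∈ (patterns k).zipIdx, ¬ Fires (eraseRole k ai) y := by
    intro ai hai
    rw [fires_eraseRole (mem_zipIdx_patterns hai).2, hyB _ (by simp)]
    simp
  rw [flipRoles, flipAlong_append]
  by_cases hmem : patternOf y ∈ patterns k
  · obtain ⟨i, hi, hi'⟩ := List.mem_iff_getElem.mp hmem
    have hai : (patternOf y, i) ∈ (patterns k).zipIdx :=
      List.mem_zipIdx_iff_getElem?.mpr (by rw [List.getElem?_eq_getElem hi, hi'])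
    have hlt := (mem_zipIdx_patterns hai).2
    dsimp only at hlt
    have hnd : (patterns k).zipIdx.Nodup := by
      refine List.Nodup.of_map Prod.fst ?_
      rw [List.zipIdx_map_fst]
      exact nodup_patterns
    have hmark : flipAll (markRole k (patternOf y, i)) y =
        fun q => if q = ⟨k + i, hlt⟩ then true else y q := by
      funext q
      have hq' : q = ⟨k + i, hlt⟩ ↔ q.val = k + i := Fin.ext_iff
      simp only [flipAll, markRole, hq']
      by_cases hq : q.val < k
      · rw [if_pos hq, if_neg (by simp), if_neg (by omega)]
      · rw [if_neg hq]
        split_ifs <;> simp_all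
    have hpat : patternOf (flipAll (markRole k (patternOf y, i)) y) = patternOf y := by
      refine (eq_patternOf (patternOf_lt y) fun q hq => ?_).symm
      rw [hmark, testBit_patternOf y hq]
      have : q ≠ ⟨k + i, hlt⟩ := fun h => by rw [h] at hq; simp at hq
      simp [this]
    rw [flipAlong_of_unique_fires hnd hai ((fires_markRole (patternOf_lt y)).mpr rfl)]
    · have hB : ∀ bj ∈ (patterns k).zipIdx,
          (Fires (eraseRole k bj) (flipAll (markRole k (patternOf y, i)) y) ↔ bj.2 = i) := by
        intro bj hbj
        rw [fires_eraseRole (mem_zipIdx_patterns hbj).2, hmark]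
        by_cases h : bj.2 = i
        · simp [h]
        · have := hyB ⟨k + bj.2, (mem_zipIdx_patterns hbj).2⟩ (by simp)
          simp [h, this]
      have hfinal : flipAlong (((patterns k).zipIdx.filter fun ai => decide (ai.1 ≠ 0)).map
          (eraseRole k)) (flipAll (markRole k (patternOf y, i)) y) =
          fun q => decide (q = ⟨k + i, hlt⟩) := by
        by_cases h0 : patternOf y = 0
        · -- The pattern `0` need not be erased.
          rw [flipAlong_of_not_fires, hmark]
          · funext q
            by_cases hq : q = ⟨k + i, hlt⟩
            · simp [hq]
            · by_cases hqk : q.val < k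
              · rw [← testBit_patternOf y hqk, h0]; simp [hq]
              · simp [hq, hyB q hqk]
          · intro r hr
            obtain ⟨bj, hbj, rfl⟩ := List.mem_map.mp hr
            obtain ⟨hbj, hne⟩ := List.mem_filter.mp hbj
            rw [hB bj hbj]
            intro h
            have := (zipIdx_patterns_injective hbj hai).mpr h
            simp [this, h0] at hne
        · have hai' : (patternOf y, i) ∈ (patterns k).zipIdx.filter fun ai => decide (ai.1 ≠ 0) :=
            List.mem_filter.mpr ⟨hai, by simpa using h0⟩
          rw [flipAlong_of_unique_fires (hnd.filter _) hai' ((hB _ hai).mpr rfl)]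
          · funext q
            rw [hmark]
            simp only [flipAll, eraseRole]
            by_cases hq : q.val < k
            · have hne : q ≠ ⟨k + i, hlt⟩ := fun h => by rw [h] at hq; simp at hq
              rw [if_pos hq, testBit_patternOf y hq]
              cases h : y q <;> simp [hne]
            · have hyq := hyB q hq
              rw [if_neg hq, hyq]
              by_cases hq' : q = ⟨k + i, hlt⟩
              · simp [hq']
              · have hqi : q.val ≠ k + i := fun h => hq' (Fin.ext h)
                simp [hq', hqi]
          · intro bj hbj hne
            obtain ⟨hbj, -⟩ := List.mem_filter.mp hbj
            have h2 : bj.2 ≠ i := fun h =>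
              hne (Prod.ext ((zipIdx_patterns_injective hbj hai).mpr h) h)
            refine ⟨fun h => h2 ((hB bj hbj).mp h), ?_⟩
            rw [fires_eraseRole (mem_zipIdx_patterns hbj).2]
            have := hyB ⟨k + bj.2, (mem_zipIdx_patterns hbj).2⟩ (by simp)
            rw [hmark]
            simp [flipAll, eraseRole, h2, this]
      rw [hfinal, weight]
      have : (Finset.univ.filter fun q : Fin (2 ^ k) =>
          decide (q = ⟨k + i, hlt⟩) = true) = {⟨k + i, hlt⟩} := by
        ext q; simp
      rw [this, Finset.card_singleton]
    · intro bj hbj hne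
      have h1 : bj.1 ≠ patternOf y := fun h =>
        hne (Prod.ext h ((zipIdx_patterns_injective hbj hai).mp h))
      have hbj1 := (mem_patterns.mp (mem_zipIdx_patterns hbj).1).1
      rw [fires_markRole hbj1, fires_markRole hbj1, hpat]
      exact ⟨h1, h1⟩
  · rw [flipAlong_of_not_fires (L := (patterns k).zipIdx.map (markRole k)) (y := y),
      flipAlong_of_not_fires]
    · rw [weight_patternOf hy]
      by_contra h
      exact hmem (mem_patterns.mpr ⟨patternOf_lt y, h⟩)
    · intro r hr
      obtain ⟨ai, hai, rfl⟩ := List.mem_map.mp hr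
      exact herase ai (List.mem_filter.mp hai).1
    · intro r hr
      obtain ⟨ai, hai, rfl⟩ := List.mem_map.mp hr
      have hmem' := (mem_zipIdx_patterns hai).1
      rw [fires_markRole (mem_patterns.mp hmem').1]
      exact fun h => hmem (h ▸ hmem')

theorem card_weight_one (n : ℕ) :
    (Finset.univ.filter fun x : Fin n → Bool => weight x = 1).card = n := by
  have h : (Finset.univ.filter fun x : Fin n → Bool => weight x = 1) =
      Finset.univ.image fun (j : Fin n) (i : Fin n) => decide (i = j) := by
    ext x
    simp only [Finset.mem_filter, Finset.mem_univ, true_and, Finset.mem_image, weight,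
      Finset.card_eq_one]
    refine exists_congr fun j => ?_
    simp only [Finset.ext_iff, Finset.mem_filter, Finset.mem_univ, true_and, Finset.mem_singleton,
      funext_iff]
    refine forall_congr' fun i => ?_
    cases x i <;> by_cases hij : i = j <;> simp [hij]
  rw [h, Finset.card_image_of_injective, Finset.card_univ, Fintype.card_fin]
  intro j j' h
  have := congrFun h j
  simpa using this

/-- The controlled-X gates map the support of the uniform superposition onto the basis states of
weight `1`, since both sets have `2 ^ k` elements. -/
theorem runCircuit_wCircuit : runCircuit (wCircuit k) = wKet (2 ^ k) := by
  have h : runCircuit (wCircuit k) =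
      evolve (uniformKet (registerA k).toFinset) ((flipRoles k).map Gate.controlledX) := by
    rw [← evolve_hadamard nodup_registerA, wCircuit_eq]
    exact List.foldl_append
  set S := Finset.univ.filter fun x : Fin (2 ^ k) → Bool => ∀ i, x i = true →
    i ∈ (registerA k).toFinset with hS
  have himage : S.image (flipAlong (flipRoles k)) =
      Finset.univ.filter fun x : Fin (2 ^ k) → Bool => weight x = 1 := by
    refine Finset.eq_of_subset_of_card_le ?_ ?_
    · intro x hx
      obtain ⟨y, hy, rfl⟩ := Finset.mem_image.mp hx
      refine Finset.mem_filter.mpr ⟨Finset.mem_univ _, weight_flipAlong fun q hq => ?_⟩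
      exact registerA_lt.mp ((Finset.mem_filter.mp hy).2 q hq)
    · rw [card_weight_one, Finset.card_image_of_injective _ (flipAlong_injective _), hS,
        card_supported, card_registerA]
  funext x
  obtain ⟨y, rfl⟩ := (flipAlong_injective (flipRoles k)).bijective_of_finite.2 x
  rw [h, evolve_controlledX_flipAlong]
  have hiff : (∀ i, y i = true → i ∈ (registerA k).toFinset) ↔
      weight (flipAlong (flipRoles k) y) = 1 := by
    have h1 : y ∈ S ↔ flipAlong (flipRoles k) y ∈ S.image (flipAlong (flipRoles k)) :=
      ((flipAlong_injective _).mem_finset_image).symm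
    rw [himage] at h1
    simpa [hS] using h1
  have hamp : ((1 / Real.sqrt 2 : ℝ) : ℂ) ^ k = ((1 / Real.sqrt (2 ^ k : ℕ) : ℝ) : ℂ) := by
    rw [← Complex.ofReal_pow]
    congr 1
    rw [div_pow, one_pow]
    congr 1
    push_cast
    rw [Real.sqrt_eq_rpow, Real.sqrt_eq_rpow, ← Real.rpow_natCast, ← Real.rpow_natCast,
      ← Real.rpow_mul (by norm_num), ← Real.rpow_mul (by norm_num), mul_comm]
  simp only [uniformKet, wKet, card_registerA, hamp]
  exact if_congr hiff rfl rfl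

end Circuit

/-! ### The polynomial bound -/

theorem Table.nodesBelow_subset {T : Table} (hT : T.WellFormed) {b : ℕ} (hb : ∀ m, (T m).length ≤ b)
    {n i : ℕ} (hi : T.HasNode n i) :
    T.nodesBelow n i ⊆ Finset.range (n + 1) ×ˢ Finset.range (b + 1) := by
  induction n generalizing i with
  | zero => simp [nodesBelow]
  | succ m ih =>
    obtain ⟨v, hv, hmem⟩ := hi.exists_node
    obtain ⟨h0, h1, -⟩ := hT m v hmem
    have hle : Finset.range (m + 1) ×ˢ Finset.range (b + 1) ⊆
        Finset.range (m + 1 + 1) ×ˢ Finset.range (b + 1) :=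
      Finset.product_subset_product_left (Finset.range_subset_range.mpr (Nat.le_succ _))
    rw [nodesBelow, hv]
    refine Finset.insert_subset ?_
      (Finset.union_subset ((ih h0).trans hle) ((ih h1).trans hle))
    have hi' : i < (T m).length := hi
    have := hb m
    simp only [Finset.mem_product, Finset.mem_range]
    omega

/-- A diagram has at most `n + 1` levels, each with at most as many nodes as its table. -/
theorem Table.size_le {T : Table} (hT : T.WellFormed) {b : ℕ} (hb : ∀ m, (T m).length ≤ b) {n : ℕ}
    {e : Edge n} {φ : Ket n} (he : T.Den e φ) : T.size e ≤ (n + 1) * (b + 1) := by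
  match e with
  | none => exact Nat.zero_le _
  | some (A, i) =>
    refine (Finset.card_le_card (nodesBelow_subset hT hb (he.1 A i rfl).2)).trans ?_
    rw [Finset.card_product, Finset.card_range, Finset.card_range]

theorem Store.inv_empty : Store.empty.Inv where
  good := ⟨fun _ _ h => by simp [empty] at h, fun _ _ h => by simp [empty] at h⟩
  gens_length _ := rfl
  gens n v hv := by
    cases n with
    | zero => exact ⟨Nat.zero_le _, fun _ h => absurd h List.not_mem_nil⟩
    | succ m => exact absurd hv (Nat.not_lt_zero v)
  add _ _ _ _ _ h := by simp [empty] at h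
  apply _ _ _ _ _ _ h := by simp [empty] at h
  norm _ _ _ h := by simp [empty] at h
  proj _ _ _ _ _ h := by simp [empty] at h
  post _ _ _ _ _ h := by simp [empty] at h

theorem Store.bounded_empty : Store.empty.Bounded 0 :=
  ⟨fun _ => le_rfl, fun _ => le_rfl, fun _ => le_rfl, fun _ => le_rfl, fun _ => le_rfl,
    fun _ => le_rfl⟩

theorem Spec.steps_le {α : Type} {D K : ℕ} {s : Store} {x : Sim α} {Q : α → Store → Prop}
    (h : Spec D K s x Q) (hs : s.Inv) {b c : ℕ} (hb : s.Bounded b) (hc : b + K ≤ c) :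
    (x.run s).2.steps ≤ s.steps + c * opCost D c :=
  ((h hs).2.2.1 b hb).2.trans (Nat.add_le_add_left
    (Nat.mul_le_mul ((Nat.le_add_left _ _).trans hc) (opCost_mono D hc)) _)

/-- A bound for the number of operations in the simulation of the circuit on `X` qubits. -/
noncomputable def simulationOps : Polynomial ℕ :=
  2 + 7 * .X + 3 * .X * (3 + 85 * .X + (30 + 8 * .X ^ 2) * (2 * (.X + 1) * .X))

/-- A bound for the number of operations in the simulation of the circuit on `X` qubits, followed by
one readout. -/
noncomputable def totalOps : Polynomial ℕ := simulationOps + (4 + 2 * .X + 16 * .X * .X)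

/-- A bound for the steps, and also for the number of nodes. -/
noncomputable def stepBound : Polynomial ℕ :=
  totalOps * (300 * (2 * .X + 2) ^ 3 * (totalOps + 1)) + (.X + 1) * (simulationOps + 1)

theorem eval_simulationOps (n : ℕ) : simulationOps.eval n =
    2 + 7 * n + 3 * n * (3 + 85 * n + (30 + 8 * n ^ 2) * (2 * (n + 1) * n)) := by
  simp [simulationOps]

theorem eval_totalOps (n : ℕ) :
    totalOps.eval n = simulationOps.eval n + (4 + 2 * n + 16 * n * n) := by
  simp [totalOps]

theorem eval_stepBound (n : ℕ) : stepBound.eval n =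
    totalOps.eval n * opCost (2 * n) (totalOps.eval n) + (n + 1) * (simulationOps.eval n + 1) := by
  simp [stepBound, opCost]

end Limdd

theorem mainTheorem5 :
    ∃ p : Polynomial ℕ, ∀ k : ℕ,
      Limdd.runCircuit (Limdd.wCircuit k) = Limdd.wKet (2 ^ k) ∧
      ∃ (edges : List (Limdd.Edge (2 ^ k))) (s : Limdd.Store),
        (Limdd.simulate (Limdd.wCircuit k)).run Limdd.Store.empty = (edges, s) ∧
        s.steps ≤ p.eval (2 ^ k) ∧
        edges.length = (Limdd.wCircuit k).length + 1 ∧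
        ∀ (t : ℕ) (e : Limdd.Edge (2 ^ k)) (ψ : Limdd.Ket (2 ^ k)),
          edges[t]? = some e → ψ = Limdd.runCircuit ((Limdd.wCircuit k).take t) →
          s.nodes.Represents e ψ ∧
          s.nodes.size e ≤ p.eval (2 ^ k) ∧
          Limdd.subRank ψ ≤ Limdd.compRank ψ ∧ Limdd.compRank ψ ≤ 2 ^ k ∧
          (∀ x : Fin (2 ^ k) → Bool,
            ((Limdd.amplitude (2 ^ k) e x).run s).1 = ψ x ∧
            ((Limdd.amplitude (2 ^ k) e x).run s).2.steps ≤ s.steps + p.eval (2 ^ k)) ∧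
          (∀ (q : Fin (2 ^ k)) (y : Bool),
            ((Limdd.measurementProbability e q y).run s).1 = Limdd.bornProbability q y ψ ∧
            ((Limdd.measurementProbability e q y).run s).2.steps ≤ s.steps + p.eval (2 ^ k)) ∧
          (∀ (q : Fin (2 ^ k)) (y : Bool),
            ((Limdd.updatePostMeas (2 ^ k) e q y).run s).2.nodes.Represents
              ((Limdd.updatePostMeas (2 ^ k) e q y).run s).1 (Limdd.projectKet q y ψ) ∧
            ((Limdd.updatePostMeas (2 ^ k) e q y).run s).2.steps ≤ s.steps + p.eval (2 ^ k)) := by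
  -- The diagrams of the gates have `2 * n` levels, hence the bound `2 * 2 ^ k` for levels.
  refine ⟨Limdd.stepBound, fun k => ⟨Limdd.runCircuit_wCircuit, ?_⟩⟩
  have hn : 2 ^ k ≤ 2 * 2 ^ k := by omega
  have hspec := Limdd.spec_simulate (s := Limdd.Store.empty) (D := 2 * 2 ^ k) (Limdd.wCircuit k)
    le_rfl (fun t => (Limdd.wCircuit_state t).1)
  obtain ⟨hinv, -, hsteps, hlen, hden⟩ := hspec Limdd.Store.inv_empty
  have hops := hsteps.mono (k' := Limdd.simulationOps.eval (2 ^ k)) (by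
    rw [Limdd.eval_simulationOps]
    have := Limdd.length_wCircuit_le (k := k)
    gcongr)
  obtain ⟨hbound, hcost⟩ := hops 0 Limdd.Store.bounded_empty
  generalize (Limdd.simulate (Limdd.wCircuit k)).run Limdd.Store.empty = r at *
  obtain ⟨edges, s⟩ := r
  dsimp only at *
  rw [Nat.zero_add] at hbound hcost
  have hp := Limdd.eval_stepBound (2 ^ k)
  have hle : Limdd.simulationOps.eval (2 ^ k) ≤ Limdd.totalOps.eval (2 ^ k) := by
    rw [Limdd.eval_totalOps]; omega
  refine ⟨edges, s, rfl, ?_, hlen, ?_⟩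
  · have h0 : Limdd.Store.empty.steps = 0 := rfl
    have := Nat.mul_le_mul hle (Limdd.opCost_mono (2 * 2 ^ k) hle)
    omega
  rintro t e _ ht rfl
  have he := hden t e ht
  obtain ⟨hrank, hnorm⟩ := Limdd.wCircuit_state (k := k) t
  generalize Limdd.runCircuit ((Limdd.wCircuit k).take t) = ψ at *
  -- The number of operations of each of the three readouts is within the given bound.
  have hread : ∀ {α : Type} {K : ℕ} {x : Limdd.Sim α} {Q : α → Limdd.Store → Prop},
      Limdd.Spec (2 * 2 ^ k) K s x Q → K ≤ 4 + 2 * 2 ^ k + 16 * 2 ^ k * 2 ^ k →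
      (x.run s).2.steps ≤ s.steps + Limdd.stepBound.eval (2 ^ k) := by
    intro α K x Q h hK
    have := h.steps_le hinv hbound (c := Limdd.totalOps.eval (2 ^ k))
      (by rw [Limdd.eval_totalOps]; omega)
    omega
  have hrank' : 16 * 2 ^ k * Limdd.compRank ψ ≤ 16 * 2 ^ k * 2 ^ k := Nat.mul_le_mul_left _ hrank
  refine ⟨⟨hinv.good.wf, he⟩, ?_, Limdd.subRank_le_compRank ψ, hrank, fun x => ?_, fun q y => ?_,
    fun q y => ?_⟩
  · have := Limdd.Table.size_le hinv.good.wf hbound.nodes he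
    omega
  · have h := Limdd.spec_amplitude (2 ^ k) hn he x
    exact ⟨(h hinv).2.2.2, hread h (by omega)⟩
  · have h := Limdd.spec_measurementProbability hn he hnorm q y
    exact ⟨(h hinv).2.2.2, hread h (by omega)⟩
  · have h := Limdd.spec_updatePostMeas (2 ^ k) hn he q y
    exact ⟨⟨(h hinv).1.good.wf, (h hinv).2.2.2⟩, hread h (by omega)⟩
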